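/- Let $B_n$ be the braid group on $n$ strands with Artin generators $\sigma_1,\dots,\sigma_{n-1}$, let $\Delta_n=\delta_n\delta_{n-1}\cdots\delta_2$ with $\delta_m=\sigma_1\sigma_2\cdots\sigma_{m-1}$, and let $\theta_n=\Delta_n^2$ be the full twist. For $r\ge 2$ put $q=e^{\pi \mathsf i/r}$, $q^{1/2}=e^{\pi\mathsf i/2r}$, $\{x\}=q^x-q^{-x}$, $[x]=\{x\}/\{1\}$, $\{a\}!=\{a\}\{a-1\}\cdots\{1\}$. Let $\mathsf V_{r-1}$ be the complex vector space with basis $u_0,\dots,u_{r-1}$ and the operators $$k\,u_m=q^{(r-1-2m)/2}u_m,\quad E\,u_m=u_{m-1},\quad F\,u_m=[m+1][r-1-m]\,u_{m+1}\qquad(u_{-1}=u_r=0).$$ On $\mathsf V_{r-1}^{\otimes n}$ let $E$ and $F$ act through the iterated coproducts of $\Delta(E)=1\otimes E+E\otimes k^2$ and $\Delta(F)=k^{-2}\otimes F+F\otimes 1$. Let $$R=\frac1{4r}\sum_{a=0}^{r-1}\sum_{m,m'=0}^{4r-1}\frac{\{1\}^{2a}}{\{a\}!}\,q^{a(a-1)/2+a(m-m')-mm'/2}\,E^ak^m\otimes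 F^ak^{m'}$$ on $\mathsf V_{r-1}\otimes\mathsf V_{r-1}$, let $\tau$ be the flip, and let $\mathsf R=q^{-(r-1)^2/2}\,\tau\circ R$. Let $\boldsymbol V_{n,\ell}\subset\mathsf V_{r-1}^{\otimes n}$ be the span of the $u_{\varepsilon_1}\otimes\cdots\otimes u_{\varepsilon_n}$ with $\varepsilon_1+\dots+\varepsilon_n=\ell$ (the eigenspace for the eigenvalue $n(r-1)-2\ell$ of $H_n=\sum_i 1\otimes\cdots\otimes H\otimes\cdots\otimes1$, where $H u_m=(r-1-2m)u_m$), and let $$\boldsymbol W_{n,\ell}=\ker E\cap\boldsymbol V_{n,\ell},\qquad \boldsymbol N_{n,\ell,\ell'}=\ker (FE)^2\cap\boldsymbol V_{n,\ell}.$$ **Theorem.** Let $n\ge 2$ and $\ell\ge1$ be integers. There exist integers $r,\ell'$ with $$0\le\ell'<\ell<r\quad\text{and}\quad \ell+\ell'\equiv 1-n \pmod r ,$$ and for every such pair $(r,\ell')$ the following hold. 1. The assignment $\sigma_i\mapsto 1^{\otimes (i-1)}\otimes\mathsf R\otimes 1^{\otimes (n-i-1)}$ defines a representation of $B_n$ on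 $\mathsf V_{r-1}^{\otimes n}$, and $\boldsymbol W_{n,\ell}$, $\boldsymbol W_{n,\ell'}$ and $\boldsymbol N_{n,\ell,\ell'}$ are subrepresentations. 2. There is a short exact sequence of $B_n$-representations $$0\to\boldsymbol W_{n,\ell}\to\boldsymbol N_{n,\ell,\ell'}\to\boldsymbol W_{n,\ell'}\to0,$$ in which the first map is the inclusion, and this sequence does not split. 3. The center of $B_n$ acts faithfully on $\boldsymbol N_{n,\ell,\ell'}$, and the full twist $\theta_n$ acts on it with infinite order. -/

import Mathlib

open scoped TensorProduct

noncomputable section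

namespace QuantumBraid

/-! ### The braid group -/

/-- The Artin relations among `σ_0, …, σ_{n-2}` (generators are numbered from `0`). -/
def braidRels (n : ℕ) : Set (FreeGroup (Fin (n - 1))) :=
  {x | ∃ i j : Fin (n - 1), (i : ℕ) + 1 < j ∧
      x = (FreeGroup.of i * FreeGroup.of j) * (FreeGroup.of j * FreeGroup.of i)⁻¹} ∪
  {x | ∃ i j : Fin (n - 1), (i : ℕ) + 1 = j ∧
      x = (FreeGroup.of i * FreeGroup.of j * FreeGroup.of i) *
        (FreeGroup.of j * FreeGroup.of i * FreeGroup.of j)⁻¹}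

/-- The braid group `B_n` on `n` strands. -/
abbrev BraidGroup (n : ℕ) : Type := PresentedGroup (braidRels n)

/-- The Artin generators. -/
def sigma {n : ℕ} (i : Fin (n - 1)) : BraidGroup n := PresentedGroup.of i

/-- `δ_m = σ_1 σ_2 ⋯ σ_{m-1}` in one-based numbering, for `2 ≤ m ≤ n`. -/
def delta (n m : ℕ) : BraidGroup n :=
  ((List.range (m - 1)).map
    fun i => if h : i < n - 1 then sigma (⟨i, h⟩ : Fin (n - 1)) else 1).prod

/-- The half twist `Δ_n = δ_n δ_{n-1} ⋯ δ_2`. -/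
def halfTwist (n : ℕ) : BraidGroup n :=
  ((List.range (n - 1)).map fun a => delta n (n - a)).prod

/-- The full twist `θ_n = Δ_n ^ 2`. -/
def fullTwist (n : ℕ) : BraidGroup n := halfTwist n ^ 2

/-! ### Quantum numbers at the root of unity -/

/-- `q^{1/2} = e^{π i / (2 r)}`. -/
def qHalf (r : ℕ) : ℂ := Complex.exp (Real.pi * Complex.I / (2 * r))

/-- `q = e^{π i / r}`. -/
def q (r : ℕ) : ℂ := Complex.exp (Real.pi * Complex.I / r)

/-- `{x} = q^x - q^{-x}`. -/
def qnum (r : ℕ) (x : ℤ) : ℂ := q r ^ x - q r ^ (-x)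

/-- `[x] = {x} / {1}`. -/
def qint (r : ℕ) (x : ℤ) : ℂ := qnum r x / qnum r 1

/-- `{a}! = {a} {a-1} ⋯ {1}`. -/
def qnumFactorial (r a : ℕ) : ℂ := ∏ m ∈ Finset.range a, qnum r (m + 1)

/-! ### The Steinberg module `V_{r-1}` with basis `u_0, …, u_{r-1}` -/

/-- The underlying vector space of the `r`-dimensional module `V_{r-1}`. -/
abbrev Steinberg (r : ℕ) : Type := Fin r → ℂ

/-- The basis vector `u_m`, with `u_m = 0` for `m ≥ r`. -/
def u (r m : ℕ) : Steinberg r := if h : m < r then Pi.single ⟨m, h⟩ 1 else 0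

/-- `E u_m = u_{m-1}`, with `u_{-1} = 0`. -/
def opE (r : ℕ) : Module.End ℂ (Steinberg r) :=
  (Pi.basisFun ℂ (Fin r)).constr ℂ fun m => if (m : ℕ) = 0 then 0 else u r (m - 1)

/-- `F u_m = [m+1] [r-1-m] u_{m+1}`, with `u_r = 0`. -/
def opF (r : ℕ) : Module.End ℂ (Steinberg r) :=
  (Pi.basisFun ℂ (Fin r)).constr ℂ fun m =>
    (qint r ((m : ℤ) + 1) * qint r ((r : ℤ) - 1 - m)) • u r (m + 1)

/-- `k u_m = q^{(r-1-2m)/2} u_m`. -/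
def opk (r : ℕ) : Module.End ℂ (Steinberg r) :=
  (Pi.basisFun ℂ (Fin r)).constr ℂ fun m => qHalf r ^ ((r : ℤ) - 1 - 2 * m) • u r m

/-- `k⁻¹ u_m = q^{-(r-1-2m)/2} u_m`. -/
def opkInv (r : ℕ) : Module.End ℂ (Steinberg r) :=
  (Pi.basisFun ℂ (Fin r)).constr ℂ fun m => qHalf r ^ (-((r : ℤ) - 1 - 2 * m)) • u r m

/-- The strong weight operator, `H u_m = (r-1-2m) u_m`. -/
def opH (r : ℕ) : Module.End ℂ (Steinberg r) :=
  (Pi.basisFun ℂ (Fin r)).constr ℂ fun m => ((r : ℂ) - 1 - 2 * (m : ℕ)) • u r m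

/-! ### The tensor power `V_{r-1}^{⊗ n}` -/

/-- The tensor power `V_{r-1}^{⊗ n}`, its factors numbered by `Fin n`. -/
abbrev TPow (r n : ℕ) : Type := ⨂[ℂ] _ : Fin n, Steinberg r

/-- `E` on the tensor power, through the iterated coproduct of `Δ(E) = 1 ⊗ E + E ⊗ k²`. -/
def tensorE (r n : ℕ) : Module.End ℂ (TPow r n) :=
  ∑ i : Fin n, PiTensorProduct.map fun j : Fin n =>
    if j < i then LinearMap.id else if j = i then opE r else opk r ^ 2

/-- `F` on the tensor power, through the iterated coproduct of `Δ(F) = k⁻² ⊗ F + F ⊗ 1`. -/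
def tensorF (r n : ℕ) : Module.End ℂ (TPow r n) :=
  ∑ i : Fin n, PiTensorProduct.map fun j : Fin n =>
    if j < i then opkInv r ^ 2 else if j = i then opF r else LinearMap.id

/-- `H_n = ∑_i 1 ⊗ ⋯ ⊗ H ⊗ ⋯ ⊗ 1`. -/
def tensorH (r n : ℕ) : Module.End ℂ (TPow r n) :=
  ∑ i : Fin n, PiTensorProduct.map fun j : Fin n => if j = i then opH r else LinearMap.id

/-- The universal `R`-matrix
`R = (4r)⁻¹ ∑_{a < r} ∑_{m, m' < 4r} ({1}^{2a} / {a}!) q^{a(a-1)/2 + a(m-m') - m m'/2}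
  E^a k^m ⊗ F^a k^{m'}`
acting on the tensor factors `x` (first leg) and `y` (second leg). -/
def tensorR (r n : ℕ) (x y : Fin n) : Module.End ℂ (TPow r n) :=
  (4 * (r : ℂ))⁻¹ • ∑ a ∈ Finset.range r, ∑ m ∈ Finset.range (4 * r), ∑ m' ∈ Finset.range (4 * r),
    (qnum r 1 ^ (2 * a) / qnumFactorial r a *
      qHalf r ^ ((a : ℤ) * (a - 1) + 2 * a * ((m : ℤ) - m') - m * m')) •
      PiTensorProduct.map fun j : Fin n =>
        if j = x then opE r ^ a * opk r ^ m
        else if j = y then opF r ^ a * opk r ^ m'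
        else LinearMap.id

/-- The flip of the tensor factors `x` and `y`. -/
def tensorFlip (r n : ℕ) (x y : Fin n) : Module.End ℂ (TPow r n) :=
  (PiTensorProduct.reindex ℂ (fun _ : Fin n => Steinberg r) (Equiv.swap x y)).toLinearMap

/-- The operator `1^{⊗ i} ⊗ q^{-(r-1)²/2} (τ ∘ R) ⊗ 1^{⊗ (n-i-2)}` by which the `i`-th Artin
generator (numbered from `0`) acts, on the factors `i` and `i + 1`. -/
def braidOp (r n : ℕ) (i : Fin (n - 1)) : Module.End ℂ (TPow r n) :=
  qHalf r ^ (-((r : ℤ) - 1) ^ 2) •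
    (tensorFlip r n ⟨i, by omega⟩ ⟨i + 1, by omega⟩ * tensorR r n ⟨i, by omega⟩ ⟨i + 1, by omega⟩)

/-- The strong weight space `V_{n,ℓ}` of strong weight `n (r-1) - 2ℓ`. -/
def weightSpace (r n ℓ : ℕ) : Submodule ℂ (TPow r n) :=
  LinearMap.ker (tensorH r n -
    ((n : ℂ) * ((r : ℂ) - 1) - 2 * (ℓ : ℂ)) • (LinearMap.id : Module.End ℂ (TPow r n)))

/-- The highest strong weight space `W_{n,ℓ} = ker E ∩ V_{n,ℓ}`. -/
def highestSpace (r n ℓ : ℕ) : Submodule ℂ (TPow r n) :=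
  LinearMap.ker (tensorE r n) ⊓ weightSpace r n ℓ

/-- The dominant space `ker (F E)² ∩ V_{n,ℓ}`. -/
def dominantSpace (r n ℓ : ℕ) : Submodule ℂ (TPow r n) :=
  LinearMap.ker ((tensorF r n * tensorE r n) ^ 2) ⊓ weightSpace r n ℓ

end QuantumBraid

end

open scoped TensorProduct

noncomputable section

namespace QuantumBraid

/-! ### Scalars -/

/-! Write `D = FE` and `d = ℓ - ℓ'`. Moving `E` past powers of `F` shows that, on level `ℓ`, `F^a
E^a = ∏_{j<a} (D + e_j)`. The congruence `ℓ + ℓ' ≡ 1 - n` mod `r` turns the shifts into `e_j = s [j]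
[d-j]` with a sign `s`. For `0 ≤ j < r` these vanish only at `j = 0` and `j = d`.

Since `E^{ℓ+1} = 0` on level `ℓ`, the polynomial `∏_{j≤ℓ} (X + e_j)` annihilates `D` there, and its
root `0` has multiplicity exactly two. Hence `ker D²` is the whole generalized kernel of `D`. In the
range `ℓ < r` the powers of `F` that bring a lower level back to level `ℓ` are injective, and the
powers of `E` from level `ℓ` down are surjective. It follows that `E^d` maps `ker D²` onto
`W_{n,ℓ'}` with kernel `W_{n,ℓ}` (`tensorE_pow_succ_eq_zero`, `tensorE_eq_zero_of_pow`,
`exists_tensorE_pow_eq`). Equivariance is automatic because the braiding commutes with `E`, `F` and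
`H`. The Yang–Baxter equation also comes from this commutation, together with a hexagon identity
(`braidOp_zero_one_tcons`).

Non-splitting and infinite order come from the full twist. On a level `t < r` it acts as an explicit
combination of the `F^a E^a` (`twistOp_eq_twistSum`), so on `ker D²` it is `Λ (1 + κ D)` with a
nonzero scalar `Λ`. A `q`-series identity gives `κ (1 - q^{-2d}) = s d q^{-d} {1}²`, hence `κ ≠ 0`
(`shear_ne_zero`). As `D` is nonzero with square zero on `ker D²`, no power of the twist is the
identity. A section would carry vectors on which the twist is scalar to vectors with `D x ≠ 0`, on
which it is not.

Faithfulness of the center needs no description of the center. It is enough that a central braid of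
exponent sum zero is trivial (`eq_one_of_mem_center_of_expSum`). Then a fixed positive power of a
central `z` is the full twist to the power of the exponent sum of `z`, and infinite order of the
twist finishes. The triviality is proved by induction on the number of strands through combing: the
braid group acts on cosets times a semidirect product of a free group with a smaller braid group,
and an element of a free group commuting with two generators is `1`. -/

theorem qHalf_sq (r : ℕ) : qHalf r ^ 2 = q r := by
  rw [qHalf, q, ← Complex.exp_nat_mul]
  congr 1
  push_cast
  by_cases h : (r : ℂ) = 0
  · simp [h]
  · field_simp

theorem q_isPrimitiveRoot {r : ℕ} (hr : 0 < r) : IsPrimitiveRoot (q r) (2 * r) := by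
  have := Complex.isPrimitiveRoot_exp (2 * r) (by omega)
  convert this using 1
  rw [q]
  congr 1
  have : (r : ℂ) ≠ 0 := by exact_mod_cast hr.ne'
  push_cast
  field_simp

theorem qHalf_isPrimitiveRoot {r : ℕ} (hr : 0 < r) : IsPrimitiveRoot (qHalf r) (4 * r) := by
  have := Complex.isPrimitiveRoot_exp (4 * r) (by omega)
  convert this using 1
  rw [qHalf]
  congr 1
  have : (r : ℂ) ≠ 0 := by exact_mod_cast hr.ne'
  push_cast
  field_simp
  norm_num

theorem q_ne_zero (r : ℕ) : q r ≠ 0 := Complex.exp_ne_zero _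

theorem qHalf_ne_zero (r : ℕ) : qHalf r ≠ 0 := Complex.exp_ne_zero _

theorem q_pow_r {r : ℕ} (hr : 0 < r) : q r ^ r = -1 := by
  rw [q, ← Complex.exp_nat_mul]
  have : (r : ℂ) ≠ 0 := by exact_mod_cast hr.ne'
  rw [mul_div_cancel₀ _ this, Complex.exp_pi_mul_I]

theorem qHalf_zpow_two_mul (r : ℕ) (x : ℤ) : qHalf r ^ (2 * x) = q r ^ x := by
  rw [zpow_mul, ← qHalf_sq]; norm_cast

theorem q_zpow_r_mul {r : ℕ} (hr : 0 < r) (x : ℤ) : q r ^ ((r : ℤ) * x) = (-1) ^ x := by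
  rw [zpow_mul, zpow_natCast, q_pow_r hr]

theorem qnum_zero (r : ℕ) : qnum r 0 = 0 := by simp [qnum]

theorem qnum_ne_zero {r : ℕ} (hr : 0 < r) {x : ℤ} (hx : ¬ (r : ℤ) ∣ x) : qnum r x ≠ 0 := by
  intro h
  have h1 : q r ^ (2 * x) = 1 := by
    rw [qnum, sub_eq_zero] at h
    rw [two_mul, zpow_add₀ (q_ne_zero r)]
    nth_rewrite 2 [h]
    rw [← zpow_add₀ (q_ne_zero r)]; simp
  rw [(q_isPrimitiveRoot hr).zpow_eq_one_iff_dvd] at h1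
  push_cast at h1
  exact hx ((mul_dvd_mul_iff_left two_ne_zero).1 h1)

theorem qnum_natCast_ne_zero {r m : ℕ} (h0 : 0 < m) (hm : m < r) : qnum r m ≠ 0 := by
  apply qnum_ne_zero (by omega)
  intro h
  have := Nat.le_of_dvd h0 (by exact_mod_cast h)
  omega

theorem qnum_one_ne_zero {r : ℕ} (hr : 2 ≤ r) : qnum r 1 ≠ 0 := by
  exact_mod_cast qnum_natCast_ne_zero (r := r) (m := 1) (by omega) (by omega)

theorem qnumFactorial_zero (r : ℕ) : qnumFactorial r 0 = 1 := by simp [qnumFactorial]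

theorem qnumFactorial_succ (r a : ℕ) :
    qnumFactorial r (a + 1) = qnumFactorial r a * qnum r (a + 1) := by
  simp [qnumFactorial, Finset.prod_range_succ]

theorem qnumFactorial_ne_zero {r a : ℕ} (ha : a < r) : qnumFactorial r a ≠ 0 := by
  rw [qnumFactorial, Finset.prod_ne_zero_iff]
  intro m hm
  rw [Finset.mem_range] at hm
  exact_mod_cast qnum_natCast_ne_zero (r := r) (m := m + 1) (by omega) (by omega)

/-- This is where `q^r = -1` enters the module structure. It turns the coefficient `[m+1][r-1-m]` of
`F` into the square `[m+1]²`. -/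
theorem qint_r_sub {r : ℕ} (hr : 0 < r) (x : ℤ) : qint r ((r : ℤ) - x) = qint r x := by
  have h : q r ^ (r : ℤ) = -1 := by rw [zpow_natCast, q_pow_r hr]
  rw [qint, qint]
  congr 1
  rw [qnum, qnum, neg_sub, zpow_sub₀ (q_ne_zero r), zpow_sub₀ (q_ne_zero r), h, zpow_neg]
  field_simp
  ring

/-- The coefficient `{1}^{2a} q^{a(a-1)/2} / {a}!` of the quasi-`R`-matrix. -/
def rcoeff (r a : ℕ) : ℂ :=
  qnum r 1 ^ (2 * a) / qnumFactorial r a * qHalf r ^ ((a : ℤ) * (a - 1))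

theorem rcoeff_zero (r : ℕ) : rcoeff r 0 = 1 := by simp [rcoeff, qnumFactorial]

theorem rcoeff_succ {r a : ℕ} (ha : a + 1 < r) :
    rcoeff r (a + 1) * qnum r (a + 1) = qnum r 1 ^ 2 * q r ^ (a : ℤ) * rcoeff r a := by
  have h1 := qnumFactorial_ne_zero (r := r) (a := a) (by omega)
  have h2 : qnum r (a + 1) ≠ 0 := by
    exact_mod_cast qnum_natCast_ne_zero (r := r) (m := a + 1) (by omega) ha
  rw [rcoeff, rcoeff, qnumFactorial_succ]
  have : (((a + 1 : ℕ) : ℤ) * ((a + 1 : ℕ) - 1)) = 2 * (a : ℤ) + a * (a - 1) := by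
    push_cast; ring
  rw [this, zpow_add₀ (qHalf_ne_zero r), qHalf_zpow_two_mul]
  field_simp
  ring

/-- The coefficients behave like those of a `q`-exponential. The quotient of factorials is the one
in the `q`-binomial theorem, which is what later collapses a double sum over `a, b` into a single
sum over `a + b`. -/
theorem rcoeff_mul {r a b : ℕ} (hab : a + b < r) :
    rcoeff r a * rcoeff r b =
      rcoeff r (a + b) * (qnumFactorial r (a + b) / (qnumFactorial r a * qnumFactorial r b)) *
        q r ^ (-((a : ℤ) * b)) := by
  have h1 := qnumFactorial_ne_zero (r := r) (a := a) (by omega)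
  have h2 := qnumFactorial_ne_zero (r := r) (a := b) (by omega)
  have h3 := qnumFactorial_ne_zero hab
  rw [rcoeff, rcoeff, rcoeff, ← qHalf_zpow_two_mul]
  have : (((a + b : ℕ) : ℤ) * ((a + b : ℕ) - 1)) =
      a * (a - 1) + b * (b - 1) + 2 * (a * b) := by
    push_cast; ring
  have h4 : qHalf r ^ (2 * -((a : ℤ) * b)) = (qHalf r ^ (2 * ((a : ℤ) * b)))⁻¹ := by
    rw [← zpow_neg]; congr 1; ring
  rw [this, zpow_add₀ (qHalf_ne_zero r), zpow_add₀ (qHalf_ne_zero r), h4]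
  have := zpow_ne_zero (2 * ((a : ℤ) * b)) (qHalf_ne_zero r)
  field_simp
  ring

/-! ### Operators on the Steinberg module -/

theorem u_of_le {r m : ℕ} (h : r ≤ m) : u r m = 0 := by simp [u, h]

theorem u_fin {r : ℕ} (m : Fin r) : u r m = Pi.basisFun ℂ (Fin r) m := by
  simp [u]

theorem opE_u_zero (r : ℕ) : opE r (u r 0) = 0 := by
  by_cases h : 0 < r
  · rw [show u r 0 = Pi.basisFun ℂ (Fin r) ⟨0, h⟩ by simp [u, h], opE, Module.Basis.constr_basis]
    simp
  · rw [u_of_le (by omega), map_zero]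

theorem opE_u_succ {r m : ℕ} (h : m + 1 < r) : opE r (u r (m + 1)) = u r m := by
  rw [show u r (m + 1) = Pi.basisFun ℂ (Fin r) ⟨m + 1, h⟩ by simp [u, h], opE,
    Module.Basis.constr_basis]
  simp

theorem opF_u {r : ℕ} (m : ℕ) :
    opF r (u r m) = (qint r (m + 1)) ^ 2 • u r (m + 1) := by
  by_cases h : m < r
  · rw [show u r m = Pi.basisFun ℂ (Fin r) ⟨m, h⟩ by simp [u, h], opF, Module.Basis.constr_basis]
    simp only
    rw [show (r : ℤ) - 1 - m = r - (m + 1) by ring, qint_r_sub (by omega), sq]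
  · rw [u_of_le (by omega), u_of_le (by omega)]; simp

theorem opk_u (r m : ℕ) : opk r (u r m) = qHalf r ^ ((r : ℤ) - 1 - 2 * m) • u r m := by
  by_cases h : m < r
  · nth_rewrite 1 [show u r m = Pi.basisFun ℂ (Fin r) ⟨m, h⟩ by simp [u, h]]
    rw [opk, Module.Basis.constr_basis]
  · rw [u_of_le (by omega)]; simp

theorem opkInv_u (r m : ℕ) : opkInv r (u r m) = qHalf r ^ (-((r : ℤ) - 1 - 2 * m)) • u r m := by
  by_cases h : m < r
  · nth_rewrite 1 [show u r m = Pi.basisFun ℂ (Fin r) ⟨m, h⟩ by simp [u, h]]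
    rw [opkInv, Module.Basis.constr_basis]
  · rw [u_of_le (by omega)]; simp

theorem opH_u (r m : ℕ) : opH r (u r m) = ((r : ℂ) - 1 - 2 * m) • u r m := by
  by_cases h : m < r
  · nth_rewrite 1 [show u r m = Pi.basisFun ℂ (Fin r) ⟨m, h⟩ by simp [u, h]]
    rw [opH, Module.Basis.constr_basis]
  · rw [u_of_le (by omega)]; simp

/-- The scalar `(-1)^n q^{-n-2t}` by which `k²` acts in level `t` of the `n`-th tensor power. -/
def wt (r : ℕ) (n : ℕ) (t : ℤ) : ℂ := (-1) ^ n * q r ^ (-(n : ℤ) - 2 * t)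

theorem wt_ne_zero (r n : ℕ) (t : ℤ) : wt r n t ≠ 0 :=
  mul_ne_zero (by simp) (zpow_ne_zero _ (q_ne_zero r))

theorem wt_succ (r n : ℕ) (s t : ℤ) : wt r (n + 1) (s + t) = wt r 1 s * wt r n t := by
  simp only [wt]
  rw [show -((n + 1 : ℕ) : ℤ) - 2 * (s + t) = (-((1 : ℕ) : ℤ) - 2 * s) + (-(n : ℤ) - 2 * t) by
    push_cast; ring, zpow_add₀ (q_ne_zero r)]
  ring

theorem qHalf_zpow_weight {r : ℕ} (hr : 0 < r) (m : ℤ) :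
    (qHalf r ^ ((r : ℤ) - 1 - 2 * m)) ^ 2 = wt r 1 m := by
  rw [← zpow_natCast, ← zpow_mul, mul_comm]
  rw [Nat.cast_ofNat, qHalf_zpow_two_mul, wt,
    show (r : ℤ) - 1 - 2 * m = r * 1 + (-((1 : ℕ) : ℤ) - 2 * m) by push_cast; ring,
    zpow_add₀ (q_ne_zero r), q_zpow_r_mul hr]
  simp

theorem opk_sq_u {r : ℕ} (m : ℕ) : (opk r ^ 2) (u r m) = wt r 1 m • u r m := by
  by_cases h : m < r
  · rw [sq, Module.End.mul_apply, opk_u, map_smul, opk_u, smul_smul, ← sq,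
      qHalf_zpow_weight (by omega)]
  · rw [u_of_le (by omega)]; simp

theorem opkInv_sq_u {r : ℕ} (m : ℕ) : (opkInv r ^ 2) (u r m) = (wt r 1 m)⁻¹ • u r m := by
  by_cases h : m < r
  · rw [sq, Module.End.mul_apply, opkInv_u, map_smul, opkInv_u, smul_smul, ← sq, zpow_neg, inv_pow,
      qHalf_zpow_weight (by omega)]
  · rw [u_of_le (by omega)]; simp

theorem steinberg_ext {r : ℕ} {M : Type*} [AddCommMonoid M] [Module ℂ M]
    {f g : Steinberg r →ₗ[ℂ] M} (h : ∀ m < r, f (u r m) = g (u r m)) : f = g := by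
  apply (Pi.basisFun ℂ (Fin r)).ext
  intro i
  rw [← u_fin]
  exact h i i.2

theorem opE_pow_u {r : ℕ} (a m : ℕ) (hm : m < r) :
    (opE r ^ a) (u r m) = if a ≤ m then u r (m - a) else 0 := by
  induction a with
  | zero => simp
  | succ a ih =>
    rw [pow_succ', Module.End.mul_apply, ih]
    by_cases h : a + 1 ≤ m
    · rw [if_pos (by omega), if_pos h, show m - a = (m - (a + 1)) + 1 by omega,
        opE_u_succ (by omega)]
    · rw [if_neg h]
      by_cases h' : a ≤ m
      · rw [if_pos h', show m - a = 0 by omega, opE_u_zero]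
      · simp [h']

theorem opF_pow_u {r : ℕ} (a m : ℕ) :
    (opF r ^ a) (u r m) = (∏ i ∈ Finset.range a, qint r (m + i + 1) ^ 2) • u r (m + a) := by
  induction a with
  | zero => simp
  | succ a ih =>
    rw [pow_succ', Module.End.mul_apply, ih, map_smul, opF_u, smul_smul, Finset.prod_range_succ]
    push_cast
    rfl

theorem opE_pow_r (r : ℕ) : opE r ^ r = 0 := by
  apply steinberg_ext
  intro m hm
  rw [opE_pow_u _ _ hm, if_neg (by omega)]; simp

theorem opF_pow_u_eq_zero {r a m : ℕ} (h : r ≤ m + a) : (opF r ^ a) (u r m) = 0 := by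
  rw [opF_pow_u, u_of_le h, smul_zero]

/-! ### Splitting off the first tensor factor -/

/-- The bilinear map `(v, x) ↦ v ⊗ x` from `V × V^{⊗ n}` to `V^{⊗ (n+1)}`. -/
def tcons (r n : ℕ) : Steinberg r →ₗ[ℂ] TPow r n →ₗ[ℂ] TPow r (n + 1) :=
  (PiTensorProduct.lift (R := ℂ) (s := fun _ : Fin n => Steinberg r)
    (E := TPow r (n + 1))).toLinearMap ∘ₗ
    (PiTensorProduct.tprod ℂ (s := fun _ : Fin (n + 1) => Steinberg r)).curryLeft

theorem tcons_tprod {r n : ℕ} (v : Steinberg r) (f : Fin n → Steinberg r) :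
    tcons r n v (PiTensorProduct.tprod ℂ f) = PiTensorProduct.tprod ℂ (Fin.cons v f) := by
  simp [tcons]

theorem tprod_eq_tcons {r n : ℕ} (f : Fin (n + 1) → Steinberg r) :
    PiTensorProduct.tprod ℂ f = tcons r n (f 0) (PiTensorProduct.tprod ℂ (Fin.tail f)) := by
  rw [tcons_tprod, Fin.cons_self_tail]

theorem tpow_ext {r n : ℕ} {M : Type*} [AddCommMonoid M] [Module ℂ M]
    {f g : TPow r (n + 1) →ₗ[ℂ] M} (h : ∀ m < r, ∀ x, f (tcons r n (u r m) x) = g (tcons r n (u r m) x)) :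
    f = g := by
  have h' : ∀ x, f ∘ₗ (tcons r n).flip x = g ∘ₗ (tcons r n).flip x := by
    intro x
    apply steinberg_ext
    intro m hm
    simpa using h m hm x
  apply PiTensorProduct.ext
  refine MultilinearMap.ext fun a => ?_
  have := LinearMap.congr_fun (h' (PiTensorProduct.tprod ℂ (Fin.tail a))) (a 0)
  simpa [tprod_eq_tcons a] using this

/-- The component of a tensor along the basis vector `u_m` of the first factor. -/
def coord (r n : ℕ) (m : Fin r) : TPow r (n + 1) →ₗ[ℂ] TPow r n :=
  PiTensorProduct.lift (LinearMap.uncurryLeft (M := fun _ : Fin (n + 1) => Steinberg r)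
    ((LinearMap.proj m : Steinberg r →ₗ[ℂ] ℂ).smulRight
      (PiTensorProduct.tprod ℂ (s := fun _ : Fin n => Steinberg r))))

theorem coord_tcons {r n : ℕ} (m : Fin r) (v : Steinberg r) (x : TPow r n) :
    coord r n m (tcons r n v x) = v m • x := by
  have : coord r n m ∘ₗ tcons r n v = v m • LinearMap.id := by
    apply PiTensorProduct.ext
    refine MultilinearMap.ext fun f => ?_
    simp [tcons_tprod, coord]
  exact LinearMap.congr_fun this x

theorem sum_tcons_coord {r n : ℕ} (y : TPow r (n + 1)) :
    ∑ m : Fin r, tcons r n (u r m) (coord r n m y) = y := by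
  have : ∑ m : Fin r, tcons r n (u r m) ∘ₗ coord r n m = LinearMap.id := by
    apply tpow_ext
    intro j hj x
    simp only [LinearMap.sum_apply, LinearMap.comp_apply, coord_tcons, LinearMap.id_apply]
    rw [Finset.sum_eq_single ⟨j, hj⟩]
    · simp [u, hj]
    · intro b _ hb
      simp [u, hj, hb]
    · simp
  simpa using LinearMap.congr_fun this y

theorem coord_u {r n : ℕ} (m : Fin r) (j : ℕ) (x : TPow r n) :
    coord r n m (tcons r n (u r j) x) = if (m : ℕ) = j then x else 0 := by
  rw [coord_tcons]
  by_cases hj : j < r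
  · simp only [u, hj, dif_pos, Pi.single_apply, Fin.ext_iff]
    split_ifs <;> simp
  · have : (m : ℕ) ≠ j := by omega
    simp [u, hj, this]

/-- The operator `A ⊗ B` on `V ⊗ V^{⊗ n}`. -/
def tmap {r n n' : ℕ} (A : Module.End ℂ (Steinberg r)) (B : TPow r n →ₗ[ℂ] TPow r n') :
    TPow r (n + 1) →ₗ[ℂ] TPow r (n' + 1) :=
  ∑ m : Fin r, tcons r n' (A (u r m)) ∘ₗ B ∘ₗ coord r n m

theorem tmap_tcons {r n n' : ℕ} (A : Module.End ℂ (Steinberg r)) (B : TPow r n →ₗ[ℂ] TPow r n')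
    (v : Steinberg r) (x : TPow r n) : tmap A B (tcons r n v x) = tcons r n' (A v) (B x) := by
  have : tmap A B ∘ₗ (tcons r n).flip x = (tcons r n').flip (B x) ∘ₗ A := by
    apply steinberg_ext
    intro j hj
    simp only [tmap, LinearMap.comp_apply, LinearMap.flip_apply, LinearMap.sum_apply, coord_u]
    rw [Finset.sum_eq_single ⟨j, hj⟩]
    · simp
    · intro b _ hb
      have : (b : ℕ) ≠ j := fun h => hb (Fin.ext h)
      simp [this]
    · simp
  exact LinearMap.congr_fun this v

theorem tmap_mul {r n : ℕ} (A A' : Module.End ℂ (Steinberg r)) (B B' : Module.End ℂ (TPow r n)) :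
    (tmap A B : Module.End ℂ (TPow r (n + 1))) * tmap A' B' = tmap (A * A') (B * B') := by
  apply tpow_ext
  intro m _ x
  simp [Module.End.mul_apply, tmap_tcons]

theorem tmap_one_one {r n : ℕ} : (tmap 1 1 : Module.End ℂ (TPow r (n + 1))) = 1 := by
  apply tpow_ext
  intro m _ x
  simp [tmap_tcons]

theorem tmap_pow {r n : ℕ} (A : Module.End ℂ (Steinberg r)) (B : Module.End ℂ (TPow r n)) (a : ℕ) :
    (tmap A B : Module.End ℂ (TPow r (n + 1))) ^ a = tmap (A ^ a) (B ^ a) := by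
  induction a with
  | zero => simp [tmap_one_one]
  | succ a ih => rw [pow_succ, ih, tmap_mul, pow_succ, pow_succ]

theorem map_tcons {r n : ℕ} (f : Fin (n + 1) → Module.End ℂ (Steinberg r)) (v : Steinberg r)
    (x : TPow r n) :
    PiTensorProduct.map f (tcons r n v x) =
      tcons r n (f 0 v) (PiTensorProduct.map (fun i => f i.succ) x) := by
  have : PiTensorProduct.map f ∘ₗ tcons r n v =
      tcons r n (f 0 v) ∘ₗ PiTensorProduct.map (fun i => f i.succ) := by
    apply PiTensorProduct.ext
    refine MultilinearMap.ext fun g => ?_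
    simp only [LinearMap.compMultilinearMap_apply, LinearMap.comp_apply, tcons_tprod,
      PiTensorProduct.map_tprod]
    congr 1
    funext i
    refine Fin.cases ?_ (fun i => ?_) i <;> simp
  exact LinearMap.congr_fun this x

/-! ### The quantum group operators through the first tensor factor -/

/-- `k²` on the tensor power. -/
def tensorK (r n : ℕ) : Module.End ℂ (TPow r n) := PiTensorProduct.map fun _ => opk r ^ 2

theorem tensorK_tcons {r n : ℕ} (v : Steinberg r) (x : TPow r n) :
    tensorK r (n + 1) (tcons r n v x) = tcons r n ((opk r ^ 2) v) (tensorK r n x) := by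
  rw [tensorK, map_tcons, tensorK]

theorem tensorE_tcons {r n : ℕ} (v : Steinberg r) (x : TPow r n) :
    tensorE r (n + 1) (tcons r n v x) =
      tcons r n v (tensorE r n x) + tcons r n (opE r v) (tensorK r n x) := by
  rw [tensorE, LinearMap.sum_apply, Fin.sum_univ_succ, add_comm (PiTensorProduct.map _ _)]
  congr 1
  · rw [tensorE, LinearMap.sum_apply, map_sum]
    refine Finset.sum_congr rfl fun i _ => ?_
    rw [map_tcons]
    simp
  · rw [map_tcons, tensorK]
    simp [Fin.succ_ne_zero]

theorem tensorF_tcons {r n : ℕ} (v : Steinberg r) (x : TPow r n) :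
    tensorF r (n + 1) (tcons r n v x) =
      tcons r n ((opkInv r ^ 2) v) (tensorF r n x) + tcons r n (opF r v) x := by
  rw [tensorF, LinearMap.sum_apply, Fin.sum_univ_succ, add_comm (PiTensorProduct.map _ _)]
  congr 1
  · rw [tensorF, LinearMap.sum_apply, map_sum]
    refine Finset.sum_congr rfl fun i _ => ?_
    rw [map_tcons]
    simp
  · rw [map_tcons]
    simp [Fin.succ_ne_zero, PiTensorProduct.map_id]

theorem tensorH_tcons {r n : ℕ} (v : Steinberg r) (x : TPow r n) :
    tensorH r (n + 1) (tcons r n v x) =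
      tcons r n v (tensorH r n x) + tcons r n (opH r v) x := by
  rw [tensorH, LinearMap.sum_apply, Fin.sum_univ_succ, add_comm (PiTensorProduct.map _ _)]
  congr 1
  · rw [tensorH, LinearMap.sum_apply, map_sum]
    refine Finset.sum_congr rfl fun i _ => ?_
    rw [map_tcons]
    simp [(Fin.succ_ne_zero _).symm]
  · rw [map_tcons]
    simp [Fin.succ_ne_zero, PiTensorProduct.map_id]

/-! ### Levels -/

/-- The level `t` part of the tensor power, for an integer `t`. -/
def level (r n : ℕ) (t : ℤ) : Submodule ℂ (TPow r n) :=
  LinearMap.ker (tensorH r n -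
    ((n : ℂ) * ((r : ℂ) - 1) - 2 * (t : ℂ)) • (LinearMap.id : Module.End ℂ (TPow r n)))

theorem weightSpace_eq_level (r n ℓ : ℕ) : weightSpace r n ℓ = level r n ℓ := by
  simp [weightSpace, level]

theorem mem_level {r n : ℕ} {t : ℤ} {x : TPow r n} :
    x ∈ level r n t ↔ tensorH r n x = ((n : ℂ) * ((r : ℂ) - 1) - 2 * (t : ℂ)) • x := by
  simp [level, sub_eq_zero]

theorem tcons_mem_level {r n : ℕ} {t : ℤ} (m : ℕ) {x : TPow r n} (hx : x ∈ level r n t) :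
    tcons r n (u r m) x ∈ level r (n + 1) (m + t) := by
  rw [mem_level] at hx ⊢
  rw [tensorH_tcons, hx, opH_u, map_smul, map_smul, LinearMap.smul_apply, ← add_smul]
  congr 1
  push_cast
  ring

theorem coord_mem_level {r n : ℕ} {t : ℤ} (m : Fin r) {y : TPow r (n + 1)}
    (hy : y ∈ level r (n + 1) t) : coord r n m y ∈ level r n (t - m) := by
  have h : coord r n m ∘ₗ tensorH r (n + 1) =
      (tensorH r n + ((r : ℂ) - 1 - 2 * (m : ℕ)) • 1) ∘ₗ coord r n m := by
    apply tpow_ext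
    intro j _ x
    simp only [LinearMap.comp_apply, tensorH_tcons, opH_u, map_add, map_smul, LinearMap.smul_apply,
      coord_u, LinearMap.add_apply, Module.End.one_apply]
    split_ifs with h
    · rw [h]
    · simp
  rw [mem_level] at hy ⊢
  have h2 := LinearMap.congr_fun h y
  simp only [LinearMap.comp_apply, hy, map_smul, LinearMap.add_apply, LinearMap.smul_apply,
    Module.End.one_apply] at h2
  rw [show ((n + 1 : ℕ) : ℂ) * ((r : ℂ) - 1) - 2 * t =
    ((n : ℂ) * ((r : ℂ) - 1) - 2 * ((t - (m : ℕ) : ℤ) : ℂ)) + ((r : ℂ) - 1 - 2 * (m : ℕ)) by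
      push_cast; ring, add_smul] at h2
  exact (add_right_cancel h2).symm

/-- A tensor is the sum of its components `u_m ⊗ x`, and each component inherits a definite level.
This stands in for a basis of weight vectors in all inductions on the number of factors. -/
theorem level_induction {r n : ℕ} {t : ℤ} {p : TPow r (n + 1) → Prop} (h0 : p 0)
    (hadd : ∀ x y, p x → p y → p (x + y))
    (hu : ∀ (m : ℕ) (x : TPow r n), m < r → x ∈ level r n (t - m) → p (tcons r n (u r m) x))
    {y : TPow r (n + 1)} (hy : y ∈ level r (n + 1) t) : p y := by
  rw [← sum_tcons_coord y]
  exact Finset.sum_induction _ p hadd h0 fun m _ => hu m _ m.2 (coord_mem_level m hy)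

theorem tensorH_zero (r : ℕ) : tensorH r 0 = 0 := by simp [tensorH]

theorem tensorE_zero (r : ℕ) : tensorE r 0 = 0 := by simp [tensorE]

theorem tensorF_zero (r : ℕ) : tensorF r 0 = 0 := by simp [tensorF]

theorem tensorK_zero (r : ℕ) : tensorK r 0 = 1 := by
  rw [tensorK]
  convert PiTensorProduct.map_one (R := ℂ) (ι := Fin 0) (s := fun _ => Steinberg r)

theorem level_zero_eq_bot {r : ℕ} {t : ℤ} (ht : t ≠ 0) {x : TPow r 0} (hx : x ∈ level r 0 t) :
    x = 0 := by
  rw [mem_level, tensorH_zero] at hx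
  simpa [ht] using hx.symm

/-- Levels are allowed to be integers so that `E` always lowers them by one. Vanishing of negative
levels then makes `E^{t+1}` zero on level `t`. -/
theorem level_neg {r n : ℕ} {t : ℤ} (ht : t < 0) {x : TPow r n} (hx : x ∈ level r n t) :
    x = 0 := by
  induction n generalizing t with
  | zero => exact level_zero_eq_bot ht.ne hx
  | succ n ih =>
    refine level_induction (p := fun x => x = 0) rfl (by rintro _ _ rfl rfl; simp) ?_ hx
    intro m x _ hx
    rw [ih (by omega) hx, map_zero]

theorem tensorK_level {r n : ℕ} {t : ℤ} {x : TPow r n} (hx : x ∈ level r n t) :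
    tensorK r n x = wt r n t • x := by
  induction n generalizing t with
  | zero =>
    by_cases ht : t = 0
    · simp [tensorK_zero, wt, ht]
    · simp [level_zero_eq_bot ht hx]
  | succ n ih =>
    refine level_induction (p := fun x => tensorK r (n + 1) x = wt r (n + 1) t • x) (by simp)
      (fun x y hx hy => by rw [map_add, hx, hy, smul_add]) ?_ hx
    intro m x _ hx
    rw [tensorK_tcons, opk_sq_u, ih hx, map_smul, map_smul, LinearMap.smul_apply, smul_smul,
      show t = m + (t - m) by ring, wt_succ, mul_comm]
    congr 3; ring

theorem tensorE_mem_level {r n : ℕ} {t : ℤ} {x : TPow r n} (hx : x ∈ level r n t) :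
    tensorE r n x ∈ level r n (t - 1) := by
  induction n generalizing t with
  | zero => simp [tensorE_zero]
  | succ n ih =>
    refine level_induction (p := fun x => tensorE r (n + 1) x ∈ level r (n + 1) (t - 1)) (by simp)
      (fun x y hx hy => by rw [map_add]; exact add_mem hx hy) ?_ hx
    intro m x hm hx
    rw [tensorE_tcons, tensorK_level hx]
    refine add_mem ?_ ?_
    · convert tcons_mem_level m (ih hx) using 2; ring
    · cases m with
      | zero => simp [opE_u_zero]
      | succ m =>
        rw [opE_u_succ hm, map_smul]
        refine Submodule.smul_mem _ _ ?_
        convert tcons_mem_level m hx using 2; push_cast; ring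

theorem tensorF_mem_level {r n : ℕ} {t : ℤ} {x : TPow r n} (hx : x ∈ level r n t) :
    tensorF r n x ∈ level r n (t + 1) := by
  induction n generalizing t with
  | zero => simp [tensorF_zero]
  | succ n ih =>
    refine level_induction (p := fun x => tensorF r (n + 1) x ∈ level r (n + 1) (t + 1)) (by simp)
      (fun x y hx hy => by rw [map_add]; exact add_mem hx hy) ?_ hx
    intro m x hm hx
    rw [tensorF_tcons, opkInv_sq_u, opF_u, map_smul, map_smul, LinearMap.smul_apply,
      LinearMap.smul_apply]
    refine add_mem (Submodule.smul_mem _ _ ?_) (Submodule.smul_mem _ _ ?_)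
    · convert tcons_mem_level m (ih hx) using 2; ring
    · convert tcons_mem_level (m + 1) hx using 2; push_cast; ring

theorem tensorE_pow_mem_level {r n : ℕ} {t : ℤ} {x : TPow r n} (hx : x ∈ level r n t) (a : ℕ) :
    (tensorE r n ^ a) x ∈ level r n (t - a) := by
  induction a with
  | zero => simpa using hx
  | succ a ih =>
    rw [pow_succ', Module.End.mul_apply]
    convert tensorE_mem_level ih using 2; push_cast; ring

theorem tensorF_pow_mem_level {r n : ℕ} {t : ℤ} {x : TPow r n} (hx : x ∈ level r n t) (a : ℕ) :
    (tensorF r n ^ a) x ∈ level r n (t + a) := by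
  induction a with
  | zero => simpa using hx
  | succ a ih =>
    rw [pow_succ', Module.End.mul_apply]
    convert tensorF_mem_level ih using 2; push_cast; ring

theorem tensorE_pow_eq_zero {r n : ℕ} {t : ℤ} {x : TPow r n} (hx : x ∈ level r n t) {a : ℕ}
    (ha : t < a) : (tensorE r n ^ a) x = 0 :=
  level_neg (by omega) (tensorE_pow_mem_level hx a)

/-- The `q`-commutator `EF - FE` on level `t`, that is `[weight]`. -/
def wtInt (r n : ℕ) (t : ℤ) : ℂ := (wt r n t - (wt r n t)⁻¹) / qnum r 1

/-! ### The commutator of `E` and `F` on tensor powers. -/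

theorem wt_shift (r n : ℕ) (t : ℤ) : wt r n (t - 1) = q r ^ 2 * wt r n t := by
  simp only [wt]
  rw [show -(n : ℤ) - 2 * (t - 1) = 2 + (-(n : ℤ) - 2 * t) by ring, zpow_add₀ (q_ne_zero r)]
  norm_cast
  ring

theorem opE_opF_u {r m : ℕ} (hr : 2 ≤ r) (hm : m < r) :
    opE r (opF r (u r m)) = opF r (opE r (u r m)) + wtInt r 1 m • u r m := by
  have h1 := qnum_one_ne_zero hr
  have key : qint r (m + 1) ^ 2 = qint r m ^ 2 + wtInt r 1 m := by
    simp only [qint, wtInt, wt]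
    field_simp
    simp only [qnum] at h1 ⊢
    rw [show -((1 : ℕ) : ℤ) - 2 * (m : ℤ) = (-1 - m - m) by push_cast; ring]
    simp only [neg_add_rev, zpow_add₀ (q_ne_zero r), zpow_sub₀ (q_ne_zero r), zpow_neg]
    have h2 := q_ne_zero r
    have h3 : q r ^ (m : ℤ) ≠ 0 := zpow_ne_zero _ h2
    generalize q r ^ (m : ℤ) = z at *
    simp only [zpow_one]
    field_simp
    ring
  rw [opF_u, map_smul]
  have h2 : opE r (u r (m + 1)) = if m + 1 < r then u r m else 0 := by
    split_ifs with h
    · exact opE_u_succ h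
    · rw [u_of_le (by omega), map_zero]
  -- At the top vector `F u_{r-1} = 0`, and the general formula still holds because its coefficient
  -- `[r]` vanishes.
  have hz : m + 1 = r → qint r (m + 1) = 0 := by
    intro h
    have := qint_r_sub (r := r) (by omega) 0
    rw [sub_zero] at this
    rw [show ((m : ℤ) + 1) = r by exact_mod_cast h, this, qint, qnum_zero, zero_div]
  have h3 : qint r (m + 1) ^ 2 • opE r (u r (m + 1)) = qint r (m + 1) ^ 2 • u r m := by
    rw [h2]
    split_ifs with h
    · rfl
    · rw [hz (by omega)]; simp
  rw [h3, key, add_smul]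
  congr 1
  cases m with
  | zero => rw [opE_u_zero, map_zero]; simp [qint, qnum_zero]
  | succ m => rw [opE_u_succ hm, opF_u]; push_cast; rfl

theorem tensorE_tensorF {r n : ℕ} (hr : 2 ≤ r) {t : ℤ} {x : TPow r n} (hx : x ∈ level r n t) :
    tensorE r n (tensorF r n x) = tensorF r n (tensorE r n x) + wtInt r n t • x := by
  induction n generalizing t with
  | zero =>
    by_cases ht : t = 0
    · simp [tensorE_zero, tensorF_zero, wtInt, wt, ht]
    · simp [level_zero_eq_bot ht hx]
  | succ n ih =>
    refine level_induction (p := fun x => tensorE r (n + 1) (tensorF r (n + 1) x) =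
      tensorF r (n + 1) (tensorE r (n + 1) x) + wtInt r (n + 1) t • x) (by simp)
      (fun x y hx hy => by simp only [map_add, hx, hy, smul_add]; abel) ?_ hx
    intro m x hm hx
    -- The mixed terms of `EF` and `FE` are `E k⁻² ⊗ k² F` and `k⁻² E ⊗ F k²`. The factors `q²` and
    -- `q⁻²` from exchanging `E` with `k⁻²` and `k²` with `F` cancel, so only the diagonal terms
    -- contribute to the commutator.
    have hE : opE r ((opkInv r ^ 2) (u r m)) = q r ^ 2 • (opkInv r ^ 2) (opE r (u r m)) := by
      cases m with
      | zero => simp [opkInv_sq_u, opE_u_zero]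
      | succ m =>
        rw [opkInv_sq_u, map_smul, opE_u_succ hm, opkInv_sq_u, smul_smul]
        congr 1
        rw [show ((m : ℕ) : ℤ) = (m + 1 : ℕ) - 1 by push_cast; ring, wt_shift]
        have := q_ne_zero r
        have := wt_ne_zero r 1 ((m + 1 : ℕ))
        field_simp
    have hF : tensorK r n (tensorF r n x) = (q r ^ 2)⁻¹ • tensorF r n (tensorK r n x) := by
      rw [tensorK_level hx, tensorK_level (tensorF_mem_level hx), map_smul, smul_smul]
      congr 1
      conv_rhs => rw [show t - m = (t - m + 1) - 1 by ring, wt_shift]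
      have := q_ne_zero r
      field_simp
    simp only [tensorE_tcons, tensorF_tcons, map_add, ih hx, opE_opF_u hr hm, hE, hF, map_smul,
      LinearMap.smul_apply, LinearMap.add_apply, smul_smul]
    rw [inv_mul_cancel₀ (pow_ne_zero _ (q_ne_zero r)), one_smul]
    have : wtInt r (n + 1) t • tcons r n (u r m) x =
        wtInt r n (t - m) • tcons r n ((opkInv r ^ 2) (u r m)) x +
          wtInt r 1 m • tcons r n (u r m) (tensorK r n x) := by
      rw [opkInv_sq_u, tensorK_level hx]
      simp only [map_smul, LinearMap.smul_apply, smul_smul, ← add_smul]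
      congr 1
      rw [wtInt, wtInt, wtInt, show wt r (n + 1) t = wt r 1 m * wt r n (t - m) by
        rw [← wt_succ]; congr 1; ring]
      have h1 := wt_ne_zero r 1 m
      have h2 := wt_ne_zero r n (t - m)
      have h3 := qnum_one_ne_zero hr
      field_simp
      ring
    rw [this]
    abel

/-! ### The braid generators in terms of basis vectors -/

theorem sum_qHalf_zpow {r : ℕ} (hr : 0 < r) (x : ℤ) :
    ∑ m ∈ Finset.range (4 * r), qHalf r ^ ((m : ℤ) * x) =
      if ((4 * r : ℕ) : ℤ) ∣ x then 4 * (r : ℂ) else 0 := by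
  have h := qHalf_isPrimitiveRoot hr
  have h1 : ∀ m : ℕ, qHalf r ^ ((m : ℤ) * x) = (qHalf r ^ x) ^ m := by
    intro m
    rw [mul_comm, zpow_mul, zpow_natCast]
  simp_rw [h1]
  split_ifs with hx
  · rw [(h.zpow_eq_one_iff_dvd x).2 hx]
    simp
  · have hne : qHalf r ^ x ≠ 1 := fun h' => hx ((h.zpow_eq_one_iff_dvd x).1 h')
    rw [geom_sum_eq hne, ← zpow_natCast, ← zpow_mul, mul_comm, zpow_mul, zpow_natCast, h.pow_eq_one]
    simp

/-- The sum over `m'` is a character sum modulo `4r` and kills every `m` except the residue of `k -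
2a`. The surviving term is the Cartan part `q^{H ⊗ H / 2}` of the `R`-matrix, evaluated after `E^a`
and `F^a` have shifted the weights. -/
theorem sum_sum_qHalf_zpow {r : ℕ} (hr : 0 < r) (a l k : ℤ) :
    ∑ m ∈ Finset.range (4 * r), ∑ m' ∈ Finset.range (4 * r),
      qHalf r ^ (2 * a * ((m : ℤ) - m') - m * m' + m * l + m' * k) =
      4 * (r : ℂ) * qHalf r ^ ((k - 2 * a) * (l + 2 * a)) := by
  have h := qHalf_isPrimitiveRoot hr
  have h0 := qHalf_ne_zero r
  have h1 : ∀ m m' : ℕ, qHalf r ^ (2 * a * ((m : ℤ) - m') - m * m' + m * l + m' * k) =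
      qHalf r ^ ((m : ℤ) * (l + 2 * a)) * qHalf r ^ ((m' : ℤ) * (k - 2 * a - m)) := by
    intro m m'
    rw [← zpow_add₀ h0]; congr 1; ring
  simp_rw [h1, ← Finset.mul_sum, sum_qHalf_zpow hr]
  have hpos : (0 : ℤ) < ((4 * r : ℕ) : ℤ) := by omega
  obtain ⟨m0, hm0⟩ := Int.eq_ofNat_of_zero_le (Int.emod_nonneg (k - 2 * a) hpos.ne')
  have hlt : m0 < 4 * r := by
    have := Int.emod_lt_of_pos (k - 2 * a) hpos
    rw [hm0] at this
    exact_mod_cast this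
  have hdvd : ((4 * r : ℕ) : ℤ) ∣ k - 2 * a - m0 := by
    have := Int.dvd_self_sub_emod (x := k - 2 * a) (m := ((4 * r : ℕ) : ℤ))
    rwa [hm0] at this
  rw [Finset.sum_eq_single m0]
  · rw [if_pos hdvd, mul_comm]
    congr 1
    obtain ⟨c, hc⟩ := hdvd
    rw [show k - 2 * a = m0 + ((4 * r : ℕ) : ℤ) * c by rw [← hc]; ring, add_mul, zpow_add₀ h0,
      mul_assoc, zpow_mul (qHalf r) ((4 * r : ℕ) : ℤ), zpow_natCast, h.pow_eq_one]
    simp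
  · intro b hb hne
    rw [if_neg, mul_zero]
    intro hb'
    have hd := dvd_sub hdvd hb'
    rw [show k - 2 * a - m0 - (k - 2 * a - b) = (b : ℤ) - m0 by ring] at hd
    rw [Finset.mem_range] at hb
    have h5 : (b : ℤ) - m0 = 0 := by
      apply Int.eq_zero_of_abs_lt_dvd hd
      rw [abs_lt]; constructor <;> omega
    omega
  · intro hm
    simp [hlt] at hm

theorem opk_pow_u (r a m : ℕ) :
    (opk r ^ a) (u r m) = qHalf r ^ ((a : ℤ) * ((r : ℤ) - 1 - 2 * m)) • u r m := by
  induction a with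
  | zero => simp
  | succ a ih =>
    rw [pow_succ', Module.End.mul_apply, ih, map_smul, opk_u, smul_smul,
      ← zpow_add₀ (qHalf_ne_zero r)]
    congr 2
    push_cast; ring

/-- The matrix coefficient of the braiding of `u_i ⊗ u_j` along `F^a u_j ⊗ E^a u_i`. -/
def scoeff (r : ℕ) (i j : ℤ) (a : ℕ) : ℂ :=
  (-1) ^ (i + j) * q r ^ (i + j + 2 * ((i - a) * (j + a))) * rcoeff r a

/-- The normalization `q^{-(r-1)²/2}` makes the total exponent of `q^{1/2}` even, so only integral
powers of `q` remain; the part divisible by `r` becomes a sign. -/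
theorem qHalf_zpow_braiding {r : ℕ} (hr : 0 < r) (i j a : ℤ) :
    qHalf r ^ (-((r : ℤ) - 1) ^ 2) *
      qHalf r ^ (((r : ℤ) - 1 - 2 * j - 2 * a) * ((r : ℤ) - 1 - 2 * i + 2 * a)) =
      (-1) ^ (i + j) * q r ^ (i + j + 2 * ((i - a) * (j + a))) := by
  rw [← zpow_add₀ (qHalf_ne_zero r),
    show -((r : ℤ) - 1) ^ 2 + ((r : ℤ) - 1 - 2 * j - 2 * a) * ((r : ℤ) - 1 - 2 * i + 2 * a) =
      2 * (r * -(i + j) + (i + j + 2 * ((i - a) * (j + a)))) by ring,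
    qHalf_zpow_two_mul, zpow_add₀ (q_ne_zero r), q_zpow_r_mul hr]
  congr 1
  rw [zpow_neg, ← inv_zpow]
  norm_num

theorem tensorFlip_tprod {r n : ℕ} (a b : Fin n) (f : Fin n → Steinberg r) :
    tensorFlip r n a b (PiTensorProduct.tprod ℂ f) =
      PiTensorProduct.tprod ℂ fun i => f (Equiv.swap a b i) := by
  rw [tensorFlip]
  erw [PiTensorProduct.reindex_tprod]
  rw [Equiv.symm_swap]

theorem tensorFlip_tcons {r n : ℕ} (v w : Steinberg r) (x : TPow r n) :
    tensorFlip r (n + 2) 0 1 (tcons r (n + 1) v (tcons r n w x)) =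
      tcons r (n + 1) w (tcons r n v x) := by
  have : tensorFlip r (n + 2) 0 1 ∘ₗ tcons r (n + 1) v ∘ₗ tcons r n w =
      tcons r (n + 1) w ∘ₗ tcons r n v := by
    apply PiTensorProduct.ext
    refine MultilinearMap.ext fun f => ?_
    simp only [LinearMap.compMultilinearMap_apply, LinearMap.comp_apply, tcons_tprod, tensorFlip_tprod]
    congr 1
    funext i
    refine Fin.cases ?_ (fun i => Fin.cases ?_ (fun i => ?_) i) i
    · rw [Equiv.swap_apply_left]; rfl
    · rw [show (Fin.succ 0 : Fin (n + 2)) = 1 from rfl, Equiv.swap_apply_right]; rfl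
    · rw [Equiv.swap_apply_of_ne_of_ne (Fin.succ_ne_zero _)
        (by rw [← Fin.succ_zero_eq_one]; exact fun h => Fin.succ_ne_zero _ (Fin.succ_injective _ h))]
      rfl
  exact LinearMap.congr_fun this x

theorem tensorR_tcons {r n : ℕ} (hr : 0 < r) (i j : ℕ) (x : TPow r n) :
    tensorR r (n + 2) 0 1 (tcons r (n + 1) (u r i) (tcons r n (u r j) x)) =
      ∑ a ∈ Finset.range r,
        (rcoeff r a * qHalf r ^ (((r : ℤ) - 1 - 2 * j - 2 * a) * ((r : ℤ) - 1 - 2 * i + 2 * a))) •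
        tcons r (n + 1) ((opE r ^ a) (u r i)) (tcons r n ((opF r ^ a) (u r j)) x) := by
  rw [tensorR]
  simp only [LinearMap.smul_apply, LinearMap.sum_apply]
  rw [Finset.smul_sum]
  refine Finset.sum_congr rfl fun a _ => ?_
  have h1 : ∀ m m' : ℕ, (qnum r 1 ^ (2 * a) / qnumFactorial r a *
      qHalf r ^ ((a : ℤ) * (a - 1) + 2 * a * ((m : ℤ) - m') - m * m')) •
      (PiTensorProduct.map fun l : Fin (n + 2) =>
        if l = 0 then opE r ^ a * opk r ^ m
        else if l = 1 then opF r ^ a * opk r ^ m'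
        else LinearMap.id) (tcons r (n + 1) (u r i) (tcons r n (u r j) x)) =
      (rcoeff r a * qHalf r ^ (2 * a * ((m : ℤ) - m') - m * m' + m * ((r : ℤ) - 1 - 2 * i) +
        m' * ((r : ℤ) - 1 - 2 * j))) •
        tcons r (n + 1) ((opE r ^ a) (u r i)) (tcons r n ((opF r ^ a) (u r j)) x) := by
    intro m m'
    rw [map_tcons, map_tcons]
    have h2 : ∀ l : Fin n, l.succ.succ ≠ (1 : Fin (n + 2)) := fun l h =>
      Fin.succ_ne_zero _ (Fin.succ_injective _ (h.trans Fin.succ_zero_eq_one.symm))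
    simp only [if_true, Fin.succ_ne_zero, if_false, one_ne_zero, Fin.succ_zero_eq_one, h2,
      PiTensorProduct.map_id, Module.End.mul_apply, opk_pow_u, map_smul, LinearMap.smul_apply,
      smul_smul, LinearMap.id_apply]
    congr 1
    have e : qHalf r ^ ((a : ℤ) * (a - 1)) * qHalf r ^ (2 * a * ((m : ℤ) - m') - m * m' +
        m * ((r : ℤ) - 1 - 2 * i) + m' * ((r : ℤ) - 1 - 2 * j)) =
        qHalf r ^ ((a : ℤ) * (a - 1) + 2 * a * ((m : ℤ) - m') - m * m') *
        qHalf r ^ (m * ((r : ℤ) - 1 - 2 * i)) * qHalf r ^ (m' * ((r : ℤ) - 1 - 2 * j)) := by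
      simp only [← zpow_add₀ (qHalf_ne_zero r)]
      congr 1
      ring
    rw [rcoeff, mul_assoc _ (qHalf r ^ _) (qHalf r ^ (2 * (a : ℤ) * _ - _ + _ + _)), e]
    ring
  simp_rw [h1, ← Finset.sum_smul, ← Finset.mul_sum, sum_sum_qHalf_zpow hr, smul_smul]
  congr 1
  have : (r : ℂ) ≠ 0 := by exact_mod_cast hr.ne'
  field_simp

theorem braidOp_zero_tcons {r n : ℕ} (hr : 0 < r) (i j : ℕ) (x : TPow r n) :
    braidOp r (n + 2) (0 : Fin (n + 1)) (tcons r (n + 1) (u r i) (tcons r n (u r j) x)) =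
      ∑ a ∈ Finset.range r, scoeff r i j a •
        tcons r (n + 1) ((opF r ^ a) (u r j)) (tcons r n ((opE r ^ a) (u r i)) x) := by
  have h1 : braidOp r (n + 2) (0 : Fin (n + 1)) =
    qHalf r ^ (-((r : ℤ) - 1) ^ 2) • (tensorFlip r (n + 2) 0 1 * tensorR r (n + 2) 0 1) := rfl
  rw [h1, LinearMap.smul_apply, Module.End.mul_apply, tensorR_tcons hr, map_sum, Finset.smul_sum]
  refine Finset.sum_congr rfl fun a _ => ?_
  rw [map_smul, tensorFlip_tcons, smul_smul]
  congr 1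
  rw [mul_left_comm, qHalf_zpow_braiding hr, scoeff]
  ring

theorem tensorFlip_succ_tcons {r n : ℕ} (a b : Fin n) (v : Steinberg r) (x : TPow r n) :
    tensorFlip r (n + 1) a.succ b.succ (tcons r n v x) = tcons r n v (tensorFlip r n a b x) := by
  have : tensorFlip r (n + 1) a.succ b.succ ∘ₗ tcons r n v = tcons r n v ∘ₗ tensorFlip r n a b := by
    apply PiTensorProduct.ext
    refine MultilinearMap.ext fun f => ?_
    simp only [LinearMap.compMultilinearMap_apply, LinearMap.comp_apply, tcons_tprod, tensorFlip_tprod]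
    congr 1
    funext i
    refine Fin.cases ?_ (fun i => ?_) i
    · rw [Equiv.swap_apply_of_ne_of_ne (Fin.succ_ne_zero _).symm (Fin.succ_ne_zero _).symm]
      rfl
    · rw [show Equiv.swap a.succ b.succ i.succ = (Equiv.swap a b i).succ by
        simp only [Equiv.swap_apply_def, Fin.succ_inj]; split_ifs <;> rfl]
      rfl
  exact LinearMap.congr_fun this x

theorem tensorR_succ_tcons {r n : ℕ} (a b : Fin n) (v : Steinberg r) (x : TPow r n) :
    tensorR r (n + 1) a.succ b.succ (tcons r n v x) = tcons r n v (tensorR r n a b x) := by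
  rw [tensorR, tensorR]
  simp only [LinearMap.smul_apply, LinearMap.sum_apply, map_smul, map_sum, map_tcons,
    (Fin.succ_ne_zero _).symm, if_false, Fin.succ_inj, LinearMap.id_apply]

theorem braidOp_succ_tcons {r n : ℕ} (i : Fin n) (v : Steinberg r) (x : TPow r (n + 1)) :
    braidOp r (n + 2) (i.succ : Fin (n + 1)) (tcons r (n + 1) v x) =
      tcons r (n + 1) v (braidOp r (n + 1) i x) := by
  have h1 : braidOp r (n + 2) (i.succ : Fin (n + 1)) = qHalf r ^ (-((r : ℤ) - 1) ^ 2) •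
      (tensorFlip r (n + 2) i.castSucc.succ i.succ.succ *
        tensorR r (n + 2) i.castSucc.succ i.succ.succ) := rfl
  have h2 : braidOp r (n + 1) i = qHalf r ^ (-((r : ℤ) - 1) ^ 2) •
      (tensorFlip r (n + 1) i.castSucc i.succ * tensorR r (n + 1) i.castSucc i.succ) := rfl
  rw [h1, h2, LinearMap.smul_apply, LinearMap.smul_apply, Module.End.mul_apply,
    Module.End.mul_apply, tensorR_succ_tcons, tensorFlip_succ_tcons, map_smul]

theorem braidOp_succ {r n : ℕ} (i : Fin n) :
    braidOp r (n + 2) (i.succ : Fin (n + 1)) =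
      (tmap 1 (braidOp r (n + 1) i) : Module.End ℂ (TPow r (n + 2))) := by
  apply tpow_ext
  intro m _ x
  rw [braidOp_succ_tcons, tmap_tcons, Module.End.one_apply]

/-! ### Commutation of powers -/

/-- Commutators with a power telescope. The hypothesis is required only along the orbit of `x`,
since the commutator of `E` and `F` is a scalar that changes with the level. -/
theorem apply_pow_succ {M : Type*} [AddCommGroup M] [Module ℂ M] (A B : Module.End ℂ M) (x : M)
    (w : ℕ → ℂ) (h : ∀ b, A (B ((B ^ b) x)) = B (A ((B ^ b) x)) + w b • (B ^ b) x) (a : ℕ) :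
    A ((B ^ (a + 1)) x) =
      (B ^ (a + 1)) (A x) + (∑ b ∈ Finset.range (a + 1), w b) • (B ^ a) x := by
  induction a with
  | zero => simpa using h 0
  | succ a ih =>
    rw [pow_succ' B (a + 1), Module.End.mul_apply, h, ih, map_add, map_smul,
      Finset.sum_range_succ _ (a + 1), add_smul, Module.End.mul_apply, pow_succ' B a,
      Module.End.mul_apply B, add_assoc]
    rfl

theorem wt_add_natCast (r n : ℕ) (t : ℤ) (b : ℤ) :
    wt r n (t + b) = wt r n t * q r ^ (-2 * b) := by
  simp only [wt]
  rw [show -(n : ℤ) - 2 * (t + b) = (-(n : ℤ) - 2 * t) + (-2 * b) by ring,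
    zpow_add₀ (q_ne_zero r), mul_assoc]

/-- The coefficient `[a+1] [λ - a]` of `F^a` in `E F^{a+1} - F^{a+1} E`, where `w = q^λ`. -/
def ccoeff (r : ℕ) (w : ℂ) (a : ℤ) : ℂ :=
  qnum r (a + 1) * (w * q r ^ (-a) - w⁻¹ * q r ^ a) / qnum r 1 ^ 2

theorem sum_wtInt_add {r : ℕ} (hr : 2 ≤ r) (n : ℕ) (t : ℤ) (a : ℕ) :
    ∑ b ∈ Finset.range (a + 1), wtInt r n (t + b) = ccoeff r (wt r n t) a := by
  have h1 := qnum_one_ne_zero hr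
  have h2 := q_ne_zero r
  have h3 := wt_ne_zero r n t
  induction a with
  | zero => simp [wtInt, ccoeff]; field_simp
  | succ a ih =>
    rw [Finset.sum_range_succ, ih, ccoeff, ccoeff, wtInt, wt_add_natCast]
    field_simp
    have h4 : q r ^ (a : ℤ) ≠ 0 := zpow_ne_zero _ h2
    simp only [qnum, Nat.cast_add, Nat.cast_one, neg_add_rev, neg_mul,
      show 2 * ((a : ℤ) + 1) = a + a + 1 + 1 by ring,
      zpow_add₀ h2, zpow_neg, zpow_one]
    generalize q r ^ (a : ℤ) = z at *
    field_simp
    ring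

theorem sum_wtInt_sub {r : ℕ} (hr : 2 ≤ r) (n : ℕ) (t : ℤ) (a : ℕ) :
    ∑ b ∈ Finset.range (a + 1), wtInt r n (t - b) = -ccoeff r (wt r n t)⁻¹ a := by
  have h1 := qnum_one_ne_zero hr
  have h2 := q_ne_zero r
  have h3 := wt_ne_zero r n t
  induction a with
  | zero => simp [wtInt, ccoeff]; field_simp; ring
  | succ a ih =>
    rw [Finset.sum_range_succ, ih, ccoeff, ccoeff, wtInt, sub_eq_add_neg t, wt_add_natCast]
    field_simp
    have h4 : q r ^ (a : ℤ) ≠ 0 := zpow_ne_zero _ h2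
    simp only [qnum, Nat.cast_add, Nat.cast_one, neg_add_rev, neg_mul,
      show 2 * (-1 + -(a : ℤ)) = -(a + a + 1 + 1) by ring,
      zpow_add₀ h2, zpow_neg, zpow_one]
    generalize q r ^ (a : ℤ) = z at *
    field_simp
    ring

theorem tensorF_tensorE_pow {r n : ℕ} (hr : 2 ≤ r) {t : ℤ} {x : TPow r n} (hx : x ∈ level r n t)
    (a : ℕ) : tensorF r n ((tensorE r n ^ (a + 1)) x) =
      (tensorE r n ^ (a + 1)) (tensorF r n x) +
        ccoeff r (wt r n t)⁻¹ a • (tensorE r n ^ a) x := by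
  rw [apply_pow_succ _ _ _ (fun b => -wtInt r n (t - b)), Finset.sum_neg_distrib,
    sum_wtInt_sub hr, neg_neg]
  intro b
  rw [tensorE_tensorF hr (tensorE_pow_mem_level hx b), neg_smul, add_neg_cancel_right]

theorem opE_opF_pow {r m : ℕ} (hr : 2 ≤ r) (a : ℕ) :
    opE r ((opF r ^ (a + 1)) (u r m)) =
      (opF r ^ (a + 1)) (opE r (u r m)) + ccoeff r (wt r 1 m) a • (opF r ^ a) (u r m) := by
  rw [apply_pow_succ _ _ _ (fun b => wtInt r 1 (m + b)), sum_wtInt_add hr]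
  intro b
  rw [opF_pow_u]
  by_cases h : m + b < r
  · simp only [map_smul]
    rw [opE_opF_u hr h, smul_add, smul_comm (wtInt _ _ _)]
    push_cast
    rfl
  · rw [u_of_le (by omega)]; simp

theorem opF_opE_pow {r m : ℕ} (hr : 2 ≤ r) (hm : m < r) (a : ℕ) :
    opF r ((opE r ^ (a + 1)) (u r m)) =
      (opE r ^ (a + 1)) (opF r (u r m)) + ccoeff r (wt r 1 m)⁻¹ a • (opE r ^ a) (u r m) := by
  rw [apply_pow_succ _ _ _ (fun b => -wtInt r 1 (m - b)), Finset.sum_neg_distrib,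
    sum_wtInt_sub hr, neg_neg]
  intro b
  rw [opE_pow_u _ _ hm]
  split_ifs with h
  · rw [opE_opF_u hr (by omega), neg_smul, Nat.cast_sub h, add_neg_cancel_right]
  · simp

theorem opk_sq_opE_pow_u {r m : ℕ} (hm : m < r) (a : ℕ) :
    (opk r ^ 2) ((opE r ^ a) (u r m)) = wt r 1 (m - a) • (opE r ^ a) (u r m) := by
  rw [opE_pow_u _ _ hm]
  split_ifs with h
  · rw [opk_sq_u, Nat.cast_sub h]
  · simp

theorem opH_opE_pow_u {r m : ℕ} (hm : m < r) (a : ℕ) :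
    opH r ((opE r ^ a) (u r m)) = ((r : ℂ) - 1 - 2 * (m - a)) • (opE r ^ a) (u r m) := by
  rw [opE_pow_u _ _ hm]
  split_ifs with h
  · rw [opH_u, Nat.cast_sub h]
  · simp

theorem opkInv_sq_opF_pow_u {r : ℕ} (m a : ℕ) :
    (opkInv r ^ 2) ((opF r ^ a) (u r m)) = (wt r 1 (m + a))⁻¹ • (opF r ^ a) (u r m) := by
  rw [opF_pow_u, map_smul, opkInv_sq_u, smul_comm]; push_cast; rfl

theorem opH_opF_pow_u {r : ℕ} (m a : ℕ) :
    opH r ((opF r ^ a) (u r m)) = ((r : ℂ) - 1 - 2 * (m + a)) • (opF r ^ a) (u r m) := by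
  rw [opF_pow_u, map_smul, opH_u, smul_comm]; push_cast; rfl

/-! ### The braid generators commute with the quantum group -/

theorem tpow_ext₂ {r n : ℕ} {M : Type*} [AddCommMonoid M] [Module ℂ M]
    {f g : TPow r (n + 2) →ₗ[ℂ] M}
    (h : ∀ i < r, ∀ j < r, ∀ x, f (tcons r (n + 1) (u r i) (tcons r n (u r j) x)) =
      g (tcons r (n + 1) (u r i) (tcons r n (u r j) x))) : f = g := by
  apply tpow_ext
  intro i hi y
  have : f ∘ₗ tcons r (n + 1) (u r i) = g ∘ₗ tcons r (n + 1) (u r i) :=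
    tpow_ext fun j hj x => h i hi j hj x
  exact LinearMap.congr_fun this y

theorem scoeff_sub_right (r : ℕ) (i j : ℤ) (a : ℕ) :
    scoeff r i (j - 1) a = scoeff r i j a * wt r 1 (i - a) := by
  have h := q_ne_zero r
  simp only [scoeff, wt]
  rw [show i + (j - 1) = i + j - 1 by ring, zpow_sub₀ (by norm_num : (-1 : ℂ) ≠ 0),
    show i + j - 1 + 2 * ((i - a) * (j - 1 + a)) =
      (i + j + 2 * ((i - a) * (j + a))) + (-((1 : ℕ) : ℤ) - 2 * (i - a)) by push_cast; ring,
    zpow_add₀ h]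
  norm_num
  ring

theorem scoeff_add_left (r : ℕ) (i j : ℤ) (a : ℕ) :
    scoeff r (i + 1) j a = scoeff r i j a * (wt r 1 (j + a))⁻¹ := by
  have h := q_ne_zero r
  simp only [scoeff, wt]
  rw [show i + 1 + j = i + j + 1 by ring, zpow_add₀ (by norm_num : (-1 : ℂ) ≠ 0),
    show i + j + 1 + 2 * ((i + 1 - a) * (j + a)) =
      (i + j + 2 * ((i - a) * (j + a))) - (-((1 : ℕ) : ℤ) - 2 * (j + a)) by push_cast; ring,
    zpow_sub₀ h, mul_inv]
  simp [div_eq_mul_inv]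
  ring

theorem scoeff_succ {r a : ℕ} (ha : a + 1 < r) (i j : ℤ) :
    scoeff r i j (a + 1) * qnum r (a + 1) =
      scoeff r i j a * q r ^ (2 * i - 2 * j - 3 * a - 2) * qnum r 1 ^ 2 := by
  have h := q_ne_zero r
  simp only [scoeff]
  rw [mul_assoc, rcoeff_succ ha,
    show i + j + 2 * ((i - (a + 1 : ℕ)) * (j + (a + 1 : ℕ))) =
      (i + j + 2 * ((i - a) * (j + a))) + (2 * i - 2 * j - 4 * a - 2) by push_cast; ring,
    zpow_add₀ h, show 2 * i - 2 * j - 3 * (a : ℤ) - 2 = (2 * i - 2 * j - 4 * a - 2) + a by ring,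
    zpow_add₀ h (2 * i - 2 * j - 4 * a - 2)]
  ring

/-- This compares the coefficients of `F^a u_j ⊗ E^{a+1} u_i` when the braiding is commuted with
`Δ(E)`. The left side comes from `E ⊗ k²` before the braiding. On the right stand the term `1 ⊗ E`
after it and the commutator of `E` with `F^{a+1}`. -/
theorem scoeff_sub_left {r a : ℕ} (ha : a + 1 < r) (i j : ℤ) :
    wt r 1 j * scoeff r (i - 1) j a =
      scoeff r i j a + scoeff r i j (a + 1) * wt r 1 (i - (a + 1 : ℕ)) *
        ccoeff r (wt r 1 j) a := by
  have h := q_ne_zero r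
  have h1 := qnum_one_ne_zero (r := r) (by omega)
  have e : scoeff r i j (a + 1) * wt r 1 (i - (a + 1 : ℕ)) * ccoeff r (wt r 1 j) a =
      (scoeff r i j a * q r ^ (2 * i - 2 * j - 3 * a - 2) * qnum r 1 ^ 2) *
        wt r 1 (i - (a + 1 : ℕ)) *
        ((wt r 1 j * q r ^ (-a : ℤ) - (wt r 1 j)⁻¹ * q r ^ (a : ℤ)) / qnum r 1 ^ 2) := by
    rw [← scoeff_succ ha, ccoeff]; ring
  have e2 : scoeff r i j a = scoeff r (i - 1) j a * (wt r 1 (j + a))⁻¹ := by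
    rw [← scoeff_add_left, sub_add_cancel]
  rw [e, e2]
  generalize scoeff r (i - 1) j a = S
  simp only [wt, Nat.cast_one, pow_one, Nat.cast_add]
  rw [show 2 * i - 2 * j - 3 * (a : ℤ) - 2 = i + i - j - j - a - a - a - 1 - 1 by ring,
    show (-1 : ℤ) - 2 * (i - (a + 1)) = - i - i + a + a + 1 by ring,
    show (-1 : ℤ) - 2 * j = -1 - j - j by ring,
    show (-1 : ℤ) - 2 * (j + a) = -1 - j - j - a - a by ring]
  simp only [zpow_add₀ h, zpow_sub₀ h, zpow_neg, zpow_one]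
  have h2 : q r ^ i ≠ 0 := zpow_ne_zero _ h
  have h3 : q r ^ j ≠ 0 := zpow_ne_zero _ h
  have h4 : q r ^ (a : ℤ) ≠ 0 := zpow_ne_zero _ h
  generalize q r ^ i = X at *
  generalize q r ^ j = Y at *
  generalize q r ^ (a : ℤ) = Z at *
  field_simp
  ring

/-- The counterpart for `Δ(F)`, comparing the coefficients of `F^{a+1} u_j ⊗ E^a u_i`; the last term
is now the commutator of `F` with `E^{a+1}`. -/
theorem scoeff_add_right {r a : ℕ} (ha : a + 1 < r) (i j : ℤ) :
    (wt r 1 i)⁻¹ * scoeff r i (j + 1) a =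
      scoeff r i j a + scoeff r i j (a + 1) * (wt r 1 (j + (a + 1 : ℕ)))⁻¹ *
        ccoeff r (wt r 1 i)⁻¹ a := by
  have h := q_ne_zero r
  have h1 := qnum_one_ne_zero (r := r) (by omega)
  have e : scoeff r i j (a + 1) * (wt r 1 (j + (a + 1 : ℕ)))⁻¹ * ccoeff r (wt r 1 i)⁻¹ a =
      (scoeff r i j a * q r ^ (2 * i - 2 * j - 3 * a - 2) * qnum r 1 ^ 2) *
        (wt r 1 (j + (a + 1 : ℕ)))⁻¹ *
        (((wt r 1 i)⁻¹ * q r ^ (-a : ℤ) - ((wt r 1 i)⁻¹)⁻¹ * q r ^ (a : ℤ)) / qnum r 1 ^ 2) := by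
    rw [← scoeff_succ ha, ccoeff]; ring
  have e2 : scoeff r i j a = scoeff r i (j + 1) a * wt r 1 (i - a) := by
    rw [← scoeff_sub_right, add_sub_cancel_right]
  rw [e, e2]
  generalize scoeff r i (j + 1) a = S
  simp only [wt, Nat.cast_one, pow_one, Nat.cast_add]
  rw [show 2 * i - 2 * j - 3 * (a : ℤ) - 2 = i + i - j - j - a - a - a - 1 - 1 by ring,
    show (-1 : ℤ) - 2 * (j + (a + 1)) = - j - j - a - a - 1 - 1 - 1 by ring,
    show (-1 : ℤ) - 2 * i = -1 - i - i by ring,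
    show (-1 : ℤ) - 2 * (i - a) = -1 - i - i + a + a by ring]
  simp only [zpow_add₀ h, zpow_sub₀ h, zpow_neg, zpow_one]
  have h2 : q r ^ i ≠ 0 := zpow_ne_zero _ h
  have h3 : q r ^ j ≠ 0 := zpow_ne_zero _ h
  have h4 : q r ^ (a : ℤ) ≠ 0 := zpow_ne_zero _ h
  generalize q r ^ i = X at *
  generalize q r ^ j = Y at *
  generalize q r ^ (a : ℤ) = Z at *
  field_simp
  ring

/-- `E` acting on the first two tensor factors. -/
def pairE (r n : ℕ) : Module.End ℂ (TPow r (n + 2)) :=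
  (tmap 1 (tmap (opE r) 1) : Module.End ℂ (TPow r (n + 2))) + tmap (opE r) (tmap (opk r ^ 2) 1)

/-- `F` acting on the first two tensor factors. -/
def pairF (r n : ℕ) : Module.End ℂ (TPow r (n + 2)) :=
  (tmap (opkInv r ^ 2) (tmap (opF r) 1) : Module.End ℂ (TPow r (n + 2))) + tmap (opF r) 1

theorem braidOp_zero_tcons_opE_left {r n : ℕ} {i j : ℕ} (hi : i < r) (x : TPow r n) :
    braidOp r (n + 2) (0 : Fin (n + 1)) (tcons r (n + 1) (opE r (u r i)) (tcons r n (u r j) x)) =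
      ∑ a ∈ Finset.range r, scoeff r (i - 1) j a •
        tcons r (n + 1) ((opF r ^ a) (u r j)) (tcons r n ((opE r ^ a) (opE r (u r i))) x) := by
  cases i with
  | zero => simp [opE_u_zero]
  | succ i => rw [opE_u_succ hi, braidOp_zero_tcons (by omega)]; simp

theorem braidOp_zero_tcons_opE_right {r n : ℕ} {i j : ℕ} (hj : j < r) (x : TPow r n) :
    braidOp r (n + 2) (0 : Fin (n + 1)) (tcons r (n + 1) (u r i) (tcons r n (opE r (u r j)) x)) =
      ∑ a ∈ Finset.range r, scoeff r i (j - 1) a •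
        tcons r (n + 1) ((opF r ^ a) (opE r (u r j))) (tcons r n ((opE r ^ a) (u r i)) x) := by
  cases j with
  | zero => simp [opE_u_zero]
  | succ i => rw [opE_u_succ hj, braidOp_zero_tcons (by omega)]; simp

theorem braidOp_zero_tcons_opF_left {r n : ℕ} (hr : 0 < r) (i j : ℕ) (x : TPow r n) :
    braidOp r (n + 2) (0 : Fin (n + 1)) (tcons r (n + 1) (opF r (u r i)) (tcons r n (u r j) x)) =
      ∑ a ∈ Finset.range r, scoeff r (i + 1) j a •
        tcons r (n + 1) ((opF r ^ a) (u r j)) (tcons r n ((opE r ^ a) (opF r (u r i))) x) := by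
  rw [opF_u]
  simp only [map_smul, LinearMap.smul_apply]
  rw [braidOp_zero_tcons hr, Finset.smul_sum]
  refine Finset.sum_congr rfl fun a _ => ?_
  rw [smul_comm]
  push_cast
  rfl

theorem braidOp_zero_tcons_opF_right {r n : ℕ} (hr : 0 < r) (i j : ℕ) (x : TPow r n) :
    braidOp r (n + 2) (0 : Fin (n + 1)) (tcons r (n + 1) (u r i) (tcons r n (opF r (u r j)) x)) =
      ∑ a ∈ Finset.range r, scoeff r i (j + 1) a •
        tcons r (n + 1) ((opF r ^ a) (opF r (u r j))) (tcons r n ((opE r ^ a) (u r i)) x) := by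
  rw [opF_u]
  simp only [map_smul, LinearMap.smul_apply]
  rw [braidOp_zero_tcons hr, Finset.smul_sum]
  refine Finset.sum_congr rfl fun a _ => ?_
  rw [smul_comm]
  push_cast
  rfl

/-- Terms in which `E` has reached `u_j` match by `scoeff_sub_right`, and the others by the
recursion `scoeff_sub_left`. That recursion needs `a + 1 < r`; the remaining top summands vanish
because `E^r = 0`. -/
theorem braidOp_zero_commute_pairE {r n : ℕ} (hr : 2 ≤ r) :
    Commute (braidOp r (n + 2) (0 : Fin (n + 1))) (pairE r n) := by
  apply tpow_ext₂
  intro i hi j hj x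
  obtain ⟨r', rfl⟩ : ∃ r', r = r' + 1 := ⟨r - 1, by omega⟩
  simp only [Module.End.mul_apply, pairE, LinearMap.add_apply, tmap_tcons, Module.End.one_apply,
    map_add, opk_sq_u, map_smul, LinearMap.smul_apply]
  rw [braidOp_zero_tcons_opE_left hi, braidOp_zero_tcons_opE_right hj,
    braidOp_zero_tcons (by omega)]
  simp only [map_sum, map_smul, tmap_tcons, Module.End.one_apply, opk_sq_opE_pow_u hi,
    LinearMap.smul_apply]
  -- The index is shifted here because `E F^{a+1}` produces both an `F^{a+1} E` term and an `F^a`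
  -- term, and the second has to meet the summands of index `a`.
  rw [Finset.sum_range_succ' (fun a => scoeff (r' + 1) i j a •
    wt (r' + 1) 1 (i - a) • tcons (r' + 1) (n + 1) (opE (r' + 1) ((opF (r' + 1) ^ a) (u (r' + 1) j)))
      (tcons (r' + 1) n ((opE (r' + 1) ^ a) (u (r' + 1) i)) x))]
  simp only [opE_opF_pow hr, map_add, LinearMap.add_apply, map_smul, LinearMap.smul_apply, smul_add,
    Finset.sum_add_distrib]
  rw [Finset.sum_range_succ' (fun a => scoeff (r' + 1) i (j - 1) a • _),
    Finset.sum_range_succ (fun a => scoeff (r' + 1) (i - 1) j a • _),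
    Finset.sum_range_succ (fun a => scoeff (r' + 1) i j a • _)]
  have hz : ∀ v, (opE (r' + 1) ^ r') ((opE (r' + 1)) v) = 0 := by
    intro v
    rw [← Module.End.mul_apply, ← pow_succ, opE_pow_r, LinearMap.zero_apply]
  have hz' : ∀ v, (opE (r' + 1)) ((opE (r' + 1) ^ r') v) = 0 := by
    intro v
    rw [← Module.End.mul_apply, ← pow_succ', opE_pow_r, LinearMap.zero_apply]
  rw [hz, hz']
  simp only [map_zero, LinearMap.zero_apply, smul_zero, add_zero, pow_zero, Module.End.one_apply,
    scoeff_sub_right, Finset.smul_sum, smul_smul]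
  have key : ∑ a ∈ Finset.range r', (wt (r' + 1) 1 j * scoeff (r' + 1) (i - 1) j a) •
      tcons (r' + 1) (n + 1) ((opF (r' + 1) ^ a) (u (r' + 1) j))
        (tcons (r' + 1) n ((opE (r' + 1) ^ a) (opE (r' + 1) (u (r' + 1) i))) x) =
      ∑ a ∈ Finset.range r', scoeff (r' + 1) i j a •
        tcons (r' + 1) (n + 1) ((opF (r' + 1) ^ a) (u (r' + 1) j))
        (tcons (r' + 1) n (opE (r' + 1) ((opE (r' + 1) ^ a) (u (r' + 1) i))) x) +
      ∑ a ∈ Finset.range r', (scoeff (r' + 1) i j (a + 1) * (wt (r' + 1) 1 (i - (a + 1 : ℕ)) *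
        ccoeff (r' + 1) (wt (r' + 1) 1 j) a)) •
        tcons (r' + 1) (n + 1) ((opF (r' + 1) ^ a) (u (r' + 1) j))
        (tcons (r' + 1) n ((opE (r' + 1) ^ (a + 1)) (u (r' + 1) i)) x) := by
    rw [← Finset.sum_add_distrib]
    refine Finset.sum_congr rfl fun a ha => ?_
    rw [Finset.mem_range] at ha
    rw [scoeff_sub_left (by omega), ← mul_assoc, add_smul, ← Module.End.mul_apply (opE _ ^ a),
      ← Module.End.mul_apply (opE _), ← pow_succ, ← pow_succ']
  rw [key]
  abel

theorem braidOp_zero_commute_pairF {r n : ℕ} (hr : 2 ≤ r) :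
    Commute (braidOp r (n + 2) (0 : Fin (n + 1))) (pairF r n) := by
  apply tpow_ext₂
  intro i hi j hj x
  obtain ⟨r', rfl⟩ : ∃ r', r = r' + 1 := ⟨r - 1, by omega⟩
  simp only [Module.End.mul_apply, pairF, LinearMap.add_apply, tmap_tcons, Module.End.one_apply,
    map_add, opkInv_sq_u, map_smul, LinearMap.smul_apply]
  rw [braidOp_zero_tcons_opF_left (by omega), braidOp_zero_tcons_opF_right (by omega),
    braidOp_zero_tcons (by omega)]
  simp only [map_sum, map_smul, tmap_tcons, Module.End.one_apply, opkInv_sq_opF_pow_u,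
    LinearMap.smul_apply]
  rw [Finset.sum_range_succ' (fun a => scoeff (r' + 1) i j a •
    (wt (r' + 1) 1 (j + a))⁻¹ • tcons (r' + 1) (n + 1) ((opF (r' + 1) ^ a) (u (r' + 1) j))
      (tcons (r' + 1) n (opF (r' + 1) ((opE (r' + 1) ^ a) (u (r' + 1) i))) x))]
  simp only [opF_opE_pow hr hi, map_add, LinearMap.add_apply, map_smul, LinearMap.smul_apply,
    smul_add, Finset.sum_add_distrib]
  rw [Finset.sum_range_succ' (fun a => scoeff (r' + 1) (i + 1) j a • _),
    Finset.sum_range_succ (fun a => scoeff (r' + 1) i (j + 1) a • _),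
    Finset.sum_range_succ (fun a => scoeff (r' + 1) i j a • _)]
  have hz' : opF (r' + 1) ((opF (r' + 1) ^ r') (u (r' + 1) j)) = 0 := by
    rw [← Module.End.mul_apply, ← pow_succ', opF_pow_u_eq_zero (by omega)]
  have hz : (opF (r' + 1) ^ r') (opF (r' + 1) (u (r' + 1) j)) = 0 := by
    rw [← Module.End.mul_apply, ← pow_succ, opF_pow_u_eq_zero (by omega)]
  rw [hz, hz']
  simp only [map_zero, LinearMap.zero_apply, smul_zero, add_zero, pow_zero, Module.End.one_apply,
    scoeff_add_left, Finset.smul_sum, smul_smul]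
  have key : ∑ a ∈ Finset.range r', ((wt (r' + 1) 1 i)⁻¹ * scoeff (r' + 1) i (j + 1) a) •
      tcons (r' + 1) (n + 1) ((opF (r' + 1) ^ a) (opF (r' + 1) (u (r' + 1) j)))
        (tcons (r' + 1) n ((opE (r' + 1) ^ a) (u (r' + 1) i)) x) =
      ∑ a ∈ Finset.range r', scoeff (r' + 1) i j a •
        tcons (r' + 1) (n + 1) (opF (r' + 1) ((opF (r' + 1) ^ a) (u (r' + 1) j)))
        (tcons (r' + 1) n ((opE (r' + 1) ^ a) (u (r' + 1) i)) x) +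
      ∑ a ∈ Finset.range r', (scoeff (r' + 1) i j (a + 1) * ((wt (r' + 1) 1 (j + (a + 1 : ℕ)))⁻¹ *
        ccoeff (r' + 1) (wt (r' + 1) 1 i)⁻¹ a)) •
        tcons (r' + 1) (n + 1) ((opF (r' + 1) ^ (a + 1)) (u (r' + 1) j))
        (tcons (r' + 1) n ((opE (r' + 1) ^ a) (u (r' + 1) i)) x) := by
    rw [← Finset.sum_add_distrib]
    refine Finset.sum_congr rfl fun a ha => ?_
    rw [Finset.mem_range] at ha
    rw [scoeff_add_right (by omega), ← mul_assoc, add_smul, ← Module.End.mul_apply (opF _ ^ a),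
      ← Module.End.mul_apply (opF _), ← pow_succ, ← pow_succ']
  rw [key]
  abel

theorem braidOp_zero_commute_tmap {r n : ℕ} (hr : 0 < r) (B : Module.End ℂ (TPow r n)) :
    Commute (braidOp r (n + 2) (0 : Fin (n + 1)))
      (tmap 1 (tmap 1 B) : Module.End ℂ (TPow r (n + 2))) := by
  apply tpow_ext₂
  intro i _ j _ x
  simp only [Module.End.mul_apply, tmap_tcons, Module.End.one_apply, braidOp_zero_tcons hr, map_sum,
    map_smul]

/-- The braiding moves `a` levels from one factor to the other, so it commutes with any diagonal
operator whose eigenvalue on a pair depends only on the total level. This covers `k²` and `k⁻²`. -/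
theorem braidOp_zero_commute_diagonal {r n : ℕ} (hr : 0 < r) {A : Module.End ℂ (Steinberg r)}
    {f : ℤ → ℂ} (hA : ∀ m : ℕ, A (u r m) = f m • u r m)
    (hf : ∀ i j a : ℤ, f (j + a) * f (i - a) = f i * f j) (B : Module.End ℂ (TPow r n)) :
    Commute (braidOp r (n + 2) (0 : Fin (n + 1)))
      (tmap A (tmap A B) : Module.End ℂ (TPow r (n + 2))) := by
  apply tpow_ext₂
  intro i hi j _ x
  have hE : ∀ a : ℕ, A ((opE r ^ a) (u r i)) = f (i - a) • (opE r ^ a) (u r i) := by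
    intro a
    rw [opE_pow_u _ _ hi]
    split_ifs with h
    · rw [hA, Nat.cast_sub h]
    · simp
  have hF : ∀ a : ℕ, A ((opF r ^ a) (u r j)) = f (j + a) • (opF r ^ a) (u r j) := by
    intro a
    rw [opF_pow_u, map_smul, hA, smul_comm]; push_cast; rfl
  simp only [Module.End.mul_apply, tmap_tcons, hA, braidOp_zero_tcons hr, map_sum,
    map_smul, LinearMap.smul_apply, hE, hF, Finset.smul_sum, smul_smul]
  refine Finset.sum_congr rfl fun a _ => ?_
  congr 1
  rw [mul_assoc, mul_comm (f (i - a)), hf]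
  ring

theorem braidOp_zero_commute_tensorH {r n : ℕ} (hr : 0 < r) :
    Commute (braidOp r (n + 2) (0 : Fin (n + 1))) (tensorH r (n + 2)) := by
  apply tpow_ext₂
  intro i hi j _ x
  simp only [Module.End.mul_apply, tensorH_tcons, opH_u, map_add, map_smul, LinearMap.smul_apply,
    braidOp_zero_tcons hr, map_sum, opH_opE_pow_u hi, opH_opF_pow_u, Finset.smul_sum,
    smul_smul, ← Finset.sum_add_distrib, smul_add]
  refine Finset.sum_congr rfl fun a _ => ?_
  module

/-! ### Commutation of all generators with `E`, `F`, `H` by splitting off strands. -/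

theorem tensorE_add_two (r n : ℕ) : tensorE r (n + 2) =
    (tmap 1 (tmap 1 (tensorE r n)) : Module.End ℂ (TPow r (n + 2))) +
      pairE r n * (tmap 1 (tmap 1 (tensorK r n)) : Module.End ℂ (TPow r (n + 2))) := by
  apply tpow_ext₂
  intro i _ j _ x
  simp only [tensorE_tcons, tensorK_tcons, LinearMap.add_apply, Module.End.mul_apply, tmap_tcons,
    pairE, Module.End.one_apply, map_add, add_assoc]

theorem tensorF_add_two (r n : ℕ) : tensorF r (n + 2) =
    (tmap (opkInv r ^ 2) (tmap (opkInv r ^ 2) (tensorF r n)) : Module.End ℂ (TPow r (n + 2))) +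
      pairF r n := by
  apply tpow_ext₂
  intro i _ j _ x
  simp only [tensorF_tcons, LinearMap.add_apply, tmap_tcons,
    pairF, Module.End.one_apply, map_add, add_assoc]

theorem tensorE_succ (r n : ℕ) : tensorE r (n + 1) =
    (tmap 1 (tensorE r n) : Module.End ℂ (TPow r (n + 1))) + tmap (opE r) (tensorK r n) := by
  apply tpow_ext
  intro i _ x
  simp only [tensorE_tcons, LinearMap.add_apply, tmap_tcons, Module.End.one_apply]

theorem tensorF_succ (r n : ℕ) : tensorF r (n + 1) =
    (tmap (opkInv r ^ 2) (tensorF r n) : Module.End ℂ (TPow r (n + 1))) + tmap (opF r) 1 := by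
  apply tpow_ext
  intro i _ x
  simp only [tensorF_tcons, LinearMap.add_apply, tmap_tcons, Module.End.one_apply]

theorem tensorH_succ (r n : ℕ) : tensorH r (n + 1) =
    (tmap 1 (tensorH r n) : Module.End ℂ (TPow r (n + 1))) + tmap (opH r) 1 := by
  apply tpow_ext
  intro i _ x
  simp only [tensorH_tcons, LinearMap.add_apply, tmap_tcons, Module.End.one_apply]

theorem tensorK_succ (r n : ℕ) : tensorK r (n + 1) =
    (tmap (opk r ^ 2) (tensorK r n) : Module.End ℂ (TPow r (n + 1))) := by
  apply tpow_ext
  intro i _ x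
  simp only [tensorK_tcons, tmap_tcons]

theorem tmap_commute {r n : ℕ} {A A' : Module.End ℂ (Steinberg r)} {B B' : Module.End ℂ (TPow r n)}
    (hA : Commute A A') (hB : Commute B B') :
    Commute (tmap A B : Module.End ℂ (TPow r (n + 1))) (tmap A' B') := by
  rw [Commute, SemiconjBy, tmap_mul, tmap_mul, hA.eq, hB.eq]

theorem braidOp_commute_tensorK {r n : ℕ} (hr : 0 < r) (i : Fin n) :
    Commute (braidOp r (n + 1) i) (tensorK r (n + 1)) := by
  induction n with
  | zero => exact i.elim0
  | succ n ih =>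
    rw [tensorK_succ]
    refine Fin.cases ?_ (fun i => ?_) i
    · rw [tensorK_succ]
      refine braidOp_zero_commute_diagonal hr (fun m => opk_sq_u m) (fun i j a => ?_) _
      rw [← wt_succ, ← wt_succ]; congr 1; ring
    · rw [braidOp_succ]
      exact tmap_commute (Commute.one_left _) (ih i)

theorem braidOp_commute_tensorE {r n : ℕ} (hr : 2 ≤ r) (i : Fin n) :
    Commute (braidOp r (n + 1) i) (tensorE r (n + 1)) := by
  induction n with
  | zero => exact i.elim0
  | succ n ih =>
    refine Fin.cases ?_ (fun i => ?_) i
    · rw [tensorE_add_two]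
      exact (braidOp_zero_commute_tmap (by omega) _).add_right
        ((braidOp_zero_commute_pairE hr).mul_right (braidOp_zero_commute_tmap (by omega) _))
    · rw [braidOp_succ, tensorE_succ]
      exact (tmap_commute (Commute.one_left _) (ih i)).add_right
        (tmap_commute (Commute.one_left _) (braidOp_commute_tensorK (by omega) i))

theorem braidOp_commute_tensorF {r n : ℕ} (hr : 2 ≤ r) (i : Fin n) :
    Commute (braidOp r (n + 1) i) (tensorF r (n + 1)) := by
  induction n with
  | zero => exact i.elim0
  | succ n ih =>
    refine Fin.cases ?_ (fun i => ?_) i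
    · rw [tensorF_add_two]
      refine (braidOp_zero_commute_diagonal (by omega) (f := fun m => (wt r 1 m)⁻¹)
        (fun m => opkInv_sq_u m) (fun i j a => ?_) _).add_right (braidOp_zero_commute_pairF hr)
      rw [← mul_inv, ← mul_inv, ← wt_succ, ← wt_succ]; congr 2; ring
    · rw [braidOp_succ, tensorF_succ]
      exact (tmap_commute (Commute.one_left _) (ih i)).add_right
        (tmap_commute (Commute.one_left _) (Commute.one_right _))

theorem braidOp_commute_tensorH {r n : ℕ} (hr : 2 ≤ r) (i : Fin n) :
    Commute (braidOp r (n + 1) i) (tensorH r (n + 1)) := by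
  induction n with
  | zero => exact i.elim0
  | succ n ih =>
    refine Fin.cases ?_ (fun i => ?_) i
    · exact braidOp_zero_commute_tensorH (by omega)
    · rw [braidOp_succ, tensorH_succ]
      exact (tmap_commute (Commute.one_left _) (ih i)).add_right
        (tmap_commute (Commute.one_left _) (Commute.one_right _))

/-! ### The `q`-binomial theorem -/

theorem qnum_add_right (r : ℕ) (a b : ℤ) :
    q r ^ (-b) * qnum r a + q r ^ a * qnum r b = qnum r (a + b) := by
  simp only [qnum, neg_add_rev, zpow_add₀ (q_ne_zero r), zpow_neg]
  ring

/-- The induction step is the `q`-Pascal rule `qnum_add_right`, once `Y` has been moved past `X^a`.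
The restriction `c < r` keeps all the factorials invertible at this root of unity. -/
theorem add_pow_of_qcommute {r : ℕ} {A : Type*} [Semiring A] [Algebra ℂ A] {X Y : A}
    (h : Y * X = q r ^ 2 • (X * Y)) {c : ℕ} (hc : c < r) :
    (X + Y) ^ c = qnumFactorial r c • ∑ p ∈ Finset.HasAntidiagonal.antidiagonal c,
      (q r ^ ((p.1 : ℤ) * p.2) / (qnumFactorial r p.1 * qnumFactorial r p.2)) •
        (X ^ p.1 * Y ^ p.2) := by
  have hq := q_ne_zero r
  have hcomm : ∀ a : ℕ, Y * X ^ a = q r ^ (2 * (a : ℤ)) • (X ^ a * Y) := by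
    intro a
    induction a with
    | zero => simp
    | succ a ih =>
      rw [pow_succ, ← mul_assoc, ih, smul_mul_assoc, mul_assoc, h, mul_smul_comm, smul_smul,
        ← mul_assoc, Nat.cast_succ, mul_add, zpow_add₀ hq]
      norm_cast
  induction c with
  | zero => simp [qnumFactorial_zero]
  | succ c ih =>
    have hne := qnumFactorial_ne_zero hc
    rw [qnumFactorial_succ] at hne
    have h0 := left_ne_zero_of_mul hne
    have h1 := right_ne_zero_of_mul hne
    rw [pow_succ', ih (by omega), qnumFactorial_succ, mul_smul, mul_smul_comm]
    congr 1
    rw [add_mul, Finset.mul_sum, Finset.mul_sum]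
    have e1 : ∑ p ∈ Finset.HasAntidiagonal.antidiagonal c, X * ((q r ^ ((p.1 : ℤ) * p.2) /
        (qnumFactorial r p.1 * qnumFactorial r p.2)) • (X ^ p.1 * Y ^ p.2)) =
        ∑ p ∈ Finset.HasAntidiagonal.antidiagonal (c + 1), (q r ^ ((p.1 : ℤ) * p.2) /
        (qnumFactorial r p.1 * qnumFactorial r p.2) * (q r ^ (-(p.2 : ℤ)) * qnum r p.1)) •
          (X ^ p.1 * Y ^ p.2) := by
      rw [Finset.Nat.sum_antidiagonal_succ]
      simp only [Nat.cast_zero, qnum_zero, mul_zero, zero_smul, zero_add]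
      refine Finset.sum_congr rfl fun p hp => ?_
      rw [Finset.HasAntidiagonal.mem_antidiagonal] at hp
      have hf := qnumFactorial_ne_zero (r := r) (a := p.1 + 1) (by omega)
      rw [qnumFactorial_succ] at hf ⊢
      have hf0 := left_ne_zero_of_mul hf
      have hf1 := right_ne_zero_of_mul hf
      rw [mul_smul_comm, ← mul_assoc, ← pow_succ']
      congr 1
      have hf2 := qnumFactorial_ne_zero (r := r) (a := p.2) (by omega)
      push_cast
      rw [show ((p.1 : ℤ) + 1) * p.2 = p.1 * p.2 + p.2 by ring, zpow_add₀ hq, zpow_neg]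
      have := zpow_ne_zero (p.2 : ℤ) hq
      field_simp
    have e2 : ∑ p ∈ Finset.HasAntidiagonal.antidiagonal c, Y * ((q r ^ ((p.1 : ℤ) * p.2) /
        (qnumFactorial r p.1 * qnumFactorial r p.2)) • (X ^ p.1 * Y ^ p.2)) =
        ∑ p ∈ Finset.HasAntidiagonal.antidiagonal (c + 1), (q r ^ ((p.1 : ℤ) * p.2) /
        (qnumFactorial r p.1 * qnumFactorial r p.2) * (q r ^ (p.1 : ℤ) * qnum r p.2)) •
          (X ^ p.1 * Y ^ p.2) := by
      rw [Finset.Nat.sum_antidiagonal_succ']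
      simp only [Nat.cast_zero, qnum_zero, mul_zero, zero_smul, zero_add]
      refine Finset.sum_congr rfl fun p hp => ?_
      rw [Finset.HasAntidiagonal.mem_antidiagonal] at hp
      have hf := qnumFactorial_ne_zero (r := r) (a := p.2 + 1) (by omega)
      rw [qnumFactorial_succ] at hf ⊢
      have hf0 := left_ne_zero_of_mul hf
      have hf1 := right_ne_zero_of_mul hf
      rw [mul_smul_comm, ← mul_assoc, hcomm, smul_mul_assoc, mul_assoc, ← pow_succ', smul_smul]
      congr 1
      have hf2 := qnumFactorial_ne_zero (r := r) (a := p.1) (by omega)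
      push_cast
      rw [show (p.1 : ℤ) * (p.2 + 1) = p.1 * p.2 + p.1 by ring, zpow_add₀ hq, two_mul,
        zpow_add₀ hq]
      field_simp
    rw [e1, e2, ← Finset.sum_add_distrib, Finset.smul_sum]
    refine Finset.sum_congr rfl fun p hp => ?_
    rw [Finset.HasAntidiagonal.mem_antidiagonal] at hp
    rw [← add_smul, ← mul_add, qnum_add_right, smul_smul, mul_comm]
    congr 3
    exact_mod_cast hp

/-! ### The Yang–Baxter equation -/

/-- In the applications the terms with `a + b ≥ r` contain a vanishing power of `E` or `F` of that
total order, so the square of indices may be replaced by a triangle, on which the `q`-binomial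
theorem applies. -/
theorem sum_range_range_eq_antidiagonal {M : Type*} [AddCommMonoid M] {r : ℕ} {f : ℕ → ℕ → M}
    (hf : ∀ a b, r ≤ a + b → f a b = 0) :
    ∑ a ∈ Finset.range r, ∑ b ∈ Finset.range r, f a b =
      ∑ c ∈ Finset.range r, ∑ p ∈ Finset.HasAntidiagonal.antidiagonal c, f p.1 p.2 := by
  rw [← Finset.sum_product']
  have h1 : ∑ x ∈ Finset.range r ×ˢ Finset.range r, f x.1 x.2 =
      ∑ x ∈ (Finset.range r ×ˢ Finset.range r) with x.1 + x.2 < r, f x.1 x.2 := by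
    rw [Finset.sum_filter_of_ne]
    intro x _ hx
    by_contra h
    exact hx (hf _ _ (by omega))
  rw [h1, ← Finset.sum_fiberwise_of_maps_to (t := Finset.range r) (g := fun x => x.1 + x.2)
    (by simp)]
  refine Finset.sum_congr rfl fun c hc => ?_
  rw [Finset.mem_range] at hc
  refine Finset.sum_congr ?_ fun _ _ => rfl
  ext x
  simp only [Finset.mem_filter, Finset.mem_product, Finset.mem_range,
    Finset.HasAntidiagonal.mem_antidiagonal]
  omega

theorem tmap_smul_right {r n : ℕ} (A : Module.End ℂ (Steinberg r)) (c : ℂ)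
    (B : Module.End ℂ (TPow r n)) : tmap A (c • B) = c • tmap A B := by
  apply tpow_ext
  intro m _ x
  simp [tmap_tcons]

theorem tmap_smul_left {r n : ℕ} (A : Module.End ℂ (Steinberg r)) (c : ℂ)
    (B : Module.End ℂ (TPow r n)) : tmap (c • A) B = c • tmap A B := by
  apply tpow_ext
  intro m _ x
  simp [tmap_tcons]

theorem opk_sq_mul_opE (r : ℕ) : opk r ^ 2 * opE r = q r ^ 2 • (opE r * opk r ^ 2) := by
  apply steinberg_ext
  intro m hm
  simp only [Module.End.mul_apply, LinearMap.smul_apply, opk_sq_u]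
  cases m with
  | zero => simp [opE_u_zero]
  | succ m =>
    rw [map_smul, opE_u_succ hm, opk_sq_u, smul_smul, ← wt_shift]
    push_cast; simp

theorem opk_sq_pow_u {r : ℕ} (m b : ℕ) : ((opk r ^ 2) ^ b) (u r m) = wt r 1 m ^ b • u r m := by
  induction b with
  | zero => simp
  | succ b ih => rw [pow_succ', Module.End.mul_apply, ih, map_smul, opk_sq_u, smul_smul, pow_succ]

theorem pairE_pow_tcons {r n c : ℕ} (hc : c < r) (i j : ℕ) (x : TPow r n) :
    (pairE r n ^ c) (tcons r (n + 1) (u r i) (tcons r n (u r j) x)) =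
      ∑ p ∈ Finset.HasAntidiagonal.antidiagonal c, (qnumFactorial r c *
        (q r ^ ((p.1 : ℤ) * p.2) / (qnumFactorial r p.1 * qnumFactorial r p.2)) * wt r 1 j ^ p.2) •
        tcons r (n + 1) ((opE r ^ p.2) (u r i)) (tcons r n ((opE r ^ p.1) (u r j)) x) := by
  have h : (tmap (opE r) (tmap (opk r ^ 2) 1) : Module.End ℂ (TPow r (n + 2))) *
      tmap 1 (tmap (opE r) 1) = q r ^ 2 • ((tmap 1 (tmap (opE r) 1) :
        Module.End ℂ (TPow r (n + 2))) * tmap (opE r) (tmap (opk r ^ 2) 1)) := by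
    rw [tmap_mul, tmap_mul, tmap_mul, tmap_mul, opk_sq_mul_opE, tmap_smul_left, tmap_smul_right,
      mul_one, one_mul, one_mul]
  rw [show pairE r n ^ c = _ from add_pow_of_qcommute h hc]
  simp only [LinearMap.smul_apply, LinearMap.sum_apply, Finset.smul_sum, smul_smul, tmap_pow,
    Module.End.mul_apply, tmap_tcons, opk_sq_pow_u, map_smul, one_pow, Module.End.one_apply]

/-- The coefficient of `F^c u_k ⊗ E^c y` in the braiding of a level `m` tensor `y` in two factors
with `u_k`. -/
def pairCoeff (r : ℕ) (m k : ℤ) (c : ℕ) : ℂ :=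
  (-1) ^ (m + c) * q r ^ (m + 2 * k + c + 2 * ((m - c) * (k + c))) * rcoeff r c

/-- The bracket on the right is the coefficient of `E^b ⊗ E^a` in `Δ(E)^{a+b}`; the power of `wt r 1
j` is the `k²` that each `E` on the first factor leaves on the second. -/
theorem scoeff_mul_scoeff {r a b : ℕ} (hab : a + b < r) (i j k : ℤ) :
    scoeff r j k a * scoeff r i (k + a) b = pairCoeff r (i + j) k (a + b) *
      (qnumFactorial r (a + b) * (q r ^ ((a : ℤ) * b) /
        (qnumFactorial r a * qnumFactorial r b)) * wt r 1 j ^ b) := by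
  have h := q_ne_zero r
  have hm : (-1 : ℂ) ≠ 0 := by norm_num
  have e1 : scoeff r j k a * scoeff r i (k + a) b =
      ((-1) ^ (j + k) * (-1) ^ (i + (k + a))) * (q r ^ (j + k + 2 * ((j - a) * (k + a))) *
        q r ^ (i + (k + a) + 2 * ((i - b) * ((k + a) + b)))) * (rcoeff r a * rcoeff r b) := by
    rw [scoeff, scoeff]; ring
  have e2 : wt r 1 j ^ b = (-1) ^ (b : ℤ) * q r ^ (-(b : ℤ) - 2 * (j * b)) := by
    rw [wt, mul_pow, ← zpow_natCast (q r ^ _), ← zpow_mul, pow_one, zpow_natCast]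
    congr 2
    push_cast; ring
  rw [e1, rcoeff_mul hab, pairCoeff, e2, ← zpow_add₀ hm, ← zpow_add₀ h]
  have e3 : ((-1 : ℂ) ^ (j + k + (i + (k + a)))) =
      (-1) ^ (i + j + ((a + b : ℕ) : ℤ)) * (-1) ^ (b : ℤ) := by
    rw [← zpow_add₀ hm,
      show j + k + (i + (k + a)) = (i + j + a) + 2 * k by ring,
      show i + j + ((a + b : ℕ) : ℤ) + b = (i + j + a) + 2 * b by push_cast; ring,
      zpow_add₀ hm, zpow_add₀ hm (i + j + a), zpow_mul, zpow_mul]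
    norm_num
  have e4 : q r ^ (j + k + 2 * ((j - a) * (k + a)) + (i + (k + a) + 2 * ((i - b) * (k + a + b)))) *
      q r ^ (-((a : ℤ) * b)) =
      q r ^ (i + j + 2 * k + ((a + b : ℕ) : ℤ) + 2 * ((i + j - ((a + b : ℕ) : ℤ)) *
        (k + ((a + b : ℕ) : ℤ)))) * q r ^ ((a : ℤ) * b) * q r ^ (-(b : ℤ) - 2 * (j * b)) := by
    rw [← zpow_add₀ h, ← zpow_add₀ h, ← zpow_add₀ h]
    congr 1
    push_cast; ring
  rw [e3]
  linear_combination ((-1) ^ (i + j + ((a + b : ℕ) : ℤ)) * (-1) ^ (b : ℤ) * (rcoeff r (a + b) *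
    (qnumFactorial r (a + b) / (qnumFactorial r a * qnumFactorial r b)))) * e4

theorem braidOp_zero_tcons_opF_pow {r n : ℕ} (hr : 0 < r) (i k a : ℕ) (x : TPow r n) :
    braidOp r (n + 2) (0 : Fin (n + 1))
        (tcons r (n + 1) (u r i) (tcons r n ((opF r ^ a) (u r k)) x)) =
      ∑ b ∈ Finset.range r, scoeff r i (k + a) b •
        tcons r (n + 1) ((opF r ^ (a + b)) (u r k)) (tcons r n ((opE r ^ b) (u r i)) x) := by
  simp only [add_comm a, pow_add, Module.End.mul_apply]
  rw [opF_pow_u]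
  simp only [map_smul, LinearMap.smul_apply]
  rw [braidOp_zero_tcons hr, Finset.smul_sum]
  refine Finset.sum_congr rfl fun b _ => ?_
  rw [smul_comm]
  push_cast
  rfl

/-- A hexagon identity: moving `u_k` past two strands one at a time is a single braiding past their
tensor product, with `E` acting there through the coproduct. The two successive sums recombine by
the `q`-binomial theorem. -/
theorem braidOp_zero_one_tcons {r n : ℕ} (hr : 0 < r) (i j k : ℕ) (x : TPow r n) :
    braidOp r (n + 3) (0 : Fin (n + 2)) (braidOp r (n + 3) (1 : Fin (n + 2))
      (tcons r (n + 2) (u r i) (tcons r (n + 1) (u r j) (tcons r n (u r k) x)))) =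
      ∑ c ∈ Finset.range r, pairCoeff r (i + j) k c • tcons r (n + 2) ((opF r ^ c) (u r k))
        ((pairE r n ^ c) (tcons r (n + 1) (u r i) (tcons r n (u r j) x))) := by
  rw [← Fin.succ_zero_eq_one, braidOp_succ_tcons, braidOp_zero_tcons hr]
  simp only [map_sum, map_smul, braidOp_zero_tcons_opF_pow hr]
  simp only [Finset.smul_sum, smul_smul]
  rw [sum_range_range_eq_antidiagonal]
  · refine Finset.sum_congr rfl fun c hc => ?_
    rw [Finset.mem_range] at hc
    rw [pairE_pow_tcons hc]
    simp only [map_sum, map_smul, Finset.smul_sum, smul_smul]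
    refine Finset.sum_congr rfl fun p hp => ?_
    rw [Finset.HasAntidiagonal.mem_antidiagonal] at hp
    subst hp
    rw [scoeff_mul_scoeff hc]
  · intro a b hab
    rw [opF_pow_u_eq_zero (by omega)]
    simp

/-- By the hexagon identity, moving the third strand past the first two involves only the total
level of those two and powers of `Δ(E)` on them. Braiding these two strands preserves the level and
commutes with `Δ(E)`, so it may be done before or after. -/
theorem braidOp_yang_baxter {r n : ℕ} (hr : 2 ≤ r) :
    braidOp r (n + 3) (0 : Fin (n + 2)) * braidOp r (n + 3) (1 : Fin (n + 2)) *
        braidOp r (n + 3) (0 : Fin (n + 2)) =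
      braidOp r (n + 3) (1 : Fin (n + 2)) * braidOp r (n + 3) (0 : Fin (n + 2)) *
        braidOp r (n + 3) (1 : Fin (n + 2)) := by
  apply tpow_ext₂
  intro i hi j hj y
  have : ((braidOp r (n + 3) (0 : Fin (n + 2)) * braidOp r (n + 3) (1 : Fin (n + 2)) *
        braidOp r (n + 3) (0 : Fin (n + 2))) ∘ₗ tcons r (n + 2) (u r i)) ∘ₗ
          tcons r (n + 1) (u r j) =
      ((braidOp r (n + 3) (1 : Fin (n + 2)) * braidOp r (n + 3) (0 : Fin (n + 2)) *
        braidOp r (n + 3) (1 : Fin (n + 2))) ∘ₗ tcons r (n + 2) (u r i)) ∘ₗ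
          tcons r (n + 1) (u r j) := by
    apply tpow_ext
    intro k hk x
    simp only [LinearMap.comp_apply, Module.End.mul_apply]
    rw [braidOp_zero_one_tcons (by omega), braidOp_zero_tcons (by omega)]
    -- The vectors `F^a u_j ⊗ E^a u_i` still have total level `i + j`, so the same coefficients
    -- `pairCoeff r (i + j) k c` occur for every `a`.
    have hpair : ∀ a : ℕ, braidOp r (n + 3) (0 : Fin (n + 2)) (braidOp r (n + 3) (1 : Fin (n + 2))
        (tcons r (n + 2) ((opF r ^ a) (u r j)) (tcons r (n + 1) ((opE r ^ a) (u r i))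
          (tcons r n (u r k) x)))) =
        ∑ c ∈ Finset.range r, pairCoeff r (i + j) k c • tcons r (n + 2) ((opF r ^ c) (u r k))
        ((pairE r n ^ c) (tcons r (n + 1) ((opF r ^ a) (u r j))
          (tcons r n ((opE r ^ a) (u r i)) x))) := by
      intro a
      rw [opE_pow_u _ _ hi, opF_pow_u]
      split_ifs with h
      · simp only [map_smul, LinearMap.smul_apply]
        rw [braidOp_zero_one_tcons (by omega), Finset.smul_sum]
        refine Finset.sum_congr rfl fun c _ => ?_
        rw [smul_comm]
        congr 2
        push_cast [Nat.cast_sub h]; ring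
      · simp
    simp only [map_sum, map_smul, hpair, Finset.smul_sum]
    rw [Finset.sum_comm]
    refine Finset.sum_congr rfl fun c _ => ?_
    rw [← Fin.succ_zero_eq_one, braidOp_succ_tcons, ← Module.End.mul_apply (braidOp _ _ _),
      ((braidOp_zero_commute_pairE hr).pow_right c).eq, Module.End.mul_apply,
      braidOp_zero_tcons (by omega)]
    simp only [map_sum, map_smul, Finset.smul_sum]
    refine Finset.sum_congr rfl fun a _ => ?_
    rw [smul_comm]
  exact LinearMap.congr_fun this y

theorem braidOp_far {r n : ℕ} (hr : 0 < r) (i j : Fin n) (hij : (i : ℕ) + 1 < j) :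
    Commute (braidOp r (n + 1) i) (braidOp r (n + 1) j) := by
  induction n with
  | zero => exact i.elim0
  | succ n ih =>
    obtain ⟨j, rfl⟩ := Fin.exists_succ_eq.2 (show j ≠ 0 by rintro rfl; simp at hij)
    rw [braidOp_succ]
    refine Fin.cases (motive := fun i => (i : ℕ) + 1 < _ → Commute (braidOp r (n + 2) i) _)
      (fun h => ?_) (fun i h => ?_) i hij
    · cases n with
      | zero => exact j.elim0
      | succ n =>
        obtain ⟨j, rfl⟩ := Fin.exists_succ_eq.2 (show j ≠ 0 by rintro rfl; simp at h)
        rw [braidOp_succ]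
        exact braidOp_zero_commute_tmap hr _
    · rw [braidOp_succ]
      exact tmap_commute (Commute.one_left _) (ih i j (by simpa using h))

theorem braidOp_braid {r n : ℕ} (hr : 2 ≤ r) (i j : Fin n) (hij : (i : ℕ) + 1 = j) :
    braidOp r (n + 1) i * braidOp r (n + 1) j * braidOp r (n + 1) i =
      braidOp r (n + 1) j * braidOp r (n + 1) i * braidOp r (n + 1) j := by
  induction n with
  | zero => exact i.elim0
  | succ n ih =>
    obtain ⟨j, rfl⟩ := Fin.exists_succ_eq.2 (show j ≠ 0 by rintro rfl; simp at hij)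
    refine Fin.cases (motive := fun i => (i : ℕ) + 1 = _ → braidOp r (n + 2) i * _ *
      braidOp r (n + 2) i = _ * braidOp r (n + 2) i * _) (fun h => ?_) (fun i h => ?_) i hij
    · cases n with
      | zero => exact j.elim0
      | succ n =>
        obtain rfl : j = 0 := by ext; simpa using h.symm
        exact braidOp_yang_baxter hr
    · rw [braidOp_succ, braidOp_succ, tmap_mul, tmap_mul, tmap_mul, tmap_mul,
        ih i j (by simpa using h)]

/-! ### The braid group representation -/

theorem scoeff_zero_ne_zero (r : ℕ) (i j : ℤ) : scoeff r i j 0 ≠ 0 := by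
  rw [scoeff, rcoeff_zero, mul_one]
  exact mul_ne_zero (zpow_ne_zero _ (by norm_num)) (zpow_ne_zero _ (q_ne_zero r))

/-- The braiding is triangular relative to the flip. Its `a = 0` term is a nonzero multiple of `u_j
⊗ u_i`, and the other terms have `u_{i-a}` in the second factor, which allows strong induction on
`i`. -/
theorem tcons_mem_range_braidOp_zero {r n : ℕ} {i : ℕ} (hi : i < r) (j : ℕ) (x : TPow r n) :
    tcons r (n + 1) (u r j) (tcons r n (u r i) x) ∈
      LinearMap.range (braidOp r (n + 2) (0 : Fin (n + 1))) := by
  induction i using Nat.strong_induction_on generalizing j with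
  | _ i ih =>
    obtain ⟨r', rfl⟩ : ∃ r', r = r' + 1 := ⟨r - 1, by omega⟩
    have h := braidOp_zero_tcons (n := n) (by omega : 0 < r' + 1) i j x
    rw [Finset.sum_range_succ', ← sub_eq_iff_eq_add'] at h
    simp only [pow_zero, Module.End.one_apply] at h
    rw [← Submodule.smul_mem_iff _ (scoeff_zero_ne_zero (r' + 1) i j), ← h]
    refine sub_mem (LinearMap.mem_range_self _ _) (Submodule.sum_mem _ fun a _ => ?_)
    refine Submodule.smul_mem _ _ ?_
    rw [opE_pow_u _ _ hi, opF_pow_u, map_smul, LinearMap.smul_apply]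
    refine Submodule.smul_mem _ _ ?_
    split_ifs with hle
    · exact ih _ (by omega) (by omega) _
    · simp

theorem braidOp_isUnit {r n : ℕ} (i : Fin n) : IsUnit (braidOp r (n + 1) i) := by
  rw [Module.End.isUnit_iff]
  suffices h : Function.Surjective (braidOp r (n + 1) i) from
    ⟨LinearMap.injective_iff_surjective.2 h, h⟩
  rw [← LinearMap.range_eq_top, eq_top_iff]
  rintro y -
  induction n with
  | zero => exact i.elim0
  | succ n ih =>
    rw [← sum_tcons_coord y]
    refine Submodule.sum_mem _ fun m _ => ?_
    refine Fin.cases ?_ (fun i => ?_) i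
    · generalize coord r (n + 1) m y = z
      rw [← sum_tcons_coord z, map_sum]
      exact Submodule.sum_mem _ fun m' _ => tcons_mem_range_braidOp_zero m'.2 _ _
    · obtain ⟨z, hz⟩ := ih (y := coord r (n + 1) m y) i
      refine ⟨tcons r (n + 1) (u r m) z, ?_⟩
      rw [braidOp_succ_tcons, hz]

/-- The representation of the braid group on `n + 1` strands on the tensor power. -/
def braidRep {r : ℕ} (hr : 2 ≤ r) (n : ℕ) :
    Representation ℂ (BraidGroup (n + 1)) (TPow r (n + 1)) :=
  (Units.coeHom _).comp (PresentedGroup.toGroup (rels := braidRels (n + 1))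
    (f := fun i : Fin n => (braidOp_isUnit (r := r) i).unit) (by
      rintro x (⟨i, j, hij, rfl⟩ | ⟨i, j, hij, rfl⟩)
      · simp only [map_mul, map_inv, FreeGroup.lift_apply_of, mul_inv_eq_one]
        ext1
        exact (braidOp_far (by omega) i j hij).eq
      · simp only [map_mul, map_inv, FreeGroup.lift_apply_of, mul_inv_eq_one]
        ext1
        exact braidOp_braid hr i j hij))

theorem braidRep_sigma {r : ℕ} (hr : 2 ≤ r) (n : ℕ) (i : Fin n) :
    braidRep hr n (sigma i) = braidOp r (n + 1) i := by
  rw [braidRep, MonoidHom.comp_apply, sigma, PresentedGroup.toGroup.of]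
  rfl

theorem braidRep_commute {r : ℕ} (hr : 2 ≤ r) {n : ℕ} {T : Module.End ℂ (TPow r (n + 1))}
    (hT : ∀ i : Fin n, Commute (braidOp r (n + 1) i) T) (g : BraidGroup (n + 1)) :
    Commute (braidRep hr n g) T := by
  let S : Subgroup (BraidGroup (n + 1)) :=
    { carrier := {g | Commute (braidRep hr n g) T}
      one_mem' := by
        rw [Set.mem_ofPred_eq, map_one]; exact Commute.one_left _
      mul_mem' := fun {a b} ha hb => by
        rw [Set.mem_ofPred_eq, map_mul]; exact Commute.mul_left ha hb
      inv_mem' := fun {a} ha => by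
        have h1 : braidRep hr n a⁻¹ * braidRep hr n a = 1 := by
          rw [← map_mul, inv_mul_cancel, map_one]
        have h2 : braidRep hr n a * braidRep hr n a⁻¹ = 1 := by
          rw [← map_mul, mul_inv_cancel, map_one]
        calc braidRep hr n a⁻¹ * T
            = braidRep hr n a⁻¹ * (T * braidRep hr n a) * braidRep hr n a⁻¹ := by
              rw [mul_assoc, mul_assoc, h2, mul_one]
          _ = T * braidRep hr n a⁻¹ := by
              rw [← Commute.eq ha, ← mul_assoc, h1, one_mul] }
  refine PresentedGroup.generated_by _ S (fun i => ?_) g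
  change Commute (braidRep hr n (sigma i)) T
  rw [braidRep_sigma hr n i]
  exact hT i

/-! ### Twists in a sequence of elements satisfying the Artin relations -/

/-- The first `N` terms of the sequence `g` satisfy the Artin relations. -/
structure IsBraidSeq {G : Type*} [Group G] (g : ℕ → G) (N : ℕ) : Prop where
  far : ∀ i j, i + 1 < j → j < N → Commute (g i) (g j)
  braid : ∀ i, i + 1 < N → g i * g (i + 1) * g i = g (i + 1) * g i * g (i + 1)

/-- `g_0 g_1 ⋯ g_{m-1}`. -/
def ascProd {G : Type*} [Group G] (g : ℕ → G) : ℕ → G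
  | 0 => 1
  | m + 1 => ascProd g m * g m

/-- `g_{m-1} ⋯ g_1 g_0`. -/
def descProd {G : Type*} [Group G] (g : ℕ → G) : ℕ → G
  | 0 => 1
  | m + 1 => g m * descProd g m

/-- `(g_0 ⋯ g_{m-1}) (g_0 ⋯ g_{m-2}) ⋯ g_0`. -/
def halfProd {G : Type*} [Group G] (g : ℕ → G) : ℕ → G
  | 0 => 1
  | m + 1 => ascProd g (m + 1) * halfProd g m

section

variable {G : Type*} [Group G] {g : ℕ → G} {N : ℕ}

theorem IsBraidSeq.tail (h : IsBraidSeq g (N + 1)) : IsBraidSeq (fun i => g (i + 1)) N where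
  far i j hij hj := h.far _ _ (by omega) (by omega)
  braid i hi := h.braid _ (by omega)

theorem IsBraidSeq.mono (h : IsBraidSeq g N) {m : ℕ} (hm : m ≤ N) : IsBraidSeq g m where
  far i j hij hj := h.far _ _ hij (by omega)
  braid i hi := h.braid _ (by omega)

theorem ascProd_succ' (g : ℕ → G) (m : ℕ) :
    ascProd g (m + 1) = g 0 * ascProd (fun i => g (i + 1)) m := by
  induction m with
  | zero => simp [ascProd]
  | succ m ih => rw [ascProd, ih, ascProd, mul_assoc]

theorem descProd_succ' (g : ℕ → G) (m : ℕ) :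
    descProd g (m + 1) = descProd (fun i => g (i + 1)) m * g 0 := by
  induction m with
  | zero => simp [descProd]
  | succ m ih => rw [descProd, ih, descProd, mul_assoc]

theorem commute_ascProd {c : G} {m : ℕ} (h : ∀ i < m, Commute c (g i)) :
    Commute c (ascProd g m) := by
  induction m with
  | zero => exact Commute.one_right _
  | succ m ih => exact (ih fun i hi => h i (by omega)).mul_right (h m (by omega))

theorem commute_descProd {c : G} {m : ℕ} (h : ∀ i < m, Commute c (g i)) :
    Commute c (descProd g m) := by
  induction m with
  | zero => exact Commute.one_right _
  | succ m ih => exact (h m (by omega)).mul_right (ih fun i hi => h i (by omega))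

theorem semiconj_ascProd {c : G} {g' : ℕ → G} {m : ℕ} (h : ∀ i < m, SemiconjBy c (g i) (g' i)) :
    SemiconjBy c (ascProd g m) (ascProd g' m) := by
  induction m with
  | zero => exact SemiconjBy.one_right _
  | succ m ih => exact (ih fun i hi => h i (by omega)).mul_right (h m (by omega))

theorem semiconj_halfProd {c : G} {g' : ℕ → G} {m : ℕ} (h : ∀ i < m, SemiconjBy c (g i) (g' i)) :
    SemiconjBy c (halfProd g m) (halfProd g' m) := by
  induction m with
  | zero => exact SemiconjBy.one_right _
  | succ m ih => exact (semiconj_ascProd h).mul_right (ih fun i hi => h i (by omega))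

/-- The factors beyond `g_{i+1}` commute with `g_i` and can be stripped off; the remaining case is
one braid relation, after which `g_{i+1}` passes through the factors of index below `i`. -/
theorem IsBraidSeq.ascProd_semiconj {m i : ℕ} (h : IsBraidSeq g m) (hi : i + 1 < m) :
    SemiconjBy (ascProd g m) (g i) (g (i + 1)) := by
  induction m with
  | zero => omega
  | succ m ih =>
    rcases Nat.lt_or_ge (i + 1) m with h1 | h1
    · exact (ih (h.mono (by omega)) h1).mul_left (h.far i m h1 (by omega)).symm
    · obtain rfl : m = i + 1 := by omega
      have hc : Commute (g (i + 1)) (ascProd g i) :=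
        commute_ascProd fun k hk => (h.far k (i + 1) (by omega) (by omega)).symm
      change ascProd g i * g i * g (i + 1) * g i = g (i + 1) * (ascProd g i * g i * g (i + 1))
      have := h.braid i hi
      calc ascProd g i * g i * g (i + 1) * g i
          = ascProd g i * (g i * g (i + 1) * g i) := by group
        _ = ascProd g i * g (i + 1) * g i * g (i + 1) := by rw [this]; group
        _ = _ := by rw [← hc.eq]; group

theorem IsBraidSeq.descProd_semiconj {m i : ℕ} (h : IsBraidSeq g m) (hi : i + 1 < m) :
    SemiconjBy (descProd g m) (g (i + 1)) (g i) := by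
  induction m with
  | zero => omega
  | succ m ih =>
    rcases Nat.lt_or_ge (i + 1) m with h1 | h1
    · exact SemiconjBy.mul_left (h.far i m h1 (by omega)).symm (ih (h.mono (by omega)) h1)
    · obtain rfl : m = i + 1 := by omega
      have hc : Commute (g (i + 1)) (descProd g i) :=
        commute_descProd fun k hk => (h.far k (i + 1) (by omega) (by omega)).symm
      change g (i + 1) * (g i * descProd g i) * g (i + 1) = g i * (g (i + 1) * (g i * descProd g i))
      have := h.braid i hi
      calc g (i + 1) * (g i * descProd g i) * g (i + 1)
          = g (i + 1) * g i * (descProd g i * g (i + 1)) := by group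
        _ = (g (i + 1) * g i * g (i + 1)) * descProd g i := by rw [← hc.eq]; group
        _ = _ := by rw [← this]; group

/-- The half twist may also be built by appending descending products on the right. The last
generator commutes with the half twist that is two strands shorter, which lets it be transferred
from the ascending to the descending product. -/
theorem IsBraidSeq.halfProd_succ' {m : ℕ} (h : IsBraidSeq g (m + 1)) :
    halfProd g (m + 1) = halfProd g m * descProd g (m + 1) := by
  induction m with
  | zero => simp [halfProd, ascProd, descProd]
  | succ m ih =>
    have hc : Commute (g (m + 1)) (halfProd g m) :=
      semiconj_halfProd fun k hk => (h.far k (m + 1) (by omega) (by omega)).symm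
    rw [show halfProd g (m + 2) = ascProd g (m + 2) * halfProd g (m + 1) from rfl,
      ih (h.mono (by omega)),
      show ascProd g (m + 2) = ascProd g (m + 1) * g (m + 1) from rfl,
      show descProd g (m + 2) = g (m + 1) * descProd g (m + 1) from rfl]
    calc ascProd g (m + 1) * g (m + 1) * (halfProd g m * descProd g (m + 1))
        = ascProd g (m + 1) * (g (m + 1) * halfProd g m) * descProd g (m + 1) := by group
      _ = ascProd g (m + 1) * halfProd g m * (g (m + 1) * descProd g (m + 1)) := by
          rw [hc.eq]; group
      _ = _ := by rw [← ih (h.mono (by omega))]; rfl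

theorem IsBraidSeq.ascProd_descProd_commute {m i : ℕ} (h : IsBraidSeq g (m + 1)) (hi : i < m) :
    Commute (ascProd g (m + 1) * descProd g (m + 1)) (g (i + 1)) :=
  (h.ascProd_semiconj (by omega)).mul_left (h.descProd_semiconj (by omega))

/-- With `Δ'` the half twist of the shifted strands, `Δ = Δ' · asc = desc · Δ'`, so `Δ² = Δ' · asc ·
desc · Δ'`. The loop `asc · desc` commutes with `Δ'`. Geometrically, the first strand makes a full
turn around the others, which undergo their own full twist. -/
theorem IsBraidSeq.halfProd_sq {m : ℕ} (h : IsBraidSeq g (m + 1)) :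
    halfProd g (m + 1) ^ 2 = ascProd g (m + 1) * descProd g (m + 1) *
      halfProd (fun i => g (i + 1)) m ^ 2 := by
  have h1 : halfProd g (m + 1) = halfProd (fun i => g (i + 1)) m * ascProd g (m + 1) :=
    semiconj_halfProd fun i hi => h.ascProd_semiconj (by omega)
  have h2 : halfProd g (m + 1) = descProd g (m + 1) * halfProd (fun i => g (i + 1)) m := by
    rw [h.halfProd_succ']
    exact (semiconj_halfProd (c := descProd g (m + 1)) (g := fun i => g (i + 1)) (g' := g)
      fun i hi => h.descProd_semiconj (by omega)).eq.symm
  have h3 : Commute (ascProd g (m + 1) * descProd g (m + 1)) (halfProd (fun i => g (i + 1)) m) :=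
    semiconj_halfProd fun i hi => h.ascProd_descProd_commute hi
  rw [sq]
  nth_rewrite 1 [h1]
  rw [h2, mul_assoc, ← mul_assoc (ascProd _ _), ← mul_assoc, ← h3.eq, mul_assoc, sq]

theorem IsBraidSeq.halfProd_sq_commute {m i : ℕ} (h : IsBraidSeq g m) (hi : i < m) :
    Commute (halfProd g m ^ 2) (g i) := by
  induction m generalizing g i with
  | zero => omega
  | succ m ih =>
    cases i with
    | succ i =>
      rw [h.halfProd_sq]
      exact (h.ascProd_descProd_commute (by omega)).mul_left (ih h.tail (by omega))
    | zero =>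
      cases m with
      | zero =>
        simp only [halfProd, ascProd, one_mul, mul_one]
        exact (Commute.refl _).pow_left 2
      | succ m =>
        -- The generator `g_0` is absent from the shifted sequence used in the other case. The
        -- mirrored factorization, in which the last strand makes the turn and the initial
        -- generators remain, handles it.
        have hc : ∀ i < m + 1, Commute (descProd g (m + 2) * ascProd g (m + 2)) (g i) := fun i hi =>
          (h.descProd_semiconj (by omega)).mul_left (h.ascProd_semiconj (by omega))
        have hc' : Commute (descProd g (m + 2) * ascProd g (m + 2)) (halfProd g (m + 1)) :=
          semiconj_halfProd hc
        have e : halfProd g (m + 2) ^ 2 =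
            descProd g (m + 2) * ascProd g (m + 2) * halfProd g (m + 1) ^ 2 := by
          rw [sq]
          nth_rewrite 1 [h.halfProd_succ']
          rw [show halfProd g (m + 2) = ascProd g (m + 2) * halfProd g (m + 1) from rfl,
            mul_assoc, ← mul_assoc (descProd _ _), ← mul_assoc, ← hc'.eq, mul_assoc, sq]
        rw [e]
        exact (hc 0 (by omega)).mul_left (ih (h.mono (by omega)) (by omega))

theorem map_ascProd {H : Type*} [Group H] (f : G →* H) (g : ℕ → G) (m : ℕ) :
    f (ascProd g m) = ascProd (fun i => f (g i)) m := by
  induction m with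
  | zero => simp [ascProd]
  | succ m ih => simp [ascProd, ih]

theorem map_descProd {H : Type*} [Group H] (f : G →* H) (g : ℕ → G) (m : ℕ) :
    f (descProd g m) = descProd (fun i => f (g i)) m := by
  induction m with
  | zero => simp [descProd]
  | succ m ih => simp [descProd, ih]

theorem map_halfProd {H : Type*} [Group H] (f : G →* H) (g : ℕ → G) (m : ℕ) :
    f (halfProd g m) = halfProd (fun i => f (g i)) m := by
  induction m with
  | zero => simp [halfProd]
  | succ m ih => simp [halfProd, ih, map_ascProd]

end

/-! ### The braid group -/

/-- The Artin generators as a sequence, extended by `1`. -/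
def gen (n i : ℕ) : BraidGroup n := if h : i < n - 1 then sigma (⟨i, h⟩ : Fin (n - 1)) else 1

theorem gen_of_lt {n i : ℕ} (h : i < n - 1) : gen n i = sigma (⟨i, h⟩ : Fin (n - 1)) := by
  simp [gen, h]

theorem gen_fin {n : ℕ} (i : Fin (n - 1)) : gen n i = sigma i := by simp [gen]

theorem gen_of_le {n i : ℕ} (h : n - 1 ≤ i) : gen n i = 1 := by simp [gen, h]

theorem gen_far {n i j : ℕ} (h : i + 1 < j) : Commute (gen n i) (gen n j) := by
  by_cases hj : j < n - 1
  · rw [gen_of_lt hj, gen_of_lt (by omega)]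
    have := PresentedGroup.mk_eq_one_iff.2 (Subgroup.subset_normalClosure
      (Or.inl ⟨⟨i, by omega⟩, ⟨j, hj⟩, h, rfl⟩) :
        FreeGroup.of (⟨i, by omega⟩ : Fin (n - 1)) * FreeGroup.of ⟨j, hj⟩ *
          (FreeGroup.of ⟨j, hj⟩ * FreeGroup.of ⟨i, by omega⟩)⁻¹ ∈
            Subgroup.normalClosure (braidRels n))
    rw [map_mul, map_inv, mul_inv_eq_one, map_mul, map_mul] at this
    exact this
  · rw [gen_of_le (not_lt.1 hj)]; exact Commute.one_right _

theorem gen_braid {n i : ℕ} (h : i + 1 < n - 1) :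
    gen n i * gen n (i + 1) * gen n i = gen n (i + 1) * gen n i * gen n (i + 1) := by
  rw [gen_of_lt h, gen_of_lt (show i < n - 1 by omega)]
  have := PresentedGroup.mk_eq_one_iff.2 (Subgroup.subset_normalClosure
      (Or.inr ⟨⟨i, by omega⟩, ⟨i + 1, h⟩, rfl, rfl⟩) :
        FreeGroup.of (⟨i, by omega⟩ : Fin (n - 1)) * FreeGroup.of ⟨i + 1, h⟩ *
          FreeGroup.of ⟨i, by omega⟩ *
          (FreeGroup.of ⟨i + 1, h⟩ * FreeGroup.of ⟨i, by omega⟩ * FreeGroup.of ⟨i + 1, h⟩)⁻¹ ∈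
            Subgroup.normalClosure (braidRels n))
  rw [map_mul, map_inv, mul_inv_eq_one, map_mul, map_mul, map_mul, map_mul] at this
  exact this

theorem gen_isBraidSeq (n : ℕ) : IsBraidSeq (gen n) (n - 1) where
  far _ _ h _ := gen_far h
  braid _ h := gen_braid h

theorem delta_eq_ascProd (n m : ℕ) : delta n (m + 1) = ascProd (gen n) m := by
  rw [delta, Nat.add_sub_cancel]
  change ((List.range m).map (gen n)).prod = _
  induction m with
  | zero => simp [ascProd]
  | succ m ih => rw [List.range_succ, List.map_append, List.prod_append, ih]; simp [ascProd]

theorem halfTwist_eq_halfProd (n : ℕ) : halfTwist (n + 1) = halfProd (gen (n + 1)) n := by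
  have h : ∀ g : ℕ → BraidGroup (n + 1), ∀ m,
      ((List.range m).map fun a => ascProd g (m - a)).prod = halfProd g m := by
    intro g m
    induction m with
    | zero => simp [halfProd]
    | succ m ih =>
      rw [List.range_succ_eq_map, List.map_cons, List.prod_cons, List.map_map, halfProd, ← ih]
      simp [Function.comp_def]
  rw [halfTwist, ← h]
  change ((List.range n).map fun a => delta (n + 1) (n + 1 - a)).prod = _
  congr 1
  refine List.map_congr_left fun a ha => ?_
  rw [List.mem_range] at ha
  rw [← delta_eq_ascProd]
  congr 1
  omega

theorem fullTwist_eq (n : ℕ) : fullTwist (n + 1) = halfProd (gen (n + 1)) n ^ 2 := by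
  rw [fullTwist, halfTwist_eq_halfProd]

theorem eq_top_of_gen_mem {n : ℕ} (H : Subgroup (BraidGroup n)) (h : ∀ i < n - 1, gen n i ∈ H)
    (x : BraidGroup n) : x ∈ H := by
  refine PresentedGroup.generated_by _ H (fun i => ?_) x
  rw [show PresentedGroup.of i = gen n i from (gen_fin i).symm]
  exact h i i.2

theorem mem_center_of_commute_gen {n : ℕ} {z : BraidGroup n}
    (h : ∀ i < n - 1, Commute z (gen n i)) : z ∈ Subgroup.center (BraidGroup n) := by
  rw [Subgroup.mem_center_iff]
  intro x
  have := eq_top_of_gen_mem (Subgroup.centralizer {z}) (fun i hi => by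
    rw [Subgroup.mem_centralizer_singleton_iff]; exact (h i hi).eq.symm) x
  rw [Subgroup.mem_centralizer_singleton_iff] at this
  exact this

theorem fullTwist_mem_center (n : ℕ) : fullTwist (n + 1) ∈ Subgroup.center (BraidGroup (n + 1)) := by
  apply mem_center_of_commute_gen
  intro i hi
  rw [fullTwist_eq]
  exact (gen_isBraidSeq (n + 1)).halfProd_sq_commute hi

/-- A homomorphism from the braid group given by a sequence satisfying the Artin relations. -/
def ofSeq {G : Type*} [Group G] {n : ℕ} (g : ℕ → G) (h : IsBraidSeq g (n - 1)) :
    BraidGroup n →* G :=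
  PresentedGroup.toGroup (rels := braidRels n) (f := fun i : Fin (n - 1) => g i) (by
    rintro x (⟨i, j, hij, rfl⟩ | ⟨i, j, hij, rfl⟩)
    · simp only [map_mul, map_inv, FreeGroup.lift_apply_of, mul_inv_eq_one]
      exact (h.far i j hij j.2).eq
    · simp only [map_mul, map_inv, FreeGroup.lift_apply_of, mul_inv_eq_one, ← hij]
      exact h.braid i (by omega))

theorem ofSeq_gen {G : Type*} [Group G] {n : ℕ} (g : ℕ → G) (h : IsBraidSeq g (n - 1)) {i : ℕ}
    (hi : i < n - 1) : ofSeq g h (gen n i) = g i := by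
  rw [gen_of_lt hi, ofSeq, sigma, PresentedGroup.toGroup.of]

/-- The embedding of braid groups that adds a strand on the left. -/
def shift (n : ℕ) : BraidGroup (n + 1) →* BraidGroup (n + 2) :=
  ofSeq (fun i => gen (n + 2) (i + 1)) (gen_isBraidSeq (n + 2)).tail

theorem shift_gen (n i : ℕ) : shift n (gen (n + 1) i) = gen (n + 2) (i + 1) := by
  by_cases hi : i < n
  · exact ofSeq_gen _ _ hi
  · rw [gen_of_le (by simpa using hi), gen_of_le (by simpa using hi), map_one]

theorem fullTwist_succ (n : ℕ) : fullTwist (n + 2) =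
    ascProd (gen (n + 2)) (n + 1) * descProd (gen (n + 2)) (n + 1) * shift n (fullTwist (n + 1)) := by
  rw [fullTwist_eq, fullTwist_eq, map_pow, map_halfProd]
  simp only [shift_gen]
  exact (gen_isBraidSeq (n + 2)).halfProd_sq

/-- The exponent sum. -/
def expSum (n : ℕ) : BraidGroup n →* Multiplicative ℤ :=
  ofSeq (fun _ => Multiplicative.ofAdd 1) ⟨fun _ _ _ _ => Commute.all _ _, fun _ _ => rfl⟩

theorem expSum_gen {n i : ℕ} (hi : i < n - 1) : expSum n (gen n i) = Multiplicative.ofAdd 1 :=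
  ofSeq_gen _ _ hi

theorem expSum_shift (n : ℕ) (x : BraidGroup (n + 1)) :
    expSum (n + 2) (shift n x) = expSum (n + 1) x := by
  have := eq_top_of_gen_mem (((expSum (n + 2)).comp (shift n)).eqLocus (expSum (n + 1)))
    (fun i hi => by
      change expSum (n + 2) (shift n (gen (n + 1) i)) = _
      rw [shift_gen, expSum_gen hi, expSum_gen (by omega)]) x
  exact this

theorem expSum_fullTwist (n : ℕ) :
    expSum (n + 1) (fullTwist (n + 1)) = Multiplicative.ofAdd ((n + 1 : ℤ) * n) := by
  induction n with
  | zero => simp [fullTwist_eq, halfProd]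
  | succ n ih =>
    have h1 : ∀ m ≤ n + 1, expSum (n + 2) (ascProd (gen (n + 2)) m) = Multiplicative.ofAdd (m : ℤ) := by
      intro m hm
      induction m with
      | zero => simp [ascProd]
      | succ m ihm =>
        rw [ascProd, map_mul, ihm (by omega), expSum_gen (by omega), ← ofAdd_add]; simp
    have h2 : ∀ m ≤ n + 1, expSum (n + 2) (descProd (gen (n + 2)) m) = Multiplicative.ofAdd (m : ℤ) := by
      intro m hm
      induction m with
      | zero => simp [descProd]
      | succ m ihm =>
        rw [descProd, map_mul, ihm (by omega), expSum_gen (by omega), ← ofAdd_add, add_comm]; simp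
    rw [fullTwist_succ, map_mul, map_mul, expSum_shift, ih, h1 _ le_rfl, h2 _ le_rfl, ← ofAdd_add,
      ← ofAdd_add]
    congr 1
    push_cast
    ring

/-! ### The Artin action on the free group -/

/-- If the reduced word of `w` is nonempty, one of `a`, `b` differs from its first letter. Call it
`c` and give it the sign of the last letter of `w`. Then `c^{±1} w` and `w c^{±1}` are both reduced
as written but begin with different letters. -/
theorem freeGroup_eq_one_of_commute {α : Type*} [DecidableEq α] {a b : α} (hab : a ≠ b)
    {w : FreeGroup α} (ha : Commute w (FreeGroup.of a)) (hb : Commute w (FreeGroup.of b)) :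
    w = 1 := by
  by_contra hw
  have hne : w.toWord ≠ [] := fun h => hw (FreeGroup.toWord_eq_nil_iff.1 h)
  obtain ⟨x, L, hL⟩ := List.exists_cons_of_ne_nil hne
  have hred : FreeGroup.IsReduced w.toWord := FreeGroup.isReduced_toWord
  obtain ⟨c, hcx, hc⟩ : ∃ c : α, c ≠ x.1 ∧ Commute w (FreeGroup.of c) := by
    by_cases h : a = x.1
    · exact ⟨b, by rw [← h]; exact hab.symm, hb⟩
    · exact ⟨a, h, ha⟩
  set y := w.toWord.getLast hne with hy
  have hc' : Commute w (FreeGroup.mk [(c, y.2)]) := by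
    cases hy2 : y.2 with
    | true => exact hc
    | false => exact hc.inv_right
  have h1 : FreeGroup.IsReduced ((c, y.2) :: w.toWord) := by
    rw [FreeGroup.IsReduced, List.isChain_cons]
    refine ⟨?_, hred⟩
    rw [hL]
    rintro z hz h
    simp only [List.head?_cons, Option.mem_def, Option.some.injEq] at hz
    subst hz
    exact absurd h hcx
  have h2 : FreeGroup.IsReduced (w.toWord ++ [(c, y.2)]) := by
    rw [FreeGroup.IsReduced, List.isChain_append]
    refine ⟨hred, List.isChain_singleton _, ?_⟩
    rintro z hz z' hz' -
    rw [List.getLast?_eq_getLast_of_ne_nil hne, Option.mem_def, Option.some.injEq] at hz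
    simp only [List.head?_cons, Option.mem_def, Option.some.injEq] at hz'
    rw [← hz', ← hz]
  have h3 := congrArg FreeGroup.toWord hc'.eq
  rw [FreeGroup.toWord_mul, FreeGroup.toWord_mul, FreeGroup.toWord_mk,
    FreeGroup.IsReduced.singleton.reduce_eq, h2.reduce_eq, List.singleton_append,
    h1.reduce_eq, hL, List.cons_append, List.cons.injEq] at h3
  exact hcx (by rw [h3.1])

/-- The Artin endomorphism of the free group attached to the `k`-th generator. -/
def artinHom (k : ℕ) : FreeGroup ℕ →* FreeGroup ℕ :=
  FreeGroup.lift fun j => if j = k then FreeGroup.of (k + 1)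
    else if j = k + 1 then (FreeGroup.of (k + 1))⁻¹ * FreeGroup.of k * FreeGroup.of (k + 1)
    else FreeGroup.of j

/-- The inverse of the Artin endomorphism. -/
def artinInv (k : ℕ) : FreeGroup ℕ →* FreeGroup ℕ :=
  FreeGroup.lift fun j => if j = k then FreeGroup.of k * FreeGroup.of (k + 1) * (FreeGroup.of k)⁻¹
    else if j = k + 1 then FreeGroup.of k
    else FreeGroup.of j

theorem artinHom_of_self (k : ℕ) : artinHom k (FreeGroup.of k) = FreeGroup.of (k + 1) := by
  simp [artinHom]

theorem artinHom_of_succ (k : ℕ) : artinHom k (FreeGroup.of (k + 1)) =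
    (FreeGroup.of (k + 1))⁻¹ * FreeGroup.of k * FreeGroup.of (k + 1) := by
  simp [artinHom]

theorem artinHom_of_ne {k j : ℕ} (h : j ≠ k) (h' : j ≠ k + 1) :
    artinHom k (FreeGroup.of j) = FreeGroup.of j := by
  simp [artinHom, h, h']

theorem artinInv_of_self (k : ℕ) : artinInv k (FreeGroup.of k) =
    FreeGroup.of k * FreeGroup.of (k + 1) * (FreeGroup.of k)⁻¹ := by
  simp [artinInv]

theorem artinInv_of_succ (k : ℕ) : artinInv k (FreeGroup.of (k + 1)) = FreeGroup.of k := by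
  simp [artinInv]

theorem artinInv_of_ne {k j : ℕ} (h : j ≠ k) (h' : j ≠ k + 1) :
    artinInv k (FreeGroup.of j) = FreeGroup.of j := by
  simp [artinInv, h, h']

/-- The Artin automorphism of the free group attached to the `k`-th generator. -/
def artinAut (k : ℕ) : MulAut (FreeGroup ℕ) :=
  MonoidHom.toMulEquiv (artinHom k) (artinInv k)
    (by
      ext j
      simp only [MonoidHom.comp_apply, MonoidHom.id_apply]
      rcases eq_or_ne j k with rfl | h
      · rw [artinHom_of_self, artinInv_of_succ]
      rcases eq_or_ne j (k + 1) with rfl | h'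
      · rw [artinHom_of_succ]
        simp only [map_mul, map_inv, artinInv_of_succ, artinInv_of_self]
        group
      · rw [artinHom_of_ne h h', artinInv_of_ne h h'])
    (by
      ext j
      simp only [MonoidHom.comp_apply, MonoidHom.id_apply]
      rcases eq_or_ne j k with rfl | h
      · rw [artinInv_of_self]
        simp only [map_mul, map_inv, artinHom_of_succ, artinHom_of_self]
        group
      rcases eq_or_ne j (k + 1) with rfl | h'
      · rw [artinInv_of_succ, artinHom_of_self]
      · rw [artinInv_of_ne h h', artinHom_of_ne h h'])

theorem artinAut_apply (k : ℕ) (x : FreeGroup ℕ) : artinAut k x = artinHom k x := rfl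

theorem mulAut_ext {x y : MulAut (FreeGroup ℕ)}
    (h : ∀ j, x (FreeGroup.of j) = y (FreeGroup.of j)) : x = y := by
  have : x.toMonoidHom = y.toMonoidHom := by
    ext j
    exact h j
  ext j
  exact DFunLike.congr_fun this j

theorem artinAut_isBraidSeq (N : ℕ) : IsBraidSeq artinAut N where
  far i k hik _ := by
    apply mulAut_ext
    intro j
    simp only [MulAut.mul_apply, artinAut_apply]
    rcases eq_or_ne j i with rfl | h1
    · rw [artinHom_of_ne (k := k) (by omega) (by omega), artinHom_of_self,
        artinHom_of_ne (by omega) (by omega)]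
    rcases eq_or_ne j (i + 1) with rfl | h2
    · rw [artinHom_of_ne (k := k) (by omega) (by omega), artinHom_of_succ]
      simp only [map_mul, map_inv]
      rw [artinHom_of_ne (k := k) (by omega) (by omega),
        artinHom_of_ne (k := k) (by omega) (by omega)]
    rcases eq_or_ne j k with rfl | h3
    · rw [artinHom_of_ne (k := i) h1 h2, artinHom_of_self, artinHom_of_ne (by omega) (by omega)]
    rcases eq_or_ne j (k + 1) with rfl | h4
    · rw [artinHom_of_ne (k := i) h1 h2, artinHom_of_succ]
      simp only [map_mul, map_inv]
      rw [artinHom_of_ne (k := i) (by omega) (by omega),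
        artinHom_of_ne (k := i) (by omega) (by omega)]
    · rw [artinHom_of_ne h1 h2, artinHom_of_ne h3 h4, artinHom_of_ne h1 h2]
  braid i _ := by
    have e0 := artinHom_of_self i
    have e1 := artinHom_of_succ i
    have e2 : artinHom i (FreeGroup.of (i + 1 + 1)) = _ := artinHom_of_ne (by omega) (by omega)
    have f0 : artinHom (i + 1) (FreeGroup.of i) = _ := artinHom_of_ne (by omega) (by omega)
    have f1 := artinHom_of_self (i + 1)
    have f2 := artinHom_of_succ (i + 1)
    apply mulAut_ext
    intro j
    simp only [MulAut.mul_apply, artinAut_apply]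
    rcases eq_or_ne j i with rfl | h1
    · simp only [e0, e2, f0, f1]
    rcases eq_or_ne j (i + 1) with rfl | h2
    · simp only [map_mul, map_inv, e0, e1, e2, f0, f1, f2]
    rcases eq_or_ne j (i + 1 + 1) with rfl | h3
    · simp only [map_mul, map_inv, e1, e2, f0, f1, f2]
      group
    · rw [artinHom_of_ne h1 h2, artinHom_of_ne h2 h3, artinHom_of_ne h1 h2, artinHom_of_ne h2 h3]

/-- The Artin action of the braid group on the free group. -/
def artinAction (n : ℕ) : BraidGroup n →* MulAut (FreeGroup ℕ) :=
  ofSeq artinAut (artinAut_isBraidSeq _)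

/-! ### Combing -/

/-- The semidirect product of a free group with the braid group. -/
abbrev CombGroup (n : ℕ) : Type := FreeGroup ℕ ⋊[artinAction (n + 1)] BraidGroup (n + 1)

/-- The free generators. -/
def combX (n j : ℕ) : CombGroup n := SemidirectProduct.inl (FreeGroup.of j)

/-- The Artin generators. -/
def combT (n k : ℕ) : CombGroup n := SemidirectProduct.inr (gen (n + 1) k)

theorem combT_mul_inl {n k : ℕ} (hk : k < n) (x : FreeGroup ℕ) :
    combT n k * SemidirectProduct.inl x = SemidirectProduct.inl (artinHom k x) * combT n k := by
  have h := SemidirectProduct.inl_aut (φ := artinAction (n + 1)) (gen (n + 1) k) x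
  have e : artinAction (n + 1) (gen (n + 1) k) = artinAut k := ofSeq_gen _ _ (by simpa using hk)
  rw [e, artinAut_apply] at h
  rw [h, combT]
  simp

theorem combT_mul_combX {n k j : ℕ} (h : j ≠ k) (h' : j ≠ k + 1) :
    combT n k * combX n j = combX n j * combT n k := by
  by_cases hk : k < n
  · rw [combX, combT_mul_inl hk, artinHom_of_ne h h']
  · rw [combT, gen_of_le (by simpa using hk)]; simp

theorem combT_mul_combX_self {n k : ℕ} (hk : k < n) :
    combT n k * combX n k = combX n (k + 1) * combT n k := by
  rw [combX, combT_mul_inl hk, artinHom_of_self, combX]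

/-- The Artin automorphism fixes the product `x_k x_{k+1}`. This is the condition imposed by the
braid relation on the coset `k + 2` in the combing action. -/
theorem combT_mul_combX_combX {n k : ℕ} (hk : k < n) :
    combT n k * combX n k * combX n (k + 1) = combX n k * combX n (k + 1) * combT n k := by
  rw [combX, combX, mul_assoc, ← map_mul, combT_mul_inl hk, map_mul, artinHom_of_self,
    artinHom_of_succ]
  group

theorem combT_far {n i j : ℕ} (h : i + 1 < j) : Commute (combT n i) (combT n j) :=
  (gen_far h).map SemidirectProduct.inr

theorem combT_braid {n i : ℕ} (h : i + 1 < n) :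
    combT n i * combT n (i + 1) * combT n i = combT n (i + 1) * combT n i * combT n (i + 1) := by
  simp only [combT, ← map_mul]
  rw [gen_braid (by omega)]

/-- The action of the `j`-th Artin generator on the cosets of the subgroup that fixes the first
strand, tensored with that subgroup. -/
def combAct (n : ℕ) (j : ℕ) (x : ℕ × CombGroup n) : ℕ × CombGroup n :=
  if n + 1 < x.1 then x
  else if x.1 = j then (j + 1, x.2)
  else if x.1 = j + 1 then (j, combX n j * x.2)
  else if x.1 < j then (x.1, combT n (j - 1) * x.2)
  else (x.1, combT n j * x.2)

/-- The inverse of the action of an Artin generator. -/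
def combActInv (n : ℕ) (j : ℕ) (x : ℕ × CombGroup n) : ℕ × CombGroup n :=
  if n + 1 < x.1 then x
  else if x.1 = j then (j + 1, (combX n j)⁻¹ * x.2)
  else if x.1 = j + 1 then (j, x.2)
  else if x.1 < j then (x.1, (combT n (j - 1))⁻¹ * x.2)
  else (x.1, (combT n j)⁻¹ * x.2)

section

variable {n j p : ℕ} (h : CombGroup n)

theorem combAct_big (hp : n + 1 < p) : combAct n j (p, h) = (p, h) := by
  simp [combAct, hp]

theorem combAct_self (hj : j ≤ n) : combAct n j (j, h) = (j + 1, h) := by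
  simp [combAct, show ¬ n + 1 < j by omega]

theorem combAct_succ (hj : j ≤ n) : combAct n j (j + 1, h) = (j, combX n j * h) := by
  simp [combAct, show ¬ n < j by omega]

theorem combAct_lt (hj : j ≤ n) (hp : p < j) :
    combAct n j (p, h) = (p, combT n (j - 1) * h) := by
  simp [combAct, show ¬ n + 1 < p by omega, show p ≠ j by omega, show p ≠ j + 1 by omega, hp]

theorem combAct_gt (hp : j + 1 < p) (hpn : p ≤ n + 1) :
    combAct n j (p, h) = (p, combT n j * h) := by
  simp [combAct, show ¬ n + 1 < p by omega, show p ≠ j by omega, show p ≠ j + 1 by omega,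
    show ¬ p < j by omega]

end

/-- The action of an Artin generator as a permutation. -/
def combPerm (n : ℕ) (j : ℕ) : Equiv.Perm (ℕ × CombGroup n) :=
  if hj : j ≤ n then
    { toFun := combAct n j
      invFun := combActInv n j
      left_inv := by
        rintro ⟨p, h⟩
        rcases lt_or_ge (n + 1) p with h1 | h1
        · rw [combAct_big _ h1]; simp [combActInv, h1]
        rcases lt_trichotomy p j with h2 | rfl | h2
        · rw [combAct_lt _ hj h2]
          simp [combActInv, show ¬ n + 1 < p by omega, show p ≠ j by omega,
            show p ≠ j + 1 by omega, h2]
        · rw [combAct_self _ hj]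
          simp [combActInv, show ¬ n < p by omega]
        rcases eq_or_ne p (j + 1) with rfl | h3
        · rw [combAct_succ _ hj]
          simp [combActInv, show ¬ n + 1 < j by omega]
        · rw [combAct_gt _ (by omega) h1]
          simp [combActInv, show ¬ n + 1 < p by omega, show p ≠ j by omega, h3,
            show ¬ p < j by omega]
      right_inv := by
        rintro ⟨p, h⟩
        rcases lt_or_ge (n + 1) p with h1 | h1
        · rw [show combActInv n j (p, h) = (p, h) by simp [combActInv, h1], combAct_big _ h1]
        rcases lt_trichotomy p j with h2 | rfl | h2
        · rw [show combActInv n j (p, h) = (p, (combT n (j - 1))⁻¹ * h) by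
            simp [combActInv, show ¬ n + 1 < p by omega, show p ≠ j by omega,
            show p ≠ j + 1 by omega, h2], combAct_lt _ hj h2, mul_inv_cancel_left]
        · rw [show combActInv n p (p, h) = (p + 1, (combX n p)⁻¹ * h) by
            simp [combActInv, show ¬ n + 1 < p by omega], combAct_succ _ hj, mul_inv_cancel_left]
        rcases eq_or_ne p (j + 1) with rfl | h3
        · rw [show combActInv n j (j + 1, h) = (j, h) by
            simp [combActInv, show ¬ n < j by omega], combAct_self _ hj]
        · rw [show combActInv n j (p, h) = (p, (combT n j)⁻¹ * h) by
            simp [combActInv, show ¬ n + 1 < p by omega, show p ≠ j by omega, h3,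
            show ¬ p < j by omega], combAct_gt _ (by omega) h1, mul_inv_cancel_left] }
  else 1

theorem combPerm_apply {n j : ℕ} (hj : j ≤ n) (x : ℕ × CombGroup n) :
    combPerm n j x = combAct n j x := by
  simp [combPerm, hj]

/-- This is Reidemeister–Schreier rewriting for the subgroup fixing the first strand, with coset
representatives `descProd p` for `p ≤ n + 1`. Each defining relation, read from each coset, becomes
a relation of the semidirect product: the braid relation gives `combT_mul_combX_self` on coset `j +
1` and `combT_mul_combX_combX` on coset `j + 2`. Indices above `n + 1` are fixed points without
meaning. -/
theorem combPerm_isBraidSeq (n : ℕ) : IsBraidSeq (combPerm n) (n + 1) where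
  far i j hij hj := by
    apply Equiv.ext
    rintro ⟨p, h⟩
    simp only [Equiv.Perm.mul_apply]
    rw [combPerm_apply (show i ≤ n by omega), combPerm_apply (show j ≤ n by omega),
      combPerm_apply (show i ≤ n by omega), combPerm_apply (show j ≤ n by omega)]
    rcases lt_or_ge (n + 1) p with h1 | h1
    · simp only [combAct_big _ h1]
    rcases lt_trichotomy p i with h2 | rfl | h2
    · simp only [combAct_lt _ (show i ≤ n by omega) h2,
        combAct_lt _ (show j ≤ n by omega) (show p < j by omega), ← mul_assoc,
        (combT_far (n := n) (show i - 1 + 1 < j - 1 by omega)).eq]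
    · simp only [combAct_lt _ (show j ≤ n by omega) (show p < j by omega),
        combAct_lt _ (show j ≤ n by omega) (show p + 1 < j by omega),
        combAct_self _ (show p ≤ n by omega)]
    rcases eq_or_ne p (i + 1) with rfl | h3
    · simp only [combAct_lt _ (show j ≤ n by omega) (show i + 1 < j by omega),
        combAct_lt _ (show j ≤ n by omega) (show i < j by omega),
        combAct_succ _ (show i ≤ n by omega), ← mul_assoc,
        combT_mul_combX (n := n) (show i ≠ j - 1 by omega) (show i ≠ j - 1 + 1 by omega)]
    rcases lt_trichotomy p j with h4 | rfl | h4
    · simp only [combAct_gt _ (show i + 1 < p by omega) h1,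
        combAct_lt _ (show j ≤ n by omega) h4, ← mul_assoc,
        (combT_far (n := n) (show i + 1 < j - 1 by omega)).eq]
    · simp only [combAct_gt _ (show i + 1 < p by omega) h1,
        combAct_gt _ (show i + 1 < p + 1 by omega) (show p + 1 ≤ n + 1 by omega),
        combAct_self _ (show p ≤ n by omega)]
    rcases eq_or_ne p (j + 1) with rfl | h5
    · simp only [combAct_gt _ (show i + 1 < j + 1 by omega) h1,
        combAct_gt _ (show i + 1 < j by omega) (show j ≤ n + 1 by omega),
        combAct_succ _ (show j ≤ n by omega), ← mul_assoc,
        combT_mul_combX (n := n) (show j ≠ i by omega) (show j ≠ i + 1 by omega)]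
    · simp only [combAct_gt _ (show i + 1 < p by omega) h1,
        combAct_gt _ (show j + 1 < p by omega) h1, ← mul_assoc,
        (combT_far (n := n) hij).eq]
  braid j hj := by
    apply Equiv.ext
    rintro ⟨p, h⟩
    have hj0 : j ≤ n := by omega
    have hj1 : j + 1 ≤ n := by omega
    simp only [Equiv.Perm.mul_apply, combPerm_apply hj0, combPerm_apply hj1]
    rcases lt_or_ge (n + 1) p with h1 | h1
    · simp only [combAct_big _ h1]
    rcases lt_trichotomy p j with h2 | rfl | h2
    · obtain ⟨k, rfl⟩ : ∃ k, j = k + 1 := ⟨j - 1, by omega⟩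
      simp only [combAct_lt _ hj0 h2, combAct_lt _ hj1 (show p < k + 1 + 1 by omega), ← mul_assoc,
        Nat.add_sub_cancel, combT_braid (n := n) (show k + 1 < n by omega)]
    · simp only [combAct_self _ hj0, combAct_self _ hj1,
        combAct_gt _ (show p + 1 < p + 1 + 1 by omega) (show p + 1 + 1 ≤ n + 1 by omega),
        combAct_lt _ hj1 (show p < p + 1 by omega), Nat.add_sub_cancel]
    rcases eq_or_ne p (j + 1) with rfl | h3
    · simp only [combAct_self _ hj1, combAct_succ _ hj0, combAct_succ _ hj1, combAct_self _ hj0,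
        combAct_gt _ (show j + 1 < j + 1 + 1 by omega) (show j + 1 + 1 ≤ n + 1 by omega),
        combAct_lt _ hj1 (show j < j + 1 by omega), Nat.add_sub_cancel, ← mul_assoc,
        combT_mul_combX_self (n := n) (show j < n by omega)]
    rcases eq_or_ne p (j + 1 + 1) with rfl | h4
    · simp only [combAct_succ _ hj0, combAct_succ _ hj1,
        combAct_gt _ (show j + 1 < j + 1 + 1 by omega) (show j + 1 + 1 ≤ n + 1 by omega),
        combAct_lt _ hj1 (show j < j + 1 by omega), Nat.add_sub_cancel, ← mul_assoc,
        combT_mul_combX_combX (n := n) (show j < n by omega)]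
    · simp only [combAct_gt _ (show j + 1 < p by omega) h1,
        combAct_gt _ (show j + 1 + 1 < p by omega) h1, ← mul_assoc,
        combT_braid (n := n) (show j + 1 < n by omega)]

/-- The combing action of the braid group. -/
def combAction (n : ℕ) : BraidGroup (n + 2) →* Equiv.Perm (ℕ × CombGroup n) :=
  ofSeq (combPerm n) (combPerm_isBraidSeq n)

theorem combAction_gen {n j : ℕ} (hj : j ≤ n) (x : ℕ × CombGroup n) :
    combAction n (gen (n + 2) j) x = combAct n j x := by
  rw [combAction, ofSeq_gen _ _ (by simp; omega), combPerm_apply hj]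

/-- The pure braid in which the first strand winds around the strand in position `j + 1`. -/
def pureGen (n j : ℕ) : BraidGroup (n + 2) :=
  (descProd (gen (n + 2)) j)⁻¹ * gen (n + 2) j ^ 2 * descProd (gen (n + 2)) j

/-! ### The pure braids of the first strand, conjugated according to the Artin action. -/

theorem descProd_semiconj_gen {n p i : ℕ} (hp : p ≤ n + 1) (hi : i + 1 < p) :
    SemiconjBy (descProd (gen (n + 2)) p) (gen (n + 2) (i + 1)) (gen (n + 2) i) :=
  ((gen_isBraidSeq (n + 2)).mono hp).descProd_semiconj hi

theorem descProd_commute_gen {n p i : ℕ} (hi : p < i) :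
    Commute (descProd (gen (n + 2)) p) (gen (n + 2) i) :=
  (commute_descProd fun _ hk => (gen_far (by omega)).symm).symm

theorem pureGen_commute {n j k : ℕ} (h : j ≠ k) (h' : j ≠ k + 1) :
    Commute (gen (n + 2) (k + 1)) (pureGen n j) := by
  rcases Nat.lt_or_ge n j with hj | hj
  · rw [pureGen, gen_of_le (n := n + 2) (i := j) (by omega)]
    simp
  rcases Nat.lt_or_ge j k with h1 | h1
  · have hd := (descProd_commute_gen (n := n) (show j < k + 1 by omega)).symm
    exact ((hd.inv_right).mul_right
      ((gen_far (n := n + 2) (show j + 1 < k + 1 by omega)).symm.pow_right 2)).mul_right hd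
  · have hd := (descProd_semiconj_gen (n := n) (show j ≤ n + 1 by omega)
      (show k + 1 < j by omega))
    have hc : Commute (gen (n + 2) k) (gen (n + 2) j ^ 2) :=
      (gen_far (show k + 1 < j by omega)).pow_right 2
    have : SemiconjBy (pureGen n j) (gen (n + 2) (k + 1)) (gen (n + 2) (k + 1)) :=
      (hd.inv_symm_left.mul_left hc.symm).mul_left hd
    exact Commute.symm this

theorem gen_mul_pureGen_self {n k : ℕ} (hk : k < n) :
    gen (n + 2) (k + 1) * pureGen n k = pureGen n (k + 1) * gen (n + 2) (k + 1) := by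
  have hd := (descProd_commute_gen (n := n) (show k < k + 1 by omega))
  have hb := gen_braid (n := n + 2) (i := k) (by omega)
  rw [pureGen, pureGen, show descProd (gen (n + 2)) (k + 1) =
    gen (n + 2) k * descProd (gen (n + 2)) k from rfl]
  generalize descProd (gen (n + 2)) k = D at *
  generalize gen (n + 2) k = a at *
  generalize gen (n + 2) (k + 1) = b at *
  have e : b * a ^ 2 = a⁻¹ * b ^ 2 * a * b := by
    rw [eq_comm, mul_assoc, mul_assoc, inv_mul_eq_iff_eq_mul]
    calc b ^ 2 * (a * b) = b * (b * a * b) := by rw [sq]; group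
      _ = b * (a * b * a) := by rw [hb]
      _ = (b * a * b) * a := by group
      _ = (a * b * a) * a := by rw [hb]
      _ = a * (b * a ^ 2) := by rw [sq]; group
  calc b * (D⁻¹ * a ^ 2 * D) = (b * D⁻¹) * a ^ 2 * D := by group
    _ = D⁻¹ * (b * a ^ 2) * D := by rw [← hd.inv_left.eq]; group
    _ = D⁻¹ * a⁻¹ * b ^ 2 * a * (b * D) := by rw [e]; group
    _ = _ := by rw [← hd.eq]; group

theorem gen_mul_pureGen_pureGen {n k : ℕ} (hk : k < n) :
    gen (n + 2) (k + 1) * (pureGen n k * pureGen n (k + 1)) =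
      pureGen n k * pureGen n (k + 1) * gen (n + 2) (k + 1) := by
  have hd := (descProd_commute_gen (n := n) (show k < k + 1 by omega))
  have hb := gen_braid (n := n + 2) (i := k) (by omega)
  rw [pureGen, pureGen, show descProd (gen (n + 2)) (k + 1) =
    gen (n + 2) k * descProd (gen (n + 2)) k from rfl]
  generalize descProd (gen (n + 2)) k = D at *
  generalize gen (n + 2) k = a at *
  generalize gen (n + 2) (k + 1) = b at *
  have e : Commute b (a * b ^ 2 * a) := by
    change b * (a * b ^ 2 * a) = a * b ^ 2 * a * b
    calc b * (a * b ^ 2 * a) = (b * a * b) * (b * a) := by rw [sq]; group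
      _ = a * b * (a * b * a) := by rw [← hb]; group
      _ = _ := by rw [hb, sq]; group
  have e2 : D⁻¹ * a ^ 2 * D * ((a * D)⁻¹ * b ^ 2 * (a * D)) = D⁻¹ * (a * b ^ 2 * a) * D := by
    rw [sq, mul_inv_rev]; group
  rw [e2]
  exact ((hd.symm.inv_right.mul_right e).mul_right hd.symm).eq

/-- The pure braids in which only the first strand moves. -/
def pureHom (n : ℕ) : FreeGroup ℕ →* BraidGroup (n + 2) := FreeGroup.lift (pureGen n)

theorem pureHom_of (n j : ℕ) : pureHom n (FreeGroup.of j) = pureGen n j := by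
  simp [pureHom]

/-- Conjugation by a shifted generator acts on the pure braids of the first strand by the Artin
automorphism. This is the compatibility required for mapping the semidirect product into the braid
group. -/
theorem gen_mul_pureHom {n k : ℕ} (hk : k < n) (x : FreeGroup ℕ) :
    pureHom n (artinHom k x) = gen (n + 2) (k + 1) * pureHom n x * (gen (n + 2) (k + 1))⁻¹ := by
  have : (pureHom n).comp (artinHom k) =
      (MulAut.conj (gen (n + 2) (k + 1))).toMonoidHom.comp (pureHom n) := by
    ext j
    simp only [MonoidHom.comp_apply, MulEquiv.coe_toMonoidHom, MulAut.conj_apply, pureHom_of]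
    rw [eq_mul_inv_iff_mul_eq]
    rcases eq_or_ne j k with rfl | h
    · rw [artinHom_of_self, pureHom_of, gen_mul_pureGen_self hk]
    rcases eq_or_ne j (k + 1) with rfl | h'
    · rw [artinHom_of_succ]
      simp only [map_mul, map_inv, pureHom_of]
      rw [mul_assoc, mul_assoc, inv_mul_eq_iff_eq_mul, ← mul_assoc, ← gen_mul_pureGen_pureGen hk,
        ← mul_assoc, gen_mul_pureGen_self hk, mul_assoc]
    · rw [artinHom_of_ne h h', pureHom_of, (pureGen_commute h h').eq]
  exact DFunLike.congr_fun this x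

theorem pureHom_artinAction {n : ℕ} (g : BraidGroup (n + 1)) (x : FreeGroup ℕ) :
    pureHom n (artinAction (n + 1) g x) = shift n g * pureHom n x * (shift n g)⁻¹ := by
  let S : Subgroup (BraidGroup (n + 1)) :=
    { carrier := {g | ∀ x, pureHom n (artinAction (n + 1) g x) =
        shift n g * pureHom n x * (shift n g)⁻¹}
      one_mem' := by intro x; simp
      mul_mem' := fun {a b} ha hb x => by
        rw [map_mul, MulAut.mul_apply, ha, hb, map_mul]; group
      inv_mem' := fun {a} ha x => by
        have := ha (artinAction (n + 1) a⁻¹ x)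
        rw [← MulAut.mul_apply, ← map_mul, mul_inv_cancel, map_one, MulAut.one_apply] at this
        rw [this, map_inv (shift n)]; group }
  refine eq_top_of_gen_mem S (fun k hk x => ?_) g x
  have e : artinAction (n + 1) (gen (n + 1) k) = artinAut k := ofSeq_gen _ _ (by simpa using hk)
  rw [e, artinAut_apply, shift_gen]
  exact gen_mul_pureHom hk x

/-- The homomorphism from the semidirect product to the braid group with one more strand. -/
def combHom (n : ℕ) : CombGroup n →* BraidGroup (n + 2) :=
  SemidirectProduct.lift (pureHom n) (shift n) (by
    intro g
    ext j
    simp only [MonoidHom.comp_apply, MulEquiv.coe_toMonoidHom, MulAut.conj_apply]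
    exact pureHom_artinAction g _)

theorem combHom_combX (n j : ℕ) : combHom n (combX n j) = pureGen n j := by
  rw [combHom, combX, SemidirectProduct.lift_inl, pureHom_of]

theorem combHom_combT (n k : ℕ) : combHom n (combT n k) = gen (n + 2) (k + 1) := by
  rw [combHom, combT, SemidirectProduct.lift_inr, shift_gen]

/-- The braid encoded by a coset and an element of the semidirect product. -/
def uncomb (n : ℕ) (x : ℕ × CombGroup n) : BraidGroup (n + 2) :=
  descProd (gen (n + 2)) x.1 * combHom n x.2

theorem combAct_fst_le_iff {n j : ℕ} (hj : j ≤ n) (x : ℕ × CombGroup n) :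
    (combAct n j x).1 ≤ n + 1 ↔ x.1 ≤ n + 1 := by
  rw [combAct]
  split_ifs <;> simp <;> omega

/-- Each clause of `combAct` was chosen so that decoding turns it into left multiplication by the
generator. For `p = j + 1` the generator meets itself, and its square conjugated by `descProd j` is
the pure braid `pureGen n j`. -/
theorem uncomb_combAct {n j : ℕ} (hj : j ≤ n) {x : ℕ × CombGroup n} (hx : x.1 ≤ n + 1) :
    uncomb n (combAct n j x) = gen (n + 2) j * uncomb n x := by
  obtain ⟨p, h⟩ := x
  rcases lt_trichotomy p j with h2 | rfl | h2
  · rw [combAct_lt _ hj h2]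
    simp only [uncomb, map_mul, combHom_combT]
    rw [show j - 1 + 1 = j by omega, ← mul_assoc, (descProd_commute_gen h2).eq, mul_assoc]
  · rw [combAct_self _ hj]
    simp only [uncomb, descProd, mul_assoc]
  rcases eq_or_ne p (j + 1) with rfl | h3
  · rw [combAct_succ _ hj]
    simp only [uncomb, map_mul, combHom_combX, pureGen, descProd, sq]
    group
  · rw [combAct_gt _ (by omega) hx]
    simp only [uncomb, map_mul, combHom_combT]
    rw [← mul_assoc, (descProd_semiconj_gen hx (show j + 1 < p by omega)).eq, mul_assoc]

theorem combAction_fst_le_iff {n : ℕ} (b : BraidGroup (n + 2)) (x : ℕ × CombGroup n) :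
    (combAction n b x).1 ≤ n + 1 ↔ x.1 ≤ n + 1 := by
  let S : Subgroup (BraidGroup (n + 2)) :=
    { carrier := {b | ∀ x : ℕ × CombGroup n, (combAction n b x).1 ≤ n + 1 ↔ x.1 ≤ n + 1}
      one_mem' := by intro x; simp
      mul_mem' := fun {a b} ha hb x => by
        rw [map_mul, Equiv.Perm.mul_apply, ha, hb]
      inv_mem' := fun {a} ha x => by
        rw [← ha, ← Equiv.Perm.mul_apply, ← map_mul, mul_inv_cancel, map_one, Equiv.Perm.one_apply] }
  refine eq_top_of_gen_mem S (fun j hj x => ?_) b x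
  have hj' : j ≤ n := by omega
  rw [combAction_gen hj']
  exact combAct_fst_le_iff hj' x

theorem uncomb_combAction {n : ℕ} (b : BraidGroup (n + 2)) {x : ℕ × CombGroup n}
    (hx : x.1 ≤ n + 1) : uncomb n (combAction n b x) = b * uncomb n x := by
  let S : Subgroup (BraidGroup (n + 2)) :=
    { carrier := {b | ∀ x : ℕ × CombGroup n, x.1 ≤ n + 1 →
        uncomb n (combAction n b x) = b * uncomb n x}
      one_mem' := by intro x hx; simp
      mul_mem' := fun {a b} ha hb x hx => by
        rw [map_mul, Equiv.Perm.mul_apply, ha _ ((combAction_fst_le_iff b x).2 hx), hb x hx,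
          mul_assoc]
      inv_mem' := fun {a} ha x hx => by
        have := ha (combAction n a⁻¹ x) ((combAction_fst_le_iff _ x).2 hx)
        rw [← Equiv.Perm.mul_apply, ← map_mul, mul_inv_cancel, map_one, Equiv.Perm.one_apply] at this
        rw [this, inv_mul_cancel_left] }
  refine eq_top_of_gen_mem S (fun j hj x hx => ?_) b x hx
  have hj' : j ≤ n := by omega
  rw [combAction_gen hj']
  exact uncomb_combAct hj' hx

/-- A braid is recovered from the image of the base point, so the combing action is faithful.
Injectivity of `combHom` is never needed. -/
theorem uncomb_combAction_base {n : ℕ} (b : BraidGroup (n + 2)) :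
    uncomb n (combAction n b (0, 1)) = b := by
  rw [uncomb_combAction b (by simp)]
  simp [uncomb, descProd]

theorem combAction_mul_right {n : ℕ} (b : BraidGroup (n + 2)) (p : ℕ) (g h : CombGroup n) :
    combAction n b (p, g * h) = ((combAction n b (p, g)).1, (combAction n b (p, g)).2 * h) := by
  let S : Subgroup (BraidGroup (n + 2)) :=
    { carrier := {b | ∀ x : ℕ × CombGroup n, combAction n b (x.1, x.2 * h) =
        ((combAction n b x).1, (combAction n b x).2 * h)}
      one_mem' := by intro x; simp
      mul_mem' := fun {a b} ha hb x => by
        rw [map_mul, Equiv.Perm.mul_apply, hb, ha, Equiv.Perm.mul_apply]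
      inv_mem' := fun {a} ha x => by
        have := ha (combAction n a⁻¹ x)
        have e : ∀ y, combAction n a (combAction n a⁻¹ y) = y := fun y => by
          rw [← Equiv.Perm.mul_apply, ← map_mul, mul_inv_cancel, map_one, Equiv.Perm.one_apply]
        rw [e] at this
        apply (combAction n a).injective
        rw [e, this] }
  refine eq_top_of_gen_mem S (fun j hj x => ?_) b (p, g)
  have hj' : j ≤ n := by omega
  rw [combAction_gen hj', combAction_gen hj']
  simp only [combAct]
  split_ifs <;> simp [mul_assoc]

/-! ### Central braids -/

/-- The braid `b` acts on the base coset as left multiplication by `h`. -/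
def ActsAs {n : ℕ} (b : BraidGroup (n + 2)) (h : CombGroup n) : Prop :=
  combAction n b (0, 1) = (0, h)

theorem ActsAs.apply {n : ℕ} {b : BraidGroup (n + 2)} {h : CombGroup n} (hb : ActsAs b h)
    (g : CombGroup n) : combAction n b (0, g) = (0, h * g) := by
  have := combAction_mul_right b 0 1 g
  rw [one_mul, show combAction n b (0, 1) = (0, h) from hb] at this
  exact this

theorem ActsAs.mul {n : ℕ} {a b : BraidGroup (n + 2)} {g h : CombGroup n} (ha : ActsAs a g)
    (hb : ActsAs b h) : ActsAs (a * b) (g * h) := by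
  rw [ActsAs, map_mul, Equiv.Perm.mul_apply, hb, ha.apply]

/-- Relations between braids preserving the base coset are transported into the semidirect product,
where the free factor can be inspected. -/
theorem ActsAs.commute {n : ℕ} {a b : BraidGroup (n + 2)} {g h : CombGroup n} (ha : ActsAs a g)
    (hb : ActsAs b h) (hab : Commute a b) : Commute g h := by
  have h1 := ha.mul hb
  rw [hab.eq, ActsAs, hb.mul ha] at h1
  exact (Prod.mk.inj h1).2.symm

theorem combAction_gen_zero {n j : ℕ} (h1 : 1 ≤ j) (hj : j ≤ n) :
    ActsAs (gen (n + 2) j) (combT n (j - 1)) := by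
  rw [ActsAs, combAction_gen hj, combAct_lt _ hj h1, mul_one]

theorem shift_actsAs {n : ℕ} (g : BraidGroup (n + 1)) :
    ActsAs (shift n g) (SemidirectProduct.inr g) := by
  let S : Subgroup (BraidGroup (n + 1)) :=
    { carrier := {g | ActsAs (shift n g) (SemidirectProduct.inr g)}
      one_mem' := by simp [ActsAs]
      mul_mem' := fun {a b} ha hb => by
        have := ActsAs.mul ha hb
        rwa [← map_mul, ← map_mul] at this
      inv_mem' := fun {a} ha => by
        change combAction n (shift n a⁻¹) (0, 1) = _
        apply (combAction n (shift n a)).injective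
        rw [← Equiv.Perm.mul_apply, ← map_mul, ← map_mul, mul_inv_cancel, map_one, map_one,
          Equiv.Perm.one_apply, ActsAs.apply ha, ← map_mul, mul_inv_cancel, map_one] }
  refine eq_top_of_gen_mem S (fun j hj => ?_) g
  change ActsAs (shift n (gen (n + 1) j)) _
  rw [shift_gen]
  exact combAction_gen_zero (by omega) (show j + 1 ≤ n by omega)

theorem combAction_descProd {n p : ℕ} (hp : p ≤ n + 1) (h : CombGroup n) :
    combAction n (descProd (gen (n + 2)) p) (0, h) = (p, h) := by
  induction p with
  | zero => simp [descProd]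
  | succ p ih =>
    rw [descProd, map_mul, Equiv.Perm.mul_apply, ih (by omega), combAction_gen (by omega),
      combAct_self _ (by omega)]

theorem pureGen_actsAs {n j : ℕ} (hj : j ≤ n) : ActsAs (pureGen n j) (combX n j) := by
  rw [ActsAs, pureGen, mul_assoc, map_mul, Equiv.Perm.mul_apply, map_mul, Equiv.Perm.mul_apply,
    combAction_descProd (by omega), sq, map_mul, Equiv.Perm.mul_apply, combAction_gen hj,
    combAction_gen hj, combAct_self _ hj, combAct_succ _ hj, map_inv, Equiv.Perm.inv_eq_iff_eq,
    combAction_descProd (by omega), mul_one]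

/-- The descending product carries the base coset to the last one; each generator of the ascending
product then lowers the coset by one and contributes one free generator. No element of the smaller
braid group appears, so the loop lies in the free factor. -/
theorem ascProd_descProd_actsAs (n : ℕ) :
    ∃ w, ActsAs (ascProd (gen (n + 2)) (n + 1) * descProd (gen (n + 2)) (n + 1))
      (SemidirectProduct.inl w : CombGroup n) := by
  have h : ∀ p ≤ n + 1, ∀ v : FreeGroup ℕ, ∃ w : FreeGroup ℕ,
      combAction n (ascProd (gen (n + 2)) p) (p, SemidirectProduct.inl v) =
        (0, (SemidirectProduct.inl w : CombGroup n)) := by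
    intro p hp
    induction p with
    | zero => intro v; exact ⟨v, by simp [ascProd]⟩
    | succ p ih =>
      intro v
      obtain ⟨w, hw⟩ := ih (by omega) (FreeGroup.of p * v)
      refine ⟨w, ?_⟩
      rw [ascProd, map_mul, Equiv.Perm.mul_apply, combAction_gen (by omega),
        combAct_succ _ (by omega), combX, ← map_mul, hw]
  obtain ⟨w, hw⟩ := h (n + 1) le_rfl 1
  refine ⟨w, ?_⟩
  rw [ActsAs, map_mul, Equiv.Perm.mul_apply, combAction_descProd le_rfl, ← hw, map_one]

theorem fullTwist_actsAs (n : ℕ) : ∃ w, ActsAs (fullTwist (n + 2))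
    (SemidirectProduct.inl w * SemidirectProduct.inr (fullTwist (n + 1)) : CombGroup n) := by
  obtain ⟨w, hw⟩ := ascProd_descProd_actsAs n
  refine ⟨w, ?_⟩
  rw [fullTwist_succ]
  exact hw.mul (shift_actsAs _)

/-- The generators of index at least `1` preserve the base coset, so a central braid must send it to
a coset that all of them preserve. Generator `1` moves coset `1`, and generator `p - 1` moves coset
`p` for `p ≥ 2`. The case `p = 1` is where `n ≥ 1` is needed. -/
theorem center_actsAs {n : ℕ} (hn : 1 ≤ n) {z : BraidGroup (n + 2)}
    (hz : z ∈ Subgroup.center (BraidGroup (n + 2))) : ∃ g, ActsAs z (g : CombGroup n) := by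
  rw [Subgroup.mem_center_iff] at hz
  obtain ⟨⟨p, g⟩, hpg⟩ : ∃ x, combAction n z (0, 1) = x := ⟨_, rfl⟩
  have hp : p ≤ n + 1 := by
    have := (combAction_fst_le_iff z (0, 1)).2 (by simp)
    rwa [hpg] at this
  have key : ∀ j, 1 ≤ j → j ≤ n → (combAct n j (p, g)).1 = p := by
    intro j h1 hj
    have e : combAction n (gen (n + 2) j * z) (0, 1) = combAction n (z * gen (n + 2) j) (0, 1) := by
      rw [hz]
    rw [map_mul, map_mul, Equiv.Perm.mul_apply, Equiv.Perm.mul_apply, hpg, combAction_gen hj,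
      show combAction n (gen (n + 2) j) (0, 1) = _ from combAction_gen_zero h1 hj] at e
    have e2 := combAction_mul_right z 0 1 (combT n (j - 1))
    rw [one_mul, hpg] at e2
    rw [e, e2]
  rcases Nat.eq_zero_or_pos p with rfl | h0
  · exact ⟨g, hpg⟩
  exfalso
  rcases eq_or_ne p 1 with rfl | h1
  · have := key 1 le_rfl hn
    rw [combAct_self _ hn] at this
    omega
  · obtain ⟨k, rfl⟩ : ∃ k, p = k + 1 := ⟨p - 1, by omega⟩
    have := key k (by omega) (by omega)
    rw [combAct_succ _ (by omega)] at this
    simp at this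

/-- Induction on strands. A central braid acts on the base coset as some `g` in the semidirect
product, commuting with the free generators, so `g` is determined by its image in the smaller braid
group. That image is central, and by induction it is controlled by its exponent sum `e`; comparison
with the full twist forces `e = 0`. -/
theorem eq_one_of_mem_center_of_expSum {n : ℕ} {z : BraidGroup n}
    (hz : z ∈ Subgroup.center (BraidGroup n)) (he : expSum n z = 1) : z = 1 := by
  match n with
  | 0 | 1 =>
    exact eq_top_of_gen_mem ⊥ (fun i hi => absurd hi (by omega)) z
  | 2 =>
    have h : z ∈ Subgroup.zpowers (gen 2 0) := by
      refine eq_top_of_gen_mem _ (fun i hi => ?_) z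
      obtain rfl : i = 0 := by omega
      exact Subgroup.mem_zpowers _
    obtain ⟨k, rfl⟩ := Subgroup.mem_zpowers_iff.1 h
    rw [map_zpow, expSum_gen (by omega), ← ofAdd_zsmul] at he
    simp at he
    simp [he]
  | m + 3 =>
    have ih := fun (y : BraidGroup (m + 2)) => eq_one_of_mem_center_of_expSum (z := y)
    obtain ⟨g, hg⟩ := center_actsAs (n := m + 1) (by omega) hz
    obtain ⟨w, hw⟩ := fullTwist_actsAs (m + 1)
    set t : CombGroup (m + 1) :=
      SemidirectProduct.inl w * SemidirectProduct.inr (fullTwist (m + 2)) with ht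
    have hzc := Subgroup.mem_center_iff.1 hz
    have htc := Subgroup.mem_center_iff.1 (fullTwist_mem_center (m + 2))
    have hgz : combHom (m + 1) g = z := by
      have := uncomb_combAction_base z
      rw [show combAction (m + 1) z (0, 1) = _ from hg] at this
      simpa [uncomb, descProd] using this
    have htz : combHom (m + 1) t = fullTwist (m + 3) := by
      have := uncomb_combAction_base (fullTwist (m + 3))
      rw [show combAction (m + 1) (fullTwist (m + 3)) (0, 1) = _ from hw] at this
      simpa [uncomb, descProd] using this
    have hgx : ∀ j ≤ m + 1, Commute g (combX (m + 1) j) := fun j hj =>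
      hg.commute (pureGen_actsAs hj) (hzc _).symm
    have htx : ∀ j ≤ m + 1, Commute t (combX (m + 1) j) := fun j hj =>
      hw.commute (pureGen_actsAs hj) (htc _).symm
    have hfree : ∀ y : CombGroup (m + 1), (∀ j ≤ m + 1, Commute y (combX (m + 1) j)) →
        y.right = 1 → y = 1 := by
      intro y hy hr
      have hy' : y = SemidirectProduct.inl y.left := by
        ext <;> simp [hr]
      have hc : ∀ j ≤ m + 1, Commute y.left (FreeGroup.of j) := by
        intro j hj
        have := hy j hj
        rw [hy', combX] at this
        exact SemidirectProduct.inl_injective (by simpa using this.eq)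
      rw [hy', freeGroup_eq_one_of_commute (by omega : (0 : ℕ) ≠ 1) (hc 0 (by omega))
        (hc 1 (by omega)), map_one]
    have hbc : g.right ∈ Subgroup.center (BraidGroup (m + 2)) := by
      rw [Subgroup.mem_center_iff]
      intro x
      have := hg.commute (shift_actsAs x) (hzc _).symm
      have := congrArg SemidirectProduct.right this.eq
      simpa using this.symm
    obtain ⟨e, hexp⟩ : ∃ e : ℤ, expSum (m + 2) g.right = Multiplicative.ofAdd e := ⟨_, rfl⟩
    -- Both sides are central with exponent sum `(m + 2)(m + 1) e`, so the induction hypothesis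
    -- applies to their quotient.
    have h1 : g.right ^ ((m + 2) * (m + 1)) = fullTwist (m + 2) ^ e := by
      rw [← mul_inv_eq_one]
      apply ih
      · exact mul_mem (pow_mem hbc _) (inv_mem (zpow_mem (fullTwist_mem_center (m + 1)) _))
      · rw [map_mul, map_inv, map_pow, map_zpow, hexp, expSum_fullTwist, ← ofAdd_nsmul,
          ← ofAdd_zsmul, mul_inv_eq_one]
        congr 1
        simp only [smul_eq_mul, nsmul_eq_mul]
        push_cast
        ring
    -- The equality lifts because `t` lies over the smaller full twist and also commutes with the
    -- free generators. Decoded, it says `z^{(m+2)(m+1)} = θ^e` on all strands; exponent sums then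
    -- give `0 = (m + 3)(m + 2) e`.
    have h2 : g ^ ((m + 2) * (m + 1)) = t ^ e := by
      rw [← mul_inv_eq_one]
      apply hfree
      · intro j hj
        exact ((hgx j hj).pow_left _).mul_left ((htx j hj).zpow_left _).inv_left
      · change (SemidirectProduct.rightHom : CombGroup (m + 1) →* BraidGroup (m + 2))
          (g ^ ((m + 2) * (m + 1)) * (t ^ e)⁻¹) = 1
        rw [map_mul, map_inv, map_pow, map_zpow, mul_inv_eq_one]
        simpa [ht] using h1
    have h3 := congrArg (fun y => expSum (m + 3) (combHom (m + 1) y)) h2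
    simp only [map_pow, map_zpow, hgz, htz, he, one_pow] at h3
    rw [expSum_fullTwist, ← ofAdd_zsmul, eq_comm, ofAdd_eq_one, smul_eq_mul] at h3
    have h4 : e = 0 := by
      rcases mul_eq_zero.1 h3 with h | h
      · exact h
      · exfalso
        have : (0 : ℤ) < ((m + 2 : ℕ) + 1 : ℤ) * (m + 2 : ℕ) := by positivity
        omega
    have h5 : g.right = 1 := ih _ hbc (by rw [hexp, h4]; rfl)
    rw [← hgz, hfree g hgx h5, map_one]

/-- The exponent sums agree because the full twist on `n + 1` strands has exponent sum `(n + 1) n`.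
This commensurability suffices for faithfulness, without a generator of the center being known. -/
theorem pow_eq_fullTwist_zpow {n : ℕ} {z : BraidGroup (n + 1)}
    (hz : z ∈ Subgroup.center (BraidGroup (n + 1))) :
    z ^ ((n + 1) * n) = fullTwist (n + 1) ^ (Multiplicative.toAdd (expSum (n + 1) z)) := by
  rw [← mul_inv_eq_one]
  apply eq_one_of_mem_center_of_expSum
  · exact mul_mem (pow_mem hz _) (inv_mem (zpow_mem (fullTwist_mem_center n) _))
  · rw [map_mul, map_inv, map_pow, map_zpow, expSum_fullTwist, ← ofAdd_zsmul, mul_inv_eq_one]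
    apply Multiplicative.toAdd.injective
    simp only [toAdd_pow, toAdd_ofAdd, smul_eq_mul, nsmul_eq_mul]
    push_cast
    ring

/-! ### The action of the full twist -/

/-- The operator by which the first strand makes a full turn around the `n` other strands. -/
def loopOp (r : ℕ) : (n : ℕ) → Module.End ℂ (TPow r (n + 1))
  | 0 => 1
  | n + 1 => braidOp r (n + 2) (0 : Fin (n + 1)) *
      (tmap 1 (loopOp r n) : Module.End ℂ (TPow r (n + 2))) *
      braidOp r (n + 2) (0 : Fin (n + 1))

/-- The full twist operator on the tensor power. -/
def twistOp (r : ℕ) : (n : ℕ) → Module.End ℂ (TPow r n)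
  | 0 => 1
  | n + 1 => loopOp r n * (tmap 1 (twistOp r n) : Module.End ℂ (TPow r (n + 1)))

theorem braidRep_gen {r : ℕ} (hr : 2 ≤ r) {n i : ℕ} (hi : i < n) :
    braidRep hr n (gen (n + 1) i) = braidOp r (n + 1) (⟨i, hi⟩ : Fin n) := by
  rw [gen_of_lt (show i < n + 1 - 1 by simpa using hi)]
  exact braidRep_sigma hr n ⟨i, hi⟩

theorem braidRep_shift {r : ℕ} (hr : 2 ≤ r) {n : ℕ} (g : BraidGroup (n + 1)) :
    braidRep hr (n + 1) (shift n g) =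
      (tmap 1 (braidRep hr n g) : Module.End ℂ (TPow r (n + 2))) := by
  let S : Subgroup (BraidGroup (n + 1)) :=
    { carrier := {g | braidRep hr (n + 1) (shift n g) =
        (tmap 1 (braidRep hr n g) : Module.End ℂ (TPow r (n + 2)))}
      one_mem' := by simp [tmap_one_one]
      mul_mem' := fun {a b} ha hb => by
        rw [Set.mem_ofPred_eq] at ha hb ⊢
        rw [map_mul, map_mul, ha, hb, tmap_mul, map_mul, one_mul]
      inv_mem' := fun {a} ha => by
        rw [Set.mem_ofPred_eq] at ha ⊢
        have h1 : (tmap 1 (braidRep hr n a⁻¹) : Module.End ℂ (TPow r (n + 2))) *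
            braidRep hr (n + 1) (shift n a) = 1 := by
          rw [ha, tmap_mul, ← map_mul, inv_mul_cancel, map_one, one_mul, tmap_one_one]
        have h2 : braidRep hr (n + 1) (shift n a) * braidRep hr (n + 1) (shift n a⁻¹) = 1 := by
          rw [← map_mul, ← map_mul, mul_inv_cancel, map_one, map_one]
        exact (left_inv_eq_right_inv h1 h2).symm }
  refine eq_top_of_gen_mem S (fun j hj => ?_) g
  change braidRep hr (n + 1) (shift n (gen (n + 1) j)) = _
  have hj' : j < n := by simpa using hj
  rw [shift_gen, braidRep_gen hr (show j + 1 < n + 1 by omega), braidRep_gen hr hj']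
  exact braidOp_succ ⟨j, hj'⟩

theorem braidRep_loop {r : ℕ} (hr : 2 ≤ r) (n : ℕ) :
    braidRep hr n (ascProd (gen (n + 1)) n * descProd (gen (n + 1)) n) = loopOp r n := by
  induction n with
  | zero => simp [ascProd, descProd, loopOp]
  | succ n ih =>
    have h1 : ascProd (fun i => gen (n + 2) (i + 1)) n = shift n (ascProd (gen (n + 1)) n) := by
      simp only [map_ascProd, shift_gen]
    have h2 : descProd (fun i => gen (n + 2) (i + 1)) n = shift n (descProd (gen (n + 1)) n) := by
      simp only [map_descProd, shift_gen]
    rw [ascProd_succ', descProd_succ', h1, h2, loopOp, ← ih, ← braidRep_shift,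
      ← Fin.mk_zero, ← braidRep_gen hr, ← map_mul, ← map_mul, map_mul (shift n)]
    congr 1
    simp only [mul_assoc]

theorem braidRep_fullTwist {r : ℕ} (hr : 2 ≤ r) (n : ℕ) :
    braidRep hr n (fullTwist (n + 1)) = twistOp r (n + 1) := by
  induction n with
  | zero => simp [fullTwist_eq, halfProd, twistOp, loopOp, tmap_one_one]
  | succ n ih => rw [fullTwist_succ, map_mul, braidRep_loop, braidRep_shift, ih]; rfl

theorem twistOp_commute_tensorE {r : ℕ} (hr : 2 ≤ r) (n : ℕ) :
    Commute (twistOp r n) (tensorE r n) := by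
  cases n with
  | zero => exact Commute.one_left _
  | succ n =>
    rw [← braidRep_fullTwist hr]
    exact braidRep_commute hr (braidOp_commute_tensorE hr) _

theorem twistOp_commute_tensorF {r : ℕ} (hr : 2 ≤ r) (n : ℕ) :
    Commute (twistOp r n) (tensorF r n) := by
  cases n with
  | zero => exact Commute.one_left _
  | succ n =>
    rw [← braidRep_fullTwist hr]
    exact braidRep_commute hr (braidOp_commute_tensorF hr) _

theorem twistOp_mem_level {r : ℕ} (hr : 2 ≤ r) {n : ℕ} {t : ℤ} {x : TPow r n}
    (hx : x ∈ level r n t) : twistOp r n x ∈ level r n t := by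
  cases n with
  | zero => exact hx
  | succ n =>
    rw [mem_level] at hx ⊢
    rw [← braidRep_fullTwist hr, ← Module.End.mul_apply,
      ← (braidRep_commute hr (braidOp_commute_tensorH hr) _).eq, Module.End.mul_apply, hx, map_smul]

/-! #### The loop around `u_0` -/

/-- The coefficients of `loopOp`. -/
def loopCoeff (r n : ℕ) (t : ℤ) (a : ℕ) : ℂ :=
  (-1) ^ ((n + 1) * a) * q r ^ (2 * t + ((n : ℤ) - 1 + 2 * (t - a)) * a) * rcoeff r a

theorem loopCoeff_mul_scoeff {r a b : ℕ} (hab : a + b < r) (n j : ℕ) (t : ℤ) :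
    (-1) ^ j * q r ^ (j : ℤ) * (loopCoeff r n (t - j) a * scoeff r j a b) =
      loopCoeff r (n + 1) t (a + b) * (qnumFactorial r (a + b) *
        (q r ^ ((a : ℤ) * b) / (qnumFactorial r a * qnumFactorial r b)) *
        wt r n (t - j) ^ b) := by
  have h := q_ne_zero r
  have hc := rcoeff_mul hab
  have e1 : ((-1 : ℂ)) ^ j * (-1) ^ ((n + 1) * a) * (-1) ^ (j + a) =
      (-1) ^ ((n + 1 + 1) * (a + b)) * (-1) ^ (n * b) := by
    rw [← pow_add, ← pow_add, ← pow_add]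
    apply neg_one_pow_congr
    simp only [Nat.even_add, Nat.even_mul, Nat.not_even_one]
    tauto
  have e2 : q r ^ (j : ℤ) * q r ^ (2 * (t - j) + ((n : ℤ) - 1 + 2 * (t - j - a)) * a) *
      q r ^ ((j : ℤ) + a + 2 * (((j : ℤ) - b) * (a + b))) * q r ^ (-((a : ℤ) * b)) =
      q r ^ (2 * t + (((n + 1 : ℕ) : ℤ) - 1 + 2 * (t - (a + b : ℕ))) * (a + b : ℕ)) *
        q r ^ ((a : ℤ) * b) * q r ^ ((-(n : ℤ) - 2 * (t - j)) * b) := by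
    rw [← zpow_add₀ h, ← zpow_add₀ h, ← zpow_add₀ h, ← zpow_add₀ h, ← zpow_add₀ h]
    congr 1
    push_cast; ring
  simp only [loopCoeff, scoeff, wt, mul_pow, ← pow_mul]
  rw [← zpow_natCast (q r ^ _) b, ← zpow_mul,
    show ((-1 : ℂ)) ^ ((j : ℤ) + a) = (-1) ^ (j + a) by norm_cast]
  calc _ = ((-1 : ℂ) ^ j * (-1) ^ ((n + 1) * a) * (-1) ^ (j + a)) *
        (q r ^ (j : ℤ) * q r ^ (2 * (t - j) + ((n : ℤ) - 1 + 2 * (t - j - a)) * a) *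
        q r ^ ((j : ℤ) + a + 2 * (((j : ℤ) - b) * (a + b)))) * (rcoeff r a * rcoeff r b) := by ring
    _ = (-1) ^ ((n + 1 + 1) * (a + b)) * (-1) ^ (n * b) *
        (q r ^ (j : ℤ) * q r ^ (2 * (t - j) + ((n : ℤ) - 1 + 2 * (t - j - a)) * a) *
        q r ^ ((j : ℤ) + a + 2 * (((j : ℤ) - b) * (a + b))) * q r ^ (-((a : ℤ) * b))) *
        (rcoeff r (a + b) * (qnumFactorial r (a + b) /
          (qnumFactorial r a * qnumFactorial r b))) := by rw [e1, hc]; ring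
    _ = _ := by rw [e2]; ring

theorem tensorK_mul_tensorE {r n : ℕ} :
    tensorK r n * tensorE r n = q r ^ 2 • (tensorE r n * tensorK r n) := by
  induction n with
  | zero => simp [tensorE_zero]
  | succ n ih =>
    rw [tensorE_succ, tensorK_succ, mul_add, add_mul, tmap_mul, tmap_mul, tmap_mul, tmap_mul, ih,
      opk_sq_mul_opE, smul_add, tmap_smul_left, tmap_smul_right, one_mul, mul_one]

theorem tensorE_pow_tcons {r n c : ℕ} (hc : c < r) (j : ℕ) {t : ℤ} {x : TPow r n}
    (hx : x ∈ level r n t) :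
    (tensorE r (n + 1) ^ c) (tcons r n (u r j) x) =
      ∑ p ∈ Finset.HasAntidiagonal.antidiagonal c, (qnumFactorial r c *
        (q r ^ ((p.1 : ℤ) * p.2) / (qnumFactorial r p.1 * qnumFactorial r p.2)) *
          wt r n t ^ p.2) •
        tcons r n ((opE r ^ p.2) (u r j)) ((tensorE r n ^ p.1) x) := by
  have hK : ∀ b : ℕ, (tensorK r n ^ b) x = wt r n t ^ b • x := by
    intro b
    induction b with
    | zero => simp
    | succ b ih => rw [pow_succ', Module.End.mul_apply, ih, map_smul, tensorK_level hx, smul_smul,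
        pow_succ]
  have hq : (tmap (opE r) (tensorK r n) : Module.End ℂ (TPow r (n + 1))) * tmap 1 (tensorE r n) =
      q r ^ 2 • ((tmap 1 (tensorE r n) : Module.End ℂ (TPow r (n + 1))) *
        tmap (opE r) (tensorK r n)) := by
    rw [tmap_mul, tmap_mul, tensorK_mul_tensorE, tmap_smul_right, mul_one, one_mul]
  rw [tensorE_succ, add_pow_of_qcommute hq hc, LinearMap.smul_apply, LinearMap.sum_apply,
    Finset.smul_sum]
  refine Finset.sum_congr rfl fun p _ => ?_
  rw [LinearMap.smul_apply, tmap_pow, tmap_pow, tmap_mul, tmap_tcons, smul_smul, one_pow, one_mul,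
    Module.End.mul_apply, hK, map_smul, map_smul, smul_smul]

/-- On its way out the strand `u_0` only picks up scalars, because `E u_0 = 0`. On the way back it
carries `F^a u_0`, and the successive powers of `E` left on the strands it crosses assemble into
`Δ(E)^c` by the `q`-binomial theorem. -/
theorem loopOp_tcons {r : ℕ} (hr : 0 < r) {n : ℕ} {t : ℤ} {w : TPow r n} (hw : w ∈ level r n t) :
    loopOp r n (tcons r n (u r 0) w) = ∑ a ∈ Finset.range r, loopCoeff r n t a •
      tcons r n ((opF r ^ a) (u r 0)) ((tensorE r n ^ a) w) := by
  induction n generalizing t with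
  | zero =>
    by_cases ht : t = 0
    · subst ht
      rw [Finset.sum_eq_single_of_mem 0 (Finset.mem_range.2 hr)]
      · simp [loopOp, loopCoeff, rcoeff_zero]
      · intro a _ ha
        rw [tensorE_zero, zero_pow ha]
        simp
    · rw [level_zero_eq_bot ht hw]
      simp
  | succ n ih =>
    refine level_induction (p := fun w => loopOp r (n + 1) (tcons r (n + 1) (u r 0) w) =
      ∑ a ∈ Finset.range r, loopCoeff r (n + 1) t a •
      tcons r (n + 1) ((opF r ^ a) (u r 0)) ((tensorE r (n + 1) ^ a) w)) ?_ ?_ ?_ hw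
    · simp
    · intro x y hx hy
      simp only [map_add, hx, hy, smul_add, Finset.sum_add_distrib]
    · intro j x hj hx
      have h0 : braidOp r (n + 2) (0 : Fin (n + 1))
          (tcons r (n + 1) (u r 0) (tcons r n (u r j) x)) =
          ((-1) ^ j * q r ^ (j : ℤ)) • tcons r (n + 1) (u r j) (tcons r n (u r 0) x) := by
        rw [braidOp_zero_tcons hr, Finset.sum_eq_single_of_mem 0 (Finset.mem_range.2 hr)]
        · simp [scoeff, rcoeff_zero]
        · intro a _ ha
          rw [opE_pow_u _ _ hr, if_neg (by omega)]
          simp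
      rw [loopOp, Module.End.mul_apply, Module.End.mul_apply, h0, map_smul, map_smul, tmap_tcons,
        Module.End.one_apply, ih hx]
      simp only [map_sum, map_smul, braidOp_zero_tcons_opF_pow hr, Finset.smul_sum, smul_smul]
      rw [sum_range_range_eq_antidiagonal]
      · refine Finset.sum_congr rfl fun c hc => ?_
        rw [Finset.mem_range] at hc
        rw [tensorE_pow_tcons hc j hx, map_sum, Finset.smul_sum]
        refine Finset.sum_congr rfl fun p hp => ?_
        rw [Finset.HasAntidiagonal.mem_antidiagonal] at hp
        subst hp
        rw [map_smul, smul_smul, ← loopCoeff_mul_scoeff hc]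
        simp [mul_assoc]
      · intro a b hab
        rw [opF_pow_u_eq_zero (by omega)]
        simp

/-! #### The full twist in terms of `F^a E^a` -/

/-- The coefficients of the full twist on level `t`. -/
def twistCoeff (r n : ℕ) (t : ℤ) (a : ℕ) : ℂ :=
  (-1) ^ (n * a) * q r ^ (2 * (t * (n + t - 1)) + (2 - n - 2 * t) * a) * rcoeff r a

theorem twistCoeff_zero (r n : ℕ) (t : ℤ) :
    twistCoeff r n t 0 = q r ^ (2 * (t * (n + t - 1))) := by
  simp [twistCoeff, rcoeff_zero]

theorem twistCoeff_eq (r n : ℕ) (t : ℤ) (a : ℕ) :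
    twistCoeff r n t a = twistCoeff r n t 0 * (wt r n (t - 1) ^ a * rcoeff r a) := by
  have h := q_ne_zero r
  rw [twistCoeff_zero, twistCoeff, wt, mul_pow, ← pow_mul, ← zpow_natCast (q r ^ _) a, ← zpow_mul,
    zpow_add₀ h, show (-(n : ℤ) - 2 * (t - 1)) * a = (2 - n - 2 * t) * a by ring]
  ring

/-- This recursion is exactly what commutation with `F` asks of the coefficients: the second term
records the commutator of `F` with `E^{a+1}`. -/
theorem twistCoeff_add_one {r a : ℕ} (ha : a + 1 < r) (n : ℕ) (t : ℤ) :
    twistCoeff r n (t + 1) a - twistCoeff r n (t + 1) (a + 1) * ccoeff r (wt r n t)⁻¹ a =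
      twistCoeff r n t a := by
  have h := q_ne_zero r
  have hw := wt_ne_zero r n t
  have h1 : qnum r 1 ≠ 0 := qnum_one_ne_zero (by omega)
  have h0 : twistCoeff r n t 0 = twistCoeff r n (t + 1) 0 * wt r n t ^ 2 := by
    have : wt r n t ^ 2 = q r ^ ((-(n : ℤ) - 2 * t) * 2) := by
      rw [wt, mul_pow, ← pow_mul, mul_comm n, pow_mul, ← zpow_natCast (q r ^ _), ← zpow_mul]
      simp
    rw [this, twistCoeff_zero, twistCoeff_zero, ← zpow_add₀ h]
    congr 1
    ring
  have e : rcoeff r (a + 1) * ccoeff r (wt r n t)⁻¹ a =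
      q r ^ (a : ℤ) * rcoeff r a * ((wt r n t)⁻¹ * q r ^ (-(a : ℤ)) - wt r n t * q r ^ (a : ℤ)) := by
    have hs := rcoeff_succ ha
    rw [ccoeff, inv_inv, mul_div_assoc', div_eq_iff (pow_ne_zero 2 h1)]
    linear_combination ((wt r n t)⁻¹ * q r ^ (-(a : ℤ)) - wt r n t * q r ^ (a : ℤ)) * hs
  rw [twistCoeff_eq, twistCoeff_eq r n (t + 1) (a + 1), twistCoeff_eq r n t a, h0, add_sub_cancel_right,
    wt_shift, pow_succ]
  have e2 : q r ^ (a : ℤ) * q r ^ (-(a : ℤ)) = 1 := by rw [← zpow_add₀ h]; simp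
  have e3 : wt r n t * (wt r n t)⁻¹ = 1 := mul_inv_cancel₀ hw
  have e4 : (q r ^ 2) ^ a = q r ^ (a : ℤ) * q r ^ (a : ℤ) := by
    rw [← zpow_add₀ h, ← pow_mul, ← zpow_natCast]; congr 1; push_cast; ring
  rw [mul_pow, e4]
  linear_combination (-twistCoeff r n (t + 1) 0 * wt r n t ^ a * wt r n t) * e -
    twistCoeff r n (t + 1) 0 * wt r n t ^ a * rcoeff r a * (wt r n t * (wt r n t)⁻¹) * e2 -
    twistCoeff r n (t + 1) 0 * wt r n t ^ a * rcoeff r a * e3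

theorem loopCoeff_mul_twistCoeff {r a b : ℕ} (hab : a + b < r) (n : ℕ) (t : ℤ) :
    loopCoeff r n t a * twistCoeff r n (t - a) b =
      twistCoeff r (n + 1) t (a + b) * (qnumFactorial r (a + b) *
        (q r ^ ((a : ℤ) * b) / (qnumFactorial r a * qnumFactorial r b)) *
        (wt r 1 0)⁻¹ ^ b) := by
  have h := q_ne_zero r
  have hc := rcoeff_mul hab
  have e1 : ((-1 : ℂ)) ^ ((n + 1) * a) * (-1) ^ (n * b) =
      (-1) ^ ((n + 1) * (a + b)) * (-1) ^ b := by
    rw [← pow_add, ← pow_add]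
    apply neg_one_pow_congr
    simp only [Nat.even_add, Nat.even_mul, Nat.not_even_one]
    tauto
  have e3 : (wt r 1 0)⁻¹ ^ b = (-1) ^ b * q r ^ (b : ℤ) := by
    have : (wt r 1 0)⁻¹ = -1 * q r := by simp [wt, zpow_neg]
    rw [this, mul_pow, zpow_natCast]
  have e2 : q r ^ (2 * t + ((n : ℤ) - 1 + 2 * (t - a)) * a) *
      q r ^ (2 * ((t - a) * (n + (t - a) - 1)) + (2 - n - 2 * (t - a)) * b) *
      q r ^ (-((a : ℤ) * b)) =
      q r ^ (2 * (t * ((n + 1 : ℕ) + t - 1)) + (2 - (n + 1 : ℕ) - 2 * t) * (a + b : ℕ)) *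
        q r ^ ((a : ℤ) * b) * q r ^ (b : ℤ) := by
    rw [← zpow_add₀ h, ← zpow_add₀ h, ← zpow_add₀ h, ← zpow_add₀ h]
    congr 1
    push_cast; ring
  rw [e3]
  simp only [loopCoeff, twistCoeff]
  calc _ = ((-1 : ℂ) ^ ((n + 1) * a) * (-1) ^ (n * b)) *
        (q r ^ (2 * t + ((n : ℤ) - 1 + 2 * (t - a)) * a) *
        q r ^ (2 * ((t - a) * (n + (t - a) - 1)) + (2 - n - 2 * (t - a)) * b)) *
        (rcoeff r a * rcoeff r b) := by ring
    _ = (-1) ^ ((n + 1) * (a + b)) * (-1) ^ b *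
        (q r ^ (2 * t + ((n : ℤ) - 1 + 2 * (t - a)) * a) *
        q r ^ (2 * ((t - a) * (n + (t - a) - 1)) + (2 - n - 2 * (t - a)) * b) *
        q r ^ (-((a : ℤ) * b))) *
        (rcoeff r (a + b) * (qnumFactorial r (a + b) /
          (qnumFactorial r a * qnumFactorial r b))) := by rw [e1, hc]; ring
    _ = _ := by rw [e2]; ring

/-- The expression of the full twist on level `t` through `E` and `F`. -/
def twistSum (r n : ℕ) (t : ℤ) : Module.End ℂ (TPow r n) :=
  ∑ a ∈ Finset.range r, twistCoeff r n t a • (tensorF r n ^ a * tensorE r n ^ a)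

theorem twistSum_apply (r n : ℕ) (t : ℤ) (x : TPow r n) :
    twistSum r n t x = ∑ a ∈ Finset.range r, twistCoeff r n t a •
      (tensorF r n ^ a) ((tensorE r n ^ a) x) := by
  simp [twistSum, LinearMap.sum_apply]

/-- The terms are regrouped by the power of `F`, and the recursion of the coefficients matches them.
The bound `t + 1 < r` makes `E^{r-1}` vanish on level `t`, which removes the top summand not covered
by the recursion. -/
theorem twistSum_tensorF {r n : ℕ} (hr : 2 ≤ r) {t : ℤ} (ht : t + 1 < r) {x : TPow r n}
    (hx : x ∈ level r n t) :
    twistSum r n (t + 1) (tensorF r n x) = tensorF r n (twistSum r n t x) := by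
  obtain ⟨r', rfl⟩ : ∃ r', r = r' + 1 := ⟨r - 1, by omega⟩
  rw [twistSum_apply, twistSum_apply, map_sum, Finset.sum_range_succ', Finset.sum_range_succ _ r',
    tensorE_pow_eq_zero hx (show t < (r' : ℕ) by push_cast at ht; omega)]
  have h : ∀ a : ℕ, (tensorF (r' + 1) n ^ (a + 1)) ((tensorE (r' + 1) n ^ (a + 1))
      (tensorF (r' + 1) n x)) =
      tensorF (r' + 1) n ((tensorF (r' + 1) n ^ (a + 1)) ((tensorE (r' + 1) n ^ (a + 1)) x)) -
      ccoeff (r' + 1) (wt (r' + 1) n t)⁻¹ a •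
        tensorF (r' + 1) n ((tensorF (r' + 1) n ^ a) ((tensorE (r' + 1) n ^ a) x)) := by
    intro a
    have e := tensorF_tensorE_pow hr hx a
    rw [← sub_eq_iff_eq_add] at e
    rw [← e, map_sub, map_smul, ← Module.End.mul_apply _ (tensorF _ _), ← pow_succ]
    simp only [pow_succ' (tensorF _ _), Module.End.mul_apply]
  simp only [h, smul_sub, map_smul, map_zero, smul_zero, add_zero, Finset.sum_sub_distrib,
    smul_smul, pow_zero, Module.End.one_apply]
  have h2 := Finset.sum_range_succ' (fun a => twistCoeff (r' + 1) n (t + 1) a •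
    tensorF (r' + 1) n ((tensorF (r' + 1) n ^ a) ((tensorE (r' + 1) n ^ a) x))) r'
  rw [Finset.sum_range_succ _ r',
    tensorE_pow_eq_zero hx (show t < (r' : ℕ) by push_cast at ht; omega)] at h2
  simp only [map_zero, smul_zero, add_zero, pow_zero, Module.End.one_apply] at h2
  rw [sub_add_eq_add_sub, ← h2, ← Finset.sum_sub_distrib]
  refine Finset.sum_congr rfl fun a ha => ?_
  rw [Finset.mem_range] at ha
  rw [← twistCoeff_add_one (show a + 1 < r' + 1 by omega) n t]
  exact (sub_smul _ _ _).symm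

theorem opkInv_sq_mul_opF (r : ℕ) : opkInv r ^ 2 * opF r = q r ^ 2 • (opF r * opkInv r ^ 2) := by
  apply steinberg_ext
  intro m hm
  simp only [Module.End.mul_apply, LinearMap.smul_apply, opkInv_sq_u, opF_u, map_smul, smul_smul]
  congr 1
  rw [show ((m + 1 : ℕ) : ℤ) = m + 1 by push_cast; rfl, wt_add_natCast]
  have h := q_ne_zero r
  have hw := wt_ne_zero r 1 m
  rw [show (-2 * 1 : ℤ) = -2 by norm_num, zpow_neg]
  field_simp

theorem tensorF_pow_tcons_zero {r n c : ℕ} (hc : c < r) (y : TPow r n) :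
    (tensorF r (n + 1) ^ c) (tcons r n (u r 0) y) =
      ∑ p ∈ Finset.HasAntidiagonal.antidiagonal c, (qnumFactorial r c *
        (q r ^ ((p.1 : ℤ) * p.2) / (qnumFactorial r p.1 * qnumFactorial r p.2)) *
          (wt r 1 0)⁻¹ ^ p.2) •
        tcons r n ((opF r ^ p.1) (u r 0)) ((tensorF r n ^ p.2) y) := by
  have hk : ∀ b : ℕ, ((opkInv r ^ 2) ^ b) (u r 0) = (wt r 1 0)⁻¹ ^ b • u r 0 := by
    intro b
    induction b with
    | zero => simp
    | succ b ih =>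
      rw [pow_succ', Module.End.mul_apply, ih, map_smul, opkInv_sq_u, smul_smul, pow_succ]
      simp
  have hq : (tmap (opkInv r ^ 2) (tensorF r n) : Module.End ℂ (TPow r (n + 1))) * tmap (opF r) 1 =
      q r ^ 2 • ((tmap (opF r) 1 : Module.End ℂ (TPow r (n + 1))) *
        tmap (opkInv r ^ 2) (tensorF r n)) := by
    rw [tmap_mul, tmap_mul, opkInv_sq_mul_opF, tmap_smul_left, mul_one, one_mul]
  rw [tensorF_succ, add_comm (tmap _ _), show (_ + _) ^ c = _ from add_pow_of_qcommute hq hc,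
    LinearMap.smul_apply, LinearMap.sum_apply, Finset.smul_sum]
  refine Finset.sum_congr rfl fun p _ => ?_
  rw [LinearMap.smul_apply, tmap_pow, tmap_pow, tmap_mul, tmap_tcons, smul_smul, one_pow, one_mul,
    Module.End.mul_apply, hk, map_smul, map_smul, LinearMap.smul_apply, smul_smul]

theorem tensorE_pow_tcons_zero {r n : ℕ} (a : ℕ) (y : TPow r n) :
    (tensorE r (n + 1) ^ a) (tcons r n (u r 0) y) = tcons r n (u r 0) ((tensorE r n ^ a) y) := by
  induction a with
  | zero => simp
  | succ a ih =>
    rw [pow_succ', Module.End.mul_apply, ih, tensorE_tcons, opE_u_zero, map_zero,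
      LinearMap.zero_apply, add_zero, ← Module.End.mul_apply, ← pow_succ']

/-- On `u_0 ⊗ w` the loop formula and the induction hypothesis for `w` combine through the
`q`-binomial expansion of `F^c`, since `E` does not see `u_0`. The vectors `u_m ⊗ w` are reached
from there by applying `F`, with which both operators are compatible. -/
theorem twistOp_eq_twistSum {r : ℕ} (hr : 2 ≤ r) {n : ℕ} {t : ℤ} (ht : t < r) {x : TPow r n}
    (hx : x ∈ level r n t) : twistOp r n x = twistSum r n t x := by
  induction n generalizing t with
  | zero =>
    by_cases h0 : t = 0
    · subst h0
      rw [twistSum_apply, Finset.sum_eq_single_of_mem 0 (Finset.mem_range.2 (by omega))]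
      · simp [twistOp, twistCoeff_zero]
      · intro a _ ha
        rw [tensorE_zero, zero_pow ha]
        simp
    · rw [level_zero_eq_bot h0 hx]
      simp
  | succ n ih =>
    have hu0 : ∀ t : ℤ, t < r → ∀ w ∈ level r n t, twistOp r (n + 1) (tcons r n (u r 0) w) =
        twistSum r (n + 1) t (tcons r n (u r 0) w) := by
      intro t ht w hw
      have hE : ∀ a : ℕ, (tensorE r n ^ a) (twistOp r n w) = ∑ b ∈ Finset.range r,
          twistCoeff r n (t - a) b • (tensorF r n ^ b) ((tensorE r n ^ (a + b)) w) := by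
        intro a
        rw [← Module.End.mul_apply, ← ((twistOp_commute_tensorE hr n).pow_right a).eq,
          Module.End.mul_apply, ih (by omega) (tensorE_pow_mem_level hw a), twistSum_apply]
        simp only [← Module.End.mul_apply, ← pow_add, add_comm a]
      rw [twistOp, Module.End.mul_apply, tmap_tcons, Module.End.one_apply,
        loopOp_tcons (by omega) (twistOp_mem_level hr hw), twistSum_apply]
      simp only [hE, map_sum, map_smul, Finset.smul_sum, smul_smul, tensorE_pow_tcons_zero]
      rw [sum_range_range_eq_antidiagonal]
      · refine Finset.sum_congr rfl fun c hc => ?_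
        rw [Finset.mem_range] at hc
        rw [tensorF_pow_tcons_zero hc, Finset.smul_sum]
        refine Finset.sum_congr rfl fun p hp => ?_
        rw [Finset.HasAntidiagonal.mem_antidiagonal] at hp
        subst hp
        rw [smul_smul, loopCoeff_mul_twistCoeff hc]
      · intro a b hab
        rw [tensorE_pow_eq_zero hw (by push_cast; omega)]
        simp
    have hu : ∀ m : ℕ, m < r → ∀ t : ℤ, t < r → ∀ w ∈ level r n (t - m),
        twistOp r (n + 1) (tcons r n (u r m) w) =
        twistSum r (n + 1) t (tcons r n (u r m) w) := by
      intro m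
      induction m with
      | zero =>
        intro _ t ht w hw
        exact hu0 t ht w (by simpa using hw)
      | succ m ihm =>
        intro hm t ht w hw
        have hz : qint r (m + 1) ^ 2 ≠ 0 := pow_ne_zero _ (div_ne_zero
          (by exact_mod_cast qnum_natCast_ne_zero (m := m + 1) (by omega) hm)
          (qnum_one_ne_zero hr))
        have hl : tcons r n (u r m) w ∈ level r (n + 1) (t - 1) := by
          have := tcons_mem_level m hw
          convert this using 2
          push_cast; ring
        have h1 := ihm (by omega) (t - 1) (by omega) w (by convert hw using 2; push_cast; ring)
        have h2 := ihm (by omega) t ht (tensorF r n w) (by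
          have := tensorF_mem_level hw
          convert this using 2
          push_cast; ring)
        -- `F (u_m ⊗ w)` is a multiple of `u_m ⊗ F w`, already treated at level `t`, plus `[m+1]²
        -- u_{m+1} ⊗ w`. The last coefficient is nonzero since `m + 1 < r`, so it can be cancelled.
        have h3 := congrArg (tensorF r (n + 1)) h1
        rw [← twistSum_tensorF hr (by omega) hl, ← Module.End.mul_apply,
          ← (twistOp_commute_tensorF hr (n + 1)).eq, Module.End.mul_apply, sub_add_cancel,
          tensorF_tcons, opF_u, opkInv_sq_u] at h3
        simp only [map_smul, map_add, LinearMap.smul_apply, h2, add_right_inj] at h3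
        exact (smul_right_injective _ hz) h3
    refine level_induction (p := fun x => twistOp r (n + 1) x = twistSum r (n + 1) t x)
      (by simp) (fun x y hx hy => by rw [map_add, map_add, hx, hy])
      (fun m w hm hw => hu m hm t ht w hw) hx

/-! ### Injectivity of `F` and surjectivity of `E` in low levels -/

theorem qint_succ_ne_zero {r : ℕ} (hr : 2 ≤ r) {m : ℕ} (hm : m + 1 < r) :
    qint r ((m : ℤ) + 1) ≠ 0 :=
  div_ne_zero (by exact_mod_cast qnum_natCast_ne_zero (m := m + 1) (by omega) hm)
    (qnum_one_ne_zero hr)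

theorem coord_succ_tensorF {r n : ℕ} {i : ℕ} (hi : i + 1 < r) (y : TPow r (n + 1)) :
    coord r n ⟨i + 1, hi⟩ (tensorF r (n + 1) y) =
      (wt r 1 ((i : ℤ) + 1))⁻¹ • tensorF r n (coord r n ⟨i + 1, hi⟩ y) +
        qint r ((i : ℤ) + 1) ^ 2 • coord r n ⟨i, by omega⟩ y := by
  have : coord r n ⟨i + 1, hi⟩ ∘ₗ tensorF r (n + 1) =
      (wt r 1 ((i : ℤ) + 1))⁻¹ • tensorF r n ∘ₗ coord r n ⟨i + 1, hi⟩ +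
        qint r ((i : ℤ) + 1) ^ 2 • coord r n ⟨i, by omega⟩ := by
    apply tpow_ext
    intro m hm x
    simp only [LinearMap.comp_apply, LinearMap.add_apply, LinearMap.smul_apply, tensorF_tcons,
      opkInv_sq_u, opF_u, map_add, map_smul, coord_u]
    congr 1
    · split_ifs with h
      · rw [← h]; push_cast; rfl
      · simp
    · by_cases h : i = m
      · subst h; simp
      · simp [h]
  exact LinearMap.congr_fun this y

/-- Coordinates are eliminated from the top. The one along `u_{r-1}` has negative level, and if the
coordinate along `u_{i+1}` is zero then `F y = 0` forces `[i+1]²` times the one along `u_i` to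
vanish. -/
theorem tensorF_injective {r n : ℕ} (hr : 2 ≤ r) {t : ℤ} (ht : t + 1 < r) {y : TPow r (n + 1)}
    (hy : y ∈ level r (n + 1) t) (h : tensorF r (n + 1) y = 0) : y = 0 := by
  have hc : ∀ k i : ℕ, ∀ hi : i < r, i + k + 1 = r → coord r n ⟨i, hi⟩ y = 0 := by
    intro k
    induction k with
    | zero =>
      intro i hi hik
      exact level_neg (by simp only; omega) (coord_mem_level ⟨i, hi⟩ hy)
    | succ k ih =>
      intro i hi hik
      have h1 := coord_succ_tensorF (n := n) (show i + 1 < r by omega) y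
      rw [h, ih (i + 1) (by omega) (by omega)] at h1
      simp only [map_zero, smul_zero, zero_add] at h1
      exact (smul_eq_zero.1 h1.symm).resolve_left
        (pow_ne_zero _ (qint_succ_ne_zero hr (by omega)))
  rw [← sum_tcons_coord y]
  refine Finset.sum_eq_zero fun m _ => ?_
  rw [show coord r n m y = 0 from hc (r - 1 - m) m m.2 (by omega), map_zero]

theorem tensorF_pow_injective {r n : ℕ} (hr : 2 ≤ r) {t : ℤ} {a : ℕ} (ht : t + a < r)
    {y : TPow r (n + 1)} (hy : y ∈ level r (n + 1) t) (h : (tensorF r (n + 1) ^ a) y = 0) :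
    y = 0 := by
  induction a with
  | zero => simpa using h
  | succ a ih =>
    rw [pow_succ', Module.End.mul_apply] at h
    push_cast at ht
    exact ih (by omega) (tensorF_injective hr (by omega) (tensorF_pow_mem_level hy a) h)

/-- Up to an invertible scalar, `u_i ⊗ z` is `E (u_{i+1} ⊗ z)` minus `u_{i+1} ⊗ E z`, and the level
of `E z` is lower, so the process ends. The preimage has no component along `u_0`, a fact kept for
the construction of highest vectors. -/
theorem tensorE_surjective {r n : ℕ} {t : ℤ} (ht : t + 1 < r) {y : TPow r (n + 1)}
    (hy : y ∈ level r (n + 1) t) :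
    ∃ x ∈ level r (n + 1) (t + 1), tensorE r (n + 1) x = y ∧
      ∀ hr : 0 < r, coord r n ⟨0, hr⟩ x = 0 := by
  have hu : ∀ k i : ℕ, i < r → ∀ z ∈ level r n (t - i), t - i < k →
      ∃ x ∈ level r (n + 1) (t + 1), tensorE r (n + 1) x = tcons r n (u r i) z ∧
      ∀ hr : 0 < r, coord r n ⟨0, hr⟩ x = 0 := by
    intro k
    induction k with
    | zero =>
      intro i hi z hz hk
      rw [level_neg (by simpa using hk) hz]
      exact ⟨0, zero_mem _, by simp, by simp⟩
    | succ k ih =>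
      intro i hi z hz hk
      rcases lt_or_ge t i with hti | hti
      · rw [level_neg (by omega) hz]
        exact ⟨0, zero_mem _, by simp, by simp⟩
      have hi1 : i + 1 < r := by omega
      obtain ⟨x, hx, hxE, hx0⟩ := ih (i + 1) hi1 (tensorE r n z) (by
        have := tensorE_mem_level hz
        convert this using 2
        push_cast; ring) (by push_cast at hk ⊢; omega)
      have hw := wt_ne_zero r n (t - i)
      refine ⟨(wt r n (t - i))⁻¹ • (tcons r n (u r (i + 1)) z - x),
        Submodule.smul_mem _ _ (sub_mem ?_ hx), ?_, ?_⟩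
      · have := tcons_mem_level (i + 1) hz
        convert this using 2
        push_cast; ring
      · rw [map_smul, map_sub, hxE, tensorE_tcons, opE_u_succ hi1, tensorK_level hz,
          add_sub_cancel_left, map_smul, smul_smul, inv_mul_cancel₀ hw, one_smul]
      · intro hr
        rw [map_smul, map_sub, hx0, coord_u]
        simp
  refine level_induction (p := fun y => ∃ x ∈ level r (n + 1) (t + 1), tensorE r (n + 1) x = y ∧
      ∀ hr : 0 < r, coord r n ⟨0, hr⟩ x = 0) ⟨0, zero_mem _, by simp, by simp⟩ ?_ ?_ hy
  · rintro x y ⟨x', hx, hxE, hx0⟩ ⟨y', hy, hyE, hy0⟩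
    exact ⟨x' + y', add_mem hx hy, by rw [map_add, hxE, hyE],
      fun hr => by rw [map_add, hx0, hy0, add_zero]⟩
  · intro m z hm hz
    exact hu ((t - m).toNat + 1) m hm z hz (by push_cast; omega)

theorem tensorE_pow_surjective {r n : ℕ} {t : ℤ} {a : ℕ} (ht : t + a < r) {y : TPow r (n + 1)}
    (hy : y ∈ level r (n + 1) t) :
    ∃ x ∈ level r (n + 1) (t + a), (tensorE r (n + 1) ^ a) x = y := by
  induction a generalizing t y with
  | zero => exact ⟨y, by simpa using hy, by simp⟩
  | succ a ih =>
    push_cast at ht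
    obtain ⟨x, hx, hxE, -⟩ := tensorE_surjective (by omega) hy
    obtain ⟨z, hz, hzE⟩ := ih (t := t + 1) (by omega) hx
    refine ⟨z, ?_, by rw [pow_succ', Module.End.mul_apply, hzE, hxE]⟩
    convert hz using 2
    push_cast; ring

/-! ### Nonzero vectors in weight spaces and highest weight spaces. -/

theorem exists_mem_level_zero_ne_zero {r : ℕ} (hr : 0 < r) (n : ℕ) :
    ∃ x ∈ level r n 0, x ≠ 0 := by
  induction n with
  | zero =>
    refine ⟨(PiTensorProduct.isEmptyEquiv (R := ℂ) (s := fun _ => Steinberg r) (Fin 0)).symm 1,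
      ?_, fun h => one_ne_zero ((LinearEquiv.map_eq_zero_iff _).1 h)⟩
    rw [mem_level, tensorH_zero]
    simp
  | succ n ih =>
    obtain ⟨x, hx, h0⟩ := ih
    refine ⟨tcons r n (u r 0) x, by simpa using tcons_mem_level 0 hx, fun h => h0 ?_⟩
    simpa [coord_u] using congrArg (coord r n ⟨0, hr⟩) h

theorem exists_mem_level_ne_zero {r : ℕ} (n : ℕ) {t : ℕ} (ht : t < r) :
    ∃ x ∈ level r (n + 1) t, x ≠ 0 := by
  obtain ⟨x, hx, h0⟩ := exists_mem_level_zero_ne_zero (r := r) (by omega) n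
  refine ⟨tcons r n (u r t) x, by simpa using tcons_mem_level t hx, fun h => h0 ?_⟩
  simpa [coord_u] using congrArg (coord r n ⟨t, ht⟩) h

/-- Subtracting from `u_0 ⊗ z` a preimage of `E (u_0 ⊗ z)` without `u_0`-component leaves a vector
killed by `E` whose `u_0`-component is still `z`. A second tensor factor is needed to carry a
nonzero `z` of level `t`. -/
theorem exists_highest_ne_zero {r : ℕ} (n : ℕ) {t : ℕ} (ht : t < r) :
    ∃ x ∈ level r (n + 2) t, tensorE r (n + 2) x = 0 ∧ x ≠ 0 := by
  obtain ⟨z, hz, h0⟩ := exists_mem_level_ne_zero n ht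
  have hl : tcons r (n + 1) (u r 0) z ∈ level r (n + 2) t := by
    simpa using tcons_mem_level 0 hz
  obtain ⟨x, hx, hxE, hx0⟩ := tensorE_surjective (n := n + 1) (t := t - 1) (by omega)
    (tensorE_mem_level hl)
  rw [sub_add_cancel] at hx
  refine ⟨tcons r (n + 1) (u r 0) z - x, sub_mem hl hx, by rw [map_sub, hxE, sub_self],
    fun h => h0 ?_⟩
  have := congrArg (coord r (n + 1) ⟨0, by omega⟩) h
  rw [map_sub, hx0, coord_u] at this
  simpa using this

/-! ### Polynomials in `F E` -/

theorem aeval_apply_of_apply_eq_zero {M : Type*} [AddCommGroup M] [Module ℂ M]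
    (D : Module.End ℂ M) {x : M} (hx : D x = 0) (P : Polynomial ℂ) :
    Polynomial.aeval D P x = P.eval 0 • x := by
  conv_lhs => rw [← Polynomial.divX_mul_X_add P]
  rw [map_add, map_mul, Polynomial.aeval_X, Polynomial.aeval_C, LinearMap.add_apply,
    Module.End.mul_apply, hx, map_zero, zero_add, Module.algebraMap_end_apply,
    Polynomial.coeff_zero_eq_eval_zero]

/-- `FE · E^j = E^j (FE + e_j)` on level `t`, where `e_j` is this shift. -/
def eShift (r n : ℕ) (t : ℤ) (j : ℕ) : ℂ := ccoeff r (wt r n (t - 1))⁻¹ ((j : ℤ) - 1)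

theorem tensorF_tensorE_tensorE_pow {r n : ℕ} (hr : 2 ≤ r) {t : ℤ} {x : TPow r n}
    (hx : x ∈ level r n t) (j : ℕ) :
    (tensorF r n * tensorE r n) ((tensorE r n ^ j) x) =
      (tensorE r n ^ j) ((tensorF r n * tensorE r n) x + eShift r n t j • x) := by
  cases j with
  | zero => simp [eShift, ccoeff, qnum_zero]
  | succ j =>
    have := tensorF_tensorE_pow hr (tensorE_mem_level hx) j
    rw [← Module.End.mul_apply (tensorE r n ^ (j + 1)), ← pow_succ, pow_succ',
      Module.End.mul_apply] at this
    rw [Module.End.mul_apply, this, map_add, map_smul, Module.End.mul_apply, eShift,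
      ← Module.End.mul_apply (tensorE r n ^ j), ← pow_succ]
    push_cast
    rw [add_sub_cancel_right]

/-- The polynomial by which `F^a E^a` is expressed through `FE` on level `t`. -/
def shiftPoly (r n : ℕ) (t : ℤ) (a : ℕ) : Polynomial ℂ :=
  ∏ j ∈ Finset.range a, (Polynomial.X + Polynomial.C (eShift r n t j))

theorem aeval_mem_level {r n : ℕ} {t : ℤ} {x : TPow r n} (hx : x ∈ level r n t)
    (P : Polynomial ℂ) : Polynomial.aeval (tensorF r n * tensorE r n) P x ∈ level r n t := by
  induction P using Polynomial.induction_on' with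
  | add p q hp hq => rw [map_add, LinearMap.add_apply]; exact add_mem hp hq
  | monomial k c =>
    rw [Polynomial.aeval_monomial, Module.End.mul_apply, Module.algebraMap_end_apply]
    refine Submodule.smul_mem _ _ ?_
    induction k with
    | zero => simpa using hx
    | succ k ih =>
      rw [pow_succ', Module.End.mul_apply, Module.End.mul_apply]
      have := tensorF_mem_level (tensorE_mem_level ih)
      rwa [sub_add_cancel] at this

/-- The innermost `FE` is moved to the right through `E^a`, picking up the shift `e_a`, and the rest
is the induction hypothesis for the vector `(FE + e_a) x` of the same level. -/
theorem tensorF_pow_tensorE_pow {r n : ℕ} (hr : 2 ≤ r) {t : ℤ} {x : TPow r n}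
    (hx : x ∈ level r n t) (a : ℕ) : (tensorF r n ^ a) ((tensorE r n ^ a) x) =
      Polynomial.aeval (tensorF r n * tensorE r n) (shiftPoly r n t a) x := by
  induction a generalizing x with
  | zero => simp [shiftPoly]
  | succ a ih =>
    have h := tensorF_tensorE_tensorE_pow hr hx a
    have hD : Polynomial.aeval (tensorF r n * tensorE r n)
        (Polynomial.X + Polynomial.C (eShift r n t a)) x =
        (tensorF r n * tensorE r n) x + eShift r n t a • x := by simp
    rw [pow_succ, pow_succ', Module.End.mul_apply, Module.End.mul_apply,
      ← Module.End.mul_apply (tensorF r n) (tensorE r n), h, ← hD, ih (aeval_mem_level hx _),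
      shiftPoly, shiftPoly, Finset.prod_range_succ, map_mul, Module.End.mul_apply]

/-! ### The full twist on the dominant space -/

/-- Each term for `d + 1` is the term for `d` plus a difference of consecutive products. The
differences telescope to `1`, because the last product contains the factor `1 - y^0 = 0`. -/
theorem sum_prod_one_sub_pow_div {y : ℂ} {d : ℕ} (h : ∀ a, 0 < a → a ≤ d → 1 - y ^ a ≠ 0) :
    ∑ a ∈ Finset.range d, (∏ i ∈ Finset.range (a + 1), (1 - y ^ (d - i))) / (1 - y ^ (a + 1)) =
      d := by
  induction d with
  | zero => simp
  | succ d ih =>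
    have hterm : ∀ a ∈ Finset.range (d + 1),
        (∏ i ∈ Finset.range (a + 1), (1 - y ^ (d + 1 - i))) / (1 - y ^ (a + 1)) =
        (∏ i ∈ Finset.range (a + 1), (1 - y ^ (d - i))) / (1 - y ^ (a + 1)) +
          (∏ i ∈ Finset.range a, (1 - y ^ (d - i)) -
            ∏ i ∈ Finset.range (a + 1), (1 - y ^ (d - i))) := by
      intro a ha
      rw [Finset.mem_range] at ha
      have h1 := h (a + 1) (by omega) (by omega)
      rw [Finset.prod_range_succ', Finset.prod_range_succ _ a]
      simp only [Nat.add_sub_add_right, Nat.sub_zero]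
      have e : y ^ (d + 1) = y ^ (d - a) * y ^ (a + 1) := by rw [← pow_add]; congr 1; omega
      rw [e]
      field_simp
      ring
    rw [Finset.sum_congr rfl hterm, Finset.sum_add_distrib, Finset.sum_range_succ,
      ih fun a h0 h1 => h a h0 (by omega),
      Finset.sum_range_sub' (fun a => ∏ i ∈ Finset.range a, (1 - y ^ (d - i))),
      Finset.prod_range_succ _ d]
    simp

theorem qnum_natCast_eq (r m : ℕ) : qnum r m = q r ^ m * (1 - (q r ^ (-2 : ℤ)) ^ m) := by
  have h := q_ne_zero r
  rw [qnum, mul_sub, mul_one, ← zpow_natCast (q r ^ (-2 : ℤ)), ← zpow_mul, ← zpow_natCast (q r) m,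
    ← zpow_add₀ h]
  congr 2
  ring

/-! ### The shifts `e_j` and the coefficient of `FE` in the full twist. -/

section

variable {r n d : ℕ} {t : ℤ} {s : ℂ}

/-- The hypothesis `hw` is the form in which the congruence between `ℓ`, `ℓ'` and `n` is used. It
turns the shift into `s [j] [d-j]`, whose second zero `j = d` produces the extension. -/
theorem eShift_eq (hs : s * s = 1) (hw : wt r n (t - 1) = s * q r ^ (1 - (d : ℤ))) (j : ℕ) :
    eShift r n t j = s * qnum r j * qnum r (d - j) / qnum r 1 ^ 2 := by
  have h := q_ne_zero r
  have hs' : s⁻¹ = s := inv_eq_of_mul_eq_one_left hs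
  have e1 : q r ^ (-(1 - (d : ℤ))) * q r ^ (-((j : ℤ) - 1)) = q r ^ ((d : ℤ) - j) := by
    rw [← zpow_add₀ h]; congr 1; ring
  have e2 : q r ^ (1 - (d : ℤ)) * q r ^ ((j : ℤ) - 1) = q r ^ (-((d : ℤ) - j)) := by
    rw [← zpow_add₀ h]; congr 1; ring
  rw [eShift, ccoeff, hw, inv_inv, mul_inv, hs', ← zpow_neg, sub_add_cancel, mul_assoc s, e1,
    mul_assoc s, e2, qnum, qnum, qnum]
  ring

theorem eShift_zero : eShift r n t 0 = 0 := by simp [eShift, ccoeff, qnum_zero]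

theorem eShift_self (hs : s * s = 1) (hw : wt r n (t - 1) = s * q r ^ (1 - (d : ℤ))) :
    eShift r n t d = 0 := by
  rw [eShift_eq hs hw, sub_self, qnum_zero]; simp

theorem eShift_ne_zero (hs : s * s = 1) (hw : wt r n (t - 1) = s * q r ^ (1 - (d : ℤ)))
    (hd : d < r) {j : ℕ} (h0 : 0 < j) (hj : j < r) (hjd : j ≠ d) : eShift r n t j ≠ 0 := by
  rw [eShift_eq hs hw]
  have h1 : qnum r (d - j) ≠ 0 := qnum_ne_zero (by omega) fun h => by
    have := Int.eq_zero_of_abs_lt_dvd h (by rw [abs_lt]; omega)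
    omega
  have hs0 : s ≠ 0 := fun h => by simp [h] at hs
  exact div_ne_zero (mul_ne_zero (mul_ne_zero hs0 (qnum_natCast_ne_zero h0 hj)) h1)
    (pow_ne_zero _ (qnum_one_ne_zero (by omega)))

/-- The term of degree `a + 1` in the coefficient of `FE` in the full twist. -/
def shearTerm (r n : ℕ) (t : ℤ) (a : ℕ) : ℂ :=
  wt r n (t - 1) ^ (a + 1) * rcoeff r (a + 1) * ∏ j ∈ Finset.range a, eShift r n t (j + 1)

/-- The full twist acts by `x ↦ Λ (x + κ FE x)` on the dominant space, and `κ` is this number. -/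
def shear (r n : ℕ) (t : ℤ) : ℂ := ∑ a ∈ Finset.range (r - 1), shearTerm r n t a

/-- Both the ratio of consecutive `rcoeff` and the shift `e_{a+1}` are written with `1 - q^{-2m}`.
One such factor in the shift cancels the previous denominator, so the powers of `q` and the sign
drop out at each step. -/
theorem shearTerm_mul (hs : s * s = 1) (hw : wt r n (t - 1) = s * q r ^ (1 - (d : ℤ)))
    (hd : d < r) {a : ℕ} (ha : a < d) :
    shearTerm r n t a * (1 - (q r ^ (-2 : ℤ)) ^ (a + 1)) =
      s * q r ^ (-(d : ℤ)) * qnum r 1 ^ 2 *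
        ∏ i ∈ Finset.range a, (1 - (q r ^ (-2 : ℤ)) ^ (d - 1 - i)) := by
  have h := q_ne_zero r
  have h1 : qnum r 1 ≠ 0 := qnum_one_ne_zero (by omega)
  induction a with
  | zero =>
    have e := rcoeff_succ (r := r) (a := 0) (by omega)
    have e1 := qnum_natCast_eq r 1
    rw [rcoeff_zero] at e
    simp only [Nat.cast_zero, zero_add, zpow_zero, mul_one] at e
    simp only [Nat.cast_one, pow_one] at e1
    have e2 : q r ^ (1 - (d : ℤ)) = q r ^ (-(d : ℤ)) * q r := by
      rw [← zpow_add_one₀ h]; congr 1; ring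
    simp only [shearTerm, zero_add, pow_one, Finset.range_zero, Finset.prod_empty, mul_one]
    rw [hw, e2, ← e, e1]
    ring
  | succ a ih =>
    have ih := ih (by omega)
    have h2 : qnum r ((a : ℤ) + 1) = q r ^ (a + 1) * (1 - (q r ^ (-2 : ℤ)) ^ (a + 1)) := by
      exact_mod_cast qnum_natCast_eq r (a + 1)
    have h3 : qnum r (((a + 1 : ℕ) : ℤ) + 1) =
        q r ^ (a + 2) * (1 - (q r ^ (-2 : ℤ)) ^ (a + 1 + 1)) := by
      exact_mod_cast qnum_natCast_eq r (a + 2)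
    have h4 : qnum r ((d : ℤ) - (a + 1 : ℕ)) =
        q r ^ (d - 1 - a) * (1 - (q r ^ (-2 : ℤ)) ^ (d - 1 - a)) := by
      rw [← qnum_natCast_eq]; congr 1; omega
    have hc := rcoeff_succ (r := r) (a := a + 1) (by omega)
    rw [h3] at hc
    have he := eShift_eq hs hw (a + 1)
    rw [h4, Nat.cast_add, Nat.cast_one, h2] at he
    have e2 : q r ^ (1 - (d : ℤ)) * (q r ^ ((a + 1 : ℕ) : ℤ) * (q r ^ (a + 1) *
        q r ^ (d - 1 - a))) = q r ^ (a + 2) := by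
      rw [← zpow_natCast (q r) (a + 1), ← zpow_natCast (q r) (a + 2),
        ← zpow_natCast (q r) (d - 1 - a), ← zpow_add₀ h, ← zpow_add₀ h, ← zpow_add₀ h]
      congr 1
      omega
    have hz : q r ^ (a + 2) ≠ 0 := pow_ne_zero _ h
    apply mul_left_cancel₀ hz
    rw [Finset.prod_range_succ, ← mul_assoc (s * _ * _), ← ih]
    simp only [shearTerm]
    rw [Finset.prod_range_succ, he, pow_succ _ (a + 1)]
    have hwe : wt r n (t - 1) * (s * q r ^ ((a + 1 : ℕ) : ℤ) * (q r ^ (a + 1) *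
        q r ^ (d - 1 - a))) = q r ^ (a + 2) := by
      rw [hw]
      linear_combination q r ^ (1 - (d : ℤ)) * (q r ^ ((a + 1 : ℕ) : ℤ) * (q r ^ (a + 1) *
        q r ^ (d - 1 - a))) * hs + e2
    generalize ∏ j ∈ Finset.range a, eShift r n t (j + 1) = P at *
    generalize q r ^ (-2 : ℤ) = y at *
    generalize 1 - y ^ (a + 1) = Y1 at *
    generalize 1 - y ^ (a + 1 + 1) = Y2 at *
    generalize 1 - y ^ (d - 1 - a) = Y3 at *
    have hK : qnum r 1 ^ 2 * (qnum r 1 ^ 2)⁻¹ = 1 := mul_inv_cancel₀ (pow_ne_zero 2 h1)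
    generalize q r ^ ((a + 1 : ℕ) : ℤ) = Z at *
    linear_combination (wt r n (t - 1) ^ (a + 1) * wt r n (t - 1) * P * s * q r ^ (a + 1) * Y1 *
      q r ^ (d - 1 - a) * Y3 * (qnum r 1 ^ 2)⁻¹) * hc +
      (wt r n (t - 1) ^ (a + 1) * wt r n (t - 1) * P * s * q r ^ (a + 1) * Y1 *
      q r ^ (d - 1 - a) * Y3 * Z * rcoeff r (a + 1)) * hK +
      (wt r n (t - 1) ^ (a + 1) * rcoeff r (a + 1) * P * Y1 * Y3) * hwe

/-- With `y = q^{-2}` the sum becomes the one evaluated in `sum_prod_one_sub_pow_div`, so `κ (1 -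
q^{-2d}) = s q^{-d} {1}² d`. The factor `d` is a nonzero integer, which gives the result without any
estimate. -/
theorem shear_ne_zero (hs : s * s = 1) (hw : wt r n (t - 1) = s * q r ^ (1 - (d : ℤ)))
    (h0 : 0 < d) (hd : d < r) : shear r n t ≠ 0 := by
  have hy : ∀ a, 0 < a → a ≤ d → 1 - (q r ^ (-2 : ℤ)) ^ a ≠ 0 := by
    intro a ha had hz
    have := qnum_natCast_ne_zero ha (show a < r by omega)
    rw [qnum_natCast_eq, hz, mul_zero] at this
    exact this rfl
  have hsum : shear r n t = ∑ a ∈ Finset.range d, shearTerm r n t a := by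
    rw [shear]
    symm
    -- The terms with `a ≥ d` contain the factor `e_d = 0`.
    apply Finset.sum_subset (Finset.range_subset_range.2 (by omega))
    intro a _ ha
    rw [Finset.mem_range, not_lt] at ha
    rw [shearTerm, Finset.prod_eq_zero (i := d - 1) (Finset.mem_range.2 (by omega)), mul_zero]
    rw [Nat.sub_add_cancel h0, eShift_self hs hw]
  have hk : shear r n t * (1 - (q r ^ (-2 : ℤ)) ^ d) =
      s * q r ^ (-(d : ℤ)) * qnum r 1 ^ 2 * d := by
    rw [hsum, ← sum_prod_one_sub_pow_div hy, Finset.sum_mul, Finset.mul_sum]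
    refine Finset.sum_congr rfl fun a ha => ?_
    rw [Finset.mem_range] at ha
    have h1 := hy (a + 1) (by omega) (by omega)
    have h2 := shearTerm_mul hs hw hd ha
    rw [Finset.prod_range_succ', Nat.sub_zero, mul_div_assoc', eq_div_iff h1]
    simp only [add_comm _ 1, ← Nat.sub_sub] at h2 ⊢
    linear_combination (1 - (q r ^ (-2 : ℤ)) ^ d) * h2
  intro h
  rw [h, zero_mul, eq_comm] at hk
  have hs0 : s ≠ 0 := fun h => by simp [h] at hs
  exact mul_ne_zero (mul_ne_zero (mul_ne_zero hs0 (zpow_ne_zero _ (q_ne_zero r)))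
    (pow_ne_zero 2 (qnum_one_ne_zero (by omega)))) (by exact_mod_cast h0.ne') hk

/-- Since `e_0 = 0`, every `F^{a+1} E^{a+1}` is `FE` times a polynomial in `FE`; as `(FE)² x = 0`,
only the constant term of that polynomial survives. -/
theorem twistOp_of_sq_eq_zero (hr : 2 ≤ r) (ht : t < r) {x : TPow r n} (hx : x ∈ level r n t)
    (hD : (tensorF r n * tensorE r n) ((tensorF r n * tensorE r n) x) = 0) :
    twistOp r n x =
      twistCoeff r n t 0 • (x + shear r n t • (tensorF r n * tensorE r n) x) := by
  have h := Finset.sum_range_succ' (fun a => twistCoeff r n t a •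
    (tensorF r n ^ a) ((tensorE r n ^ a) x)) (r - 1)
  rw [Nat.sub_add_cancel (by omega)] at h
  rw [twistOp_eq_twistSum hr ht hx, twistSum_apply, h, add_comm, smul_add, shear,
    Finset.sum_smul, Finset.smul_sum]
  congr 1
  refine Finset.sum_congr rfl fun a _ => ?_
  rw [tensorF_pow_tensorE_pow hr hx, shiftPoly, Finset.prod_range_succ', eShift_zero, map_zero,
    add_zero, map_mul, Polynomial.aeval_X, Module.End.mul_apply,
    aeval_apply_of_apply_eq_zero _ hD, Polynomial.eval_prod, twistCoeff_eq, shearTerm]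
  simp only [Polynomial.eval_add, Polynomial.eval_X, Polynomial.eval_C, zero_add, smul_smul]
  congr 1
  ring

theorem twistOp_of_highest (hr : 2 ≤ r) (ht : t < r) {x : TPow r n} (hx : x ∈ level r n t)
    (hE : tensorE r n x = 0) : twistOp r n x = twistCoeff r n t 0 • x := by
  rw [twistOp_of_sq_eq_zero hr ht hx (by simp [hE])]
  simp [hE]

end

/-! ### The map `E^d` on the dominant space -/

section

variable {r n d : ℕ} {t : ℤ} {s : ℂ}

theorem shiftPoly_eq_mul_X (a : ℕ) :
    shiftPoly r n t (a + 1) =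
      (∏ j ∈ Finset.range a, (Polynomial.X + Polynomial.C (eShift r n t (j + 1)))) *
        Polynomial.X := by
  rw [shiftPoly, Finset.prod_range_succ', eShift_zero, map_zero, add_zero]

/-- `F^{d+1} E^{d+1}` contains `FE` twice, from `e_0 = 0` and `e_d = 0`, so it kills `x`.
Injectivity of `F^{d+1}` on the level of `E^{d+1} x` concludes. -/
theorem tensorE_pow_succ_eq_zero (hs : s * s = 1)
    (hw : wt r (n + 1) (t - 1) = s * q r ^ (1 - (d : ℤ))) (h0 : 0 < d) (hd : d < r) (ht : t < r)
    {x : TPow r (n + 1)} (hx : x ∈ level r (n + 1) t)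
    (hD : (tensorF r (n + 1) * tensorE r (n + 1)) ((tensorF r (n + 1) * tensorE r (n + 1)) x) = 0) :
    (tensorE r (n + 1) ^ (d + 1)) x = 0 := by
  have hr : 2 ≤ r := by omega
  refine tensorF_pow_injective (a := d + 1) hr (by push_cast; omega)
    (tensorE_pow_mem_level hx (d + 1)) ?_
  obtain ⟨d, rfl⟩ : ∃ d', d = d' + 1 := ⟨d - 1, by omega⟩
  rw [tensorF_pow_tensorE_pow hr hx, shiftPoly_eq_mul_X, Finset.prod_range_succ,
    eShift_self hs hw, map_zero, add_zero, map_mul, map_mul, Polynomial.aeval_X,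
    Module.End.mul_apply, Module.End.mul_apply, hD, map_zero]

/-- On `x` the operator `F^d E^d` equals `FE` times the product of `e_1, …, e_{d-1}`, none of which
vanishes. Hence `E^d x = 0` gives `FE x = 0`, and `F` is injective on the level of `E x`. -/
theorem tensorE_eq_zero_of_pow (hs : s * s = 1)
    (hw : wt r (n + 1) (t - 1) = s * q r ^ (1 - (d : ℤ))) (h0 : 0 < d) (hd : d < r) (ht : t < r)
    {x : TPow r (n + 1)} (hx : x ∈ level r (n + 1) t)
    (hD : (tensorF r (n + 1) * tensorE r (n + 1)) ((tensorF r (n + 1) * tensorE r (n + 1)) x) = 0)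
    (h : (tensorE r (n + 1) ^ d) x = 0) : tensorE r (n + 1) x = 0 := by
  have hr : 2 ≤ r := by omega
  have h1 := tensorF_pow_tensorE_pow hr hx d
  obtain ⟨d, rfl⟩ : ∃ d', d = d' + 1 := ⟨d - 1, by omega⟩
  rw [h, map_zero, shiftPoly_eq_mul_X, map_mul, Polynomial.aeval_X, Module.End.mul_apply,
    aeval_apply_of_apply_eq_zero _ hD, eq_comm, smul_eq_zero, Polynomial.eval_prod,
    Finset.prod_eq_zero_iff] at h1
  rcases h1 with ⟨j, hj, h1⟩ | h1
  · rw [Finset.mem_range] at hj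
    simp only [Polynomial.eval_add, Polynomial.eval_X, Polynomial.eval_C, zero_add] at h1
    exact absurd h1 (eShift_ne_zero hs hw hd (by omega) (by omega) (by omega))
  · exact tensorF_injective hr (by omega) (tensorE_mem_level hx) h1

/-- `E^d` commutes with `FE` on this level because the shift `e_d` is zero. -/
theorem tensorE_pow_aeval (hs : s * s = 1) (hr : 2 ≤ r)
    (hw : wt r n (t - 1) = s * q r ^ (1 - (d : ℤ))) {x : TPow r n} (hx : x ∈ level r n t)
    (P : Polynomial ℂ) :
    (tensorE r n ^ d) (Polynomial.aeval (tensorF r n * tensorE r n) P x) =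
      Polynomial.aeval (tensorF r n * tensorE r n) P ((tensorE r n ^ d) x) := by
  induction P using Polynomial.induction_on with
  | C a => simp
  | add p q hp hq => simp only [map_add, LinearMap.add_apply, hp, hq]
  | monomial k a ih =>
    have h := tensorF_tensorE_tensorE_pow hr
      (aeval_mem_level hx (Polynomial.C a * Polynomial.X ^ k)) d
    rw [eShift_self hs hw, zero_smul, add_zero, ih] at h
    rw [pow_succ, ← mul_assoc, mul_comm _ Polynomial.X, map_mul, Polynomial.aeval_X,
      Module.End.mul_apply, Module.End.mul_apply (tensorF r n * tensorE r n), h]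

/-- An arbitrary preimage of `w` under `E^d` is corrected by a polynomial in `FE` that moves it into
`ker (FE)²`. The image is only rescaled, since `E^d` commutes with `FE` and `FE w = 0`. -/
theorem exists_tensorE_pow_eq {ℓ : ℕ} (hs : s * s = 1)
    (hw : wt r (n + 1) (ℓ - 1) = s * q r ^ (1 - (d : ℤ))) (h0 : 0 < d) (hd : d ≤ ℓ) (hℓ : ℓ < r)
    {w : TPow r (n + 1)} (hwl : w ∈ level r (n + 1) (ℓ - d)) (hE : tensorE r (n + 1) w = 0) :
    ∃ x ∈ level r (n + 1) ℓ, (tensorF r (n + 1) * tensorE r (n + 1))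
      ((tensorF r (n + 1) * tensorE r (n + 1)) x) = 0 ∧ (tensorE r (n + 1) ^ d) x = w := by
  have hr : 2 ≤ r := by omega
  obtain ⟨x, hx, rfl⟩ := tensorE_pow_surjective (a := d) (by omega) hwl
  rw [sub_add_cancel] at hx
  set D := tensorF r (n + 1) * tensorE r (n + 1) with hDdef
  set f : ℕ → Polynomial ℂ := fun j => Polynomial.X + Polynomial.C (eShift r (n + 1) ℓ j) with hf
  -- `Q` is the cofactor of `X²` in the polynomial expressing `F^{ℓ+1} E^{ℓ+1} = 0` on level `ℓ`.
  -- The two removed indices `0` and `d` are the only ones with vanishing shift, so `Q(0) ≠ 0` can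
  -- be inverted.
  set Q := ∏ j ∈ ((Finset.range (ℓ + 1)).erase 0).erase d, f j with hQ
  have hprod : shiftPoly r (n + 1) ℓ (ℓ + 1) = Polynomial.X * (Polynomial.X * Q) := by
    have e0 : f 0 = Polynomial.X := by simp [hf, eShift_zero]
    have ed : f d = Polynomial.X := by simp [hf, eShift_self hs hw]
    rw [shiftPoly, ← Finset.mul_prod_erase (Finset.range (ℓ + 1)) _ (Finset.mem_range.2
      (Nat.succ_pos ℓ)), ← Finset.mul_prod_erase ((Finset.range (ℓ + 1)).erase 0) _
      (Finset.mem_erase.2 ⟨h0.ne', Finset.mem_range.2 (by omega)⟩)]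
    exact congrArg₂ _ e0 (congrArg₂ _ ed rfl)
  have hne : Q.eval 0 ≠ 0 := by
    rw [hQ, Polynomial.eval_prod, Finset.prod_ne_zero_iff]
    intro j hj
    simp only [Finset.mem_erase, Finset.mem_range] at hj
    simpa [hf] using eShift_ne_zero hs hw (by omega) (by omega) (by omega) hj.1
  refine ⟨(Q.eval 0)⁻¹ • Polynomial.aeval D Q x, Submodule.smul_mem _ _ (aeval_mem_level hx _),
    ?_, ?_⟩
  · have h := tensorF_pow_tensorE_pow hr hx (ℓ + 1)
    rw [tensorE_pow_eq_zero hx (by push_cast; omega), map_zero, hprod, map_mul, map_mul,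
      Polynomial.aeval_X] at h
    rw [map_smul, map_smul]
    exact (congrArg _ h.symm).trans (smul_zero _)
  · rw [map_smul, tensorE_pow_aeval hs hr hw hx, aeval_apply_of_apply_eq_zero _ (by
      rw [Module.End.mul_apply, hE, map_zero]), smul_smul, inv_mul_cancel₀ hne, one_smul]

end

/-- If `1 - n - (ℓ + ℓ') = r M`, then `q^{rM} = (-1)^M`, so the sign is `s = (-1)^n (-1)^M`. -/
theorem exists_wt_eq {r n ℓ ℓ' : ℕ} (hr : 0 < r) (hlt : ℓ' < ℓ)
    (hc : (ℓ : ℤ) + ℓ' ≡ 1 - n [ZMOD r]) :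
    ∃ s : ℂ, s * s = 1 ∧ wt r n (ℓ - 1) = s * q r ^ (1 - ((ℓ - ℓ' : ℕ) : ℤ)) := by
  obtain ⟨M, hM⟩ := hc.dvd
  refine ⟨(-1) ^ n * (-1) ^ M, ?_, ?_⟩
  · rw [mul_mul_mul_comm, ← mul_pow, ← mul_zpow]
    simp
  · rw [wt, mul_assoc, ← q_zpow_r_mul hr, ← hM, ← zpow_add₀ (q_ne_zero r)]
    congr 2
    push_cast [Nat.cast_sub hlt.le]
    ring

theorem mem_highestSpace {r n ℓ : ℕ} {x : TPow r n} :
    x ∈ highestSpace r n ℓ ↔ tensorE r n x = 0 ∧ x ∈ level r n ℓ := by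
  rw [highestSpace, weightSpace_eq_level, Submodule.mem_inf, LinearMap.mem_ker]

theorem mem_dominantSpace {r n ℓ : ℕ} {x : TPow r n} :
    x ∈ dominantSpace r n ℓ ↔ (tensorF r n * tensorE r n) ((tensorF r n * tensorE r n) x) = 0 ∧
      x ∈ level r n ℓ := by
  rw [dominantSpace, weightSpace_eq_level, Submodule.mem_inf, LinearMap.mem_ker, sq,
    Module.End.mul_apply]

theorem braidRep_apply_comm {r : ℕ} (hr : 2 ≤ r) {n : ℕ} {T : Module.End ℂ (TPow r (n + 1))}
    (hT : ∀ i : Fin n, Commute (braidOp r (n + 1) i) T) (g : BraidGroup (n + 1))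
    (x : TPow r (n + 1)) : T (braidRep hr n g x) = braidRep hr n g (T x) :=
  (LinearMap.congr_fun (braidRep_commute hr hT g).eq x).symm

theorem braidRep_mem_level {r : ℕ} (hr : 2 ≤ r) {n : ℕ} (g : BraidGroup (n + 1)) {t : ℤ}
    {x : TPow r (n + 1)} (hx : x ∈ level r (n + 1) t) : braidRep hr n g x ∈ level r (n + 1) t := by
  rw [mem_level] at hx ⊢
  rw [braidRep_apply_comm hr (braidOp_commute_tensorH hr), hx, map_smul]

/-! ### The exact sequence -/

/-- The restriction of an equivariant map to subrepresentations. -/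
def restrictIntertwining {G V : Type*} [Monoid G] [AddCommMonoid V] [Module ℂ V]
    {ρ : Representation ℂ G V} (A B : Subrepresentation ρ) (T : Module.End ℂ V)
    (hT : ∀ x ∈ A.toSubmodule, T x ∈ B.toSubmodule) (hc : ∀ g x, T (ρ g x) = ρ g (T x)) :
    Representation.IntertwiningMap A.toRepresentation B.toRepresentation where
  toLinearMap := T.restrict hT
  isIntertwining' g := by
    ext x
    exact hc g x

theorem restrictIntertwining_coe {G V : Type*} [Monoid G] [AddCommMonoid V] [Module ℂ V]
    {ρ : Representation ℂ G V} {A B : Subrepresentation ρ} {T : Module.End ℂ V}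
    (hT : ∀ x ∈ A.toSubmodule, T x ∈ B.toSubmodule) (hc : ∀ g x, T (ρ g x) = ρ g (T x))
    (x : A.toSubmodule) : (restrictIntertwining A B T hT hc x : V) = T x := rfl

theorem toRepresentation_coe {G V : Type*} [Monoid G] [AddCommMonoid V] [Module ℂ V]
    {ρ : Representation ℂ G V} (A : Subrepresentation ρ) (g : G) (x : A.toSubmodule) :
    (A.toRepresentation g x : V) = ρ g x := rfl

/-- The highest strong weight space as a subrepresentation. -/
def highestRep {r : ℕ} (hr : 2 ≤ r) (n ℓ : ℕ) : Subrepresentation (braidRep hr n) where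
  toSubmodule := highestSpace r (n + 1) ℓ
  apply_mem_toSubmodule g x hx := by
    rw [mem_highestSpace] at hx ⊢
    rw [braidRep_apply_comm hr (braidOp_commute_tensorE hr), hx.1, map_zero]
    exact ⟨rfl, braidRep_mem_level hr g hx.2⟩

theorem braidOp_commute_tensorF_tensorE {r n : ℕ} (hr : 2 ≤ r) (i : Fin n) :
    Commute (braidOp r (n + 1) i) (tensorF r (n + 1) * tensorE r (n + 1)) :=
  (braidOp_commute_tensorF hr i).mul_right (braidOp_commute_tensorE hr i)

/-- The dominant space as a subrepresentation. -/
def dominantRep {r : ℕ} (hr : 2 ≤ r) (n ℓ : ℕ) : Subrepresentation (braidRep hr n) where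
  toSubmodule := dominantSpace r (n + 1) ℓ
  apply_mem_toSubmodule g x hx := by
    rw [mem_dominantSpace] at hx ⊢
    rw [braidRep_apply_comm hr (braidOp_commute_tensorF_tensorE hr),
      braidRep_apply_comm hr (braidOp_commute_tensorF_tensorE hr), hx.1, map_zero]
    exact ⟨rfl, braidRep_mem_level hr g hx.2⟩

theorem highestSpace_le_dominantSpace (r n ℓ : ℕ) : highestSpace r n ℓ ≤ dominantSpace r n ℓ := by
  intro x hx
  rw [mem_highestSpace] at hx
  rw [mem_dominantSpace]
  exact ⟨by simp [hx.1], hx.2⟩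

/-- The inclusion of the highest strong weight space into the dominant space. -/
def highestIncl {r : ℕ} (hr : 2 ≤ r) (n ℓ : ℕ) :
    Representation.IntertwiningMap (highestRep hr n ℓ).toRepresentation
      (dominantRep hr n ℓ).toRepresentation :=
  restrictIntertwining _ _ 1 (highestSpace_le_dominantSpace r (n + 1) ℓ) fun _ _ => by
    rw [Module.End.one_apply, Module.End.one_apply]

theorem highestIncl_coe {r : ℕ} (hr : 2 ≤ r) (n ℓ : ℕ) (w : (highestRep hr n ℓ).toSubmodule) :
    (highestIncl hr n ℓ w : TPow r (n + 1)) = w :=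
  (restrictIntertwining_coe (T := 1) _ _ w).trans (Module.End.one_apply _)

theorem highestIncl_injective {r : ℕ} (hr : 2 ≤ r) (n ℓ : ℕ) :
    Function.Injective (highestIncl hr n ℓ) := fun v w h => Subtype.ext (by
  rw [← highestIncl_coe, h, highestIncl_coe])

section

variable {r n ℓ ℓ' : ℕ}

theorem tensorE_pow_mem_highestSpace (hr : 2 ≤ r) (hlt : ℓ' < ℓ) (hℓ : ℓ < r)
    (hc : (ℓ : ℤ) + ℓ' ≡ 1 - (n + 1 : ℕ) [ZMOD r]) {x : TPow r (n + 1)}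
    (hx : x ∈ dominantSpace r (n + 1) ℓ) :
    (tensorE r (n + 1) ^ (ℓ - ℓ')) x ∈ highestSpace r (n + 1) ℓ' := by
  obtain ⟨s, hs, hw⟩ := exists_wt_eq (by omega) hlt hc
  rw [mem_dominantSpace] at hx
  rw [mem_highestSpace, ← Module.End.mul_apply, ← pow_succ']
  refine ⟨tensorE_pow_succ_eq_zero hs hw (by omega) (by omega) (by omega) hx.2 hx.1, ?_⟩
  have := tensorE_pow_mem_level hx.2 (ℓ - ℓ')
  rwa [Nat.cast_sub hlt.le, sub_sub_cancel] at this

/-- The power of `E` that maps the dominant space onto the lower highest strong weight space. -/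
def dominantProj (hr : 2 ≤ r) (hlt : ℓ' < ℓ) (hℓ : ℓ < r)
    (hc : (ℓ : ℤ) + ℓ' ≡ 1 - (n + 1 : ℕ) [ZMOD r]) :
    Representation.IntertwiningMap (dominantRep hr n ℓ).toRepresentation
      (highestRep hr n ℓ').toRepresentation :=
  restrictIntertwining _ _ (tensorE r (n + 1) ^ (ℓ - ℓ'))
    (fun _ hx => tensorE_pow_mem_highestSpace hr hlt hℓ hc hx)
    (braidRep_apply_comm hr fun i => (braidOp_commute_tensorE hr i).pow_right _)

theorem dominantProj_coe (hr : 2 ≤ r) (hlt : ℓ' < ℓ) (hℓ : ℓ < r)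
    (hc : (ℓ : ℤ) + ℓ' ≡ 1 - (n + 1 : ℕ) [ZMOD r]) (x : (dominantRep hr n ℓ).toSubmodule) :
    (dominantProj hr hlt hℓ hc x : TPow r (n + 1)) =
      (tensorE r (n + 1) ^ (ℓ - ℓ')) x :=
  restrictIntertwining_coe _ _ x

theorem dominantProj_eq_zero_iff (hr : 2 ≤ r) (hlt : ℓ' < ℓ) (hℓ : ℓ < r)
    (hc : (ℓ : ℤ) + ℓ' ≡ 1 - (n + 1 : ℕ) [ZMOD r]) (x : (dominantRep hr n ℓ).toSubmodule) :
    dominantProj hr hlt hℓ hc x = 0 ↔ tensorE r (n + 1) (x : TPow r (n + 1)) = 0 := by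
  obtain ⟨s, hs, hw⟩ := exists_wt_eq (by omega) hlt hc
  obtain ⟨x, hx⟩ := x
  rw [← ZeroMemClass.coe_eq_zero, dominantProj_coe]
  replace hx := mem_dominantSpace.1 hx
  constructor
  · exact tensorE_eq_zero_of_pow hs hw (by omega) (by omega) (by omega) hx.2 hx.1
  · intro h
    simp only at h
    rw [show ℓ - ℓ' = ℓ - ℓ' - 1 + 1 by omega, pow_succ, Module.End.mul_apply, h, map_zero]

theorem dominantProj_surjective (hr : 2 ≤ r) (hlt : ℓ' < ℓ) (hℓ : ℓ < r)
    (hc : (ℓ : ℤ) + ℓ' ≡ 1 - (n + 1 : ℕ) [ZMOD r]) :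
    Function.Surjective (dominantProj hr hlt hℓ hc) := by
  obtain ⟨s, hs, hw⟩ := exists_wt_eq (by omega) hlt hc
  rintro ⟨w, hwm⟩
  obtain ⟨hE, hl⟩ := mem_highestSpace.1 hwm
  obtain ⟨x, hx, hD, hxw⟩ := exists_tensorE_pow_eq hs hw (by omega) (by omega) hℓ
    (by rwa [Nat.cast_sub hlt.le, sub_sub_cancel]) hE
  exact ⟨⟨x, mem_dominantSpace.2 ⟨hD, hx⟩⟩, Subtype.ext (by rw [dominantProj_coe, hxw])⟩

theorem exact_highestIncl_dominantProj (hr : 2 ≤ r) (hlt : ℓ' < ℓ) (hℓ : ℓ < r)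
    (hc : (ℓ : ℤ) + ℓ' ≡ 1 - (n + 1 : ℕ) [ZMOD r]) :
    Function.Exact (highestIncl hr n ℓ) (dominantProj hr hlt hℓ hc) := by
  intro x
  rw [dominantProj_eq_zero_iff]
  constructor
  · intro h
    exact ⟨⟨x, mem_highestSpace.2 ⟨h, (mem_dominantSpace.1 x.2).2⟩⟩,
      Subtype.ext (by rw [highestIncl_coe])⟩
  · rintro ⟨w, rfl⟩
    rw [highestIncl_coe]
    exact (mem_highestSpace.1 w.2).1

/-- The full twist is a nontrivial shear, up to a scalar, on the dominant space. -/
theorem braidRep_fullTwist_of_mem_dominantSpace (hr : 2 ≤ r) (hℓ : ℓ < r) {x : TPow r (n + 1)}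
    (hx : x ∈ dominantSpace r (n + 1) ℓ) :
    braidRep hr n (fullTwist (n + 1)) x = twistCoeff r (n + 1) ℓ 0 •
      (x + shear r (n + 1) ℓ • (tensorF r (n + 1) * tensorE r (n + 1)) x) := by
  rw [mem_dominantSpace] at hx
  rw [braidRep_fullTwist, twistOp_of_sq_eq_zero hr (by omega) hx.2 hx.1]

/-- The twist is a scalar times a unipotent operator `1 + κ FE` with `(FE)² = 0`, so powers only
multiply `κ` by `k`. -/
theorem braidRep_fullTwist_pow (hr : 2 ≤ r) (hℓ : ℓ < r) {x : TPow r (n + 1)}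
    (hx : x ∈ dominantSpace r (n + 1) ℓ) (k : ℕ) :
    (braidRep hr n (fullTwist (n + 1)) ^ k) x = twistCoeff r (n + 1) ℓ 0 ^ k •
      (x + (k * shear r (n + 1) ℓ) • (tensorF r (n + 1) * tensorE r (n + 1)) x) := by
  have hD := (mem_dominantSpace.1 hx).1
  induction k with
  | zero => simp
  | succ k ih =>
    rw [pow_succ', Module.End.mul_apply, ih, map_smul, map_add, map_smul,
      ← braidRep_apply_comm hr (braidOp_commute_tensorF_tensorE hr),
      braidRep_fullTwist_of_mem_dominantSpace hr hℓ hx, map_smul, map_add, map_smul, hD, smul_zero,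
      add_zero, smul_comm _ (twistCoeff r (n + 1) ℓ 0), ← smul_add, smul_smul, ← pow_succ,
      add_assoc, ← add_smul]
    congr 4
    push_cast; ring

theorem shear_ne_zero_of_modEq (hlt : ℓ' < ℓ) (hℓ : ℓ < r)
    (hc : (ℓ : ℤ) + ℓ' ≡ 1 - n [ZMOD r]) : shear r n ℓ ≠ 0 := by
  obtain ⟨s, hs, hw⟩ := exists_wt_eq (by omega) hlt hc
  exact shear_ne_zero hs hw (by omega) (by omega)

theorem twistCoeff_zero_ne_zero (r n : ℕ) (t : ℤ) : twistCoeff r n t 0 ≠ 0 := by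
  rw [twistCoeff_zero]
  exact zpow_ne_zero _ (q_ne_zero r)

theorem tensorF_tensorE_eq_zero_iff (hr : 2 ≤ r) (hℓ : ℓ < r) {x : TPow r (n + 1)}
    (hx : x ∈ level r (n + 1) ℓ) :
    (tensorF r (n + 1) * tensorE r (n + 1)) x = 0 ↔ tensorE r (n + 1) x = 0 :=
  ⟨fun h => tensorF_injective hr (by omega) (tensorE_mem_level hx) h,
    fun h => by rw [Module.End.mul_apply, h, map_zero]⟩

theorem exists_mem_dominantSpace (hr : 2 ≤ r) (hlt : ℓ' < ℓ) (hℓ : ℓ < r)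
    (hc : (ℓ : ℤ) + ℓ' ≡ 1 - (n + 2 : ℕ) [ZMOD r]) :
    ∃ x ∈ dominantSpace r (n + 2) ℓ, (tensorF r (n + 2) * tensorE r (n + 2)) x ≠ 0 := by
  obtain ⟨w, hw, hE, h0⟩ := exists_highest_ne_zero n (show ℓ' < r by omega)
  obtain ⟨x, hx⟩ := dominantProj_surjective (n := n + 1) hr hlt hℓ hc
    ⟨w, mem_highestSpace.2 ⟨hE, hw⟩⟩
  refine ⟨x, x.2, fun h => h0 ?_⟩
  have h1 := (tensorF_tensorE_eq_zero_iff hr hℓ (mem_dominantSpace.1 x.2).2).1 h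
  exact congrArg Subtype.val (hx.symm.trans ((dominantProj_eq_zero_iff hr hlt hℓ hc x).2 h1))

/-- The twist is scalar on `W_{n,ℓ'}`, hence on the image of a section. For `x` in that image over
`w ≠ 0` one has `FE x ≠ 0`, while the twist acts as `Λ (1 + κ FE)` with `κ ≠ 0`. -/
theorem dominantProj_not_split (hr : 2 ≤ r) (hlt : ℓ' < ℓ) (hℓ : ℓ < r)
    (hc : (ℓ : ℤ) + ℓ' ≡ 1 - (n + 2 : ℕ) [ZMOD r]) :
    ¬ ∃ σ : Representation.IntertwiningMap (highestRep hr (n + 1) ℓ').toRepresentation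
        (dominantRep hr (n + 1) ℓ).toRepresentation,
      ∀ w, dominantProj (n := n + 1) hr hlt hℓ hc (σ w) = w := by
  rintro ⟨σ, hσ⟩
  obtain ⟨w, hw, hE, h0⟩ := exists_highest_ne_zero n (show ℓ' < r by omega)
  let w' : (highestRep hr (n + 1) ℓ').toSubmodule := ⟨w, mem_highestSpace.2 ⟨hE, hw⟩⟩
  obtain ⟨x, hx⟩ : ∃ x : (dominantRep hr (n + 1) ℓ).toSubmodule, x = σ w' := ⟨_, rfl⟩
  have hxm := (mem_dominantSpace.1 x.2)
  have hD : (tensorF r (n + 2) * tensorE r (n + 2)) (x : TPow r (n + 2)) ≠ 0 := by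
    intro h
    have h1 := (dominantProj_eq_zero_iff (n := n + 1) hr hlt hℓ hc x).2
      ((tensorF_tensorE_eq_zero_iff hr hℓ hxm.2).1 h)
    rw [hx, hσ] at h1
    exact h0 (congrArg Subtype.val h1)
  have hθ : (highestRep hr (n + 1) ℓ').toRepresentation (fullTwist (n + 2)) w' =
      twistCoeff r (n + 2) ℓ' 0 • w' := by
    apply Subtype.ext
    rw [toRepresentation_coe, Submodule.coe_smul, braidRep_fullTwist, twistOp_of_highest hr (by omega) hw hE]
  have h1 : braidRep hr (n + 1) (fullTwist (n + 2)) (x : TPow r (n + 2)) =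
      twistCoeff r (n + 2) ℓ' 0 • (x : TPow r (n + 2)) := by
    have h2 := Representation.IntertwiningMap.isIntertwining _ _ σ (fullTwist (n + 2)) w'
    rw [hθ, map_smul, ← hx] at h2
    rw [← toRepresentation_coe (dominantRep hr (n + 1) ℓ), ← h2, Submodule.coe_smul]
  rw [braidRep_fullTwist_of_mem_dominantSpace hr hℓ x.2] at h1
  -- Applying `FE` removes the shear term and shows that the two scalars coincide; substituted back,
  -- this leaves `κ FE x = 0`.
  have h2 := congrArg (tensorF r (n + 2) * tensorE r (n + 2)) h1
  rw [map_smul, map_add, map_smul, hxm.1, smul_zero, add_zero, map_smul] at h2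
  rw [smul_left_injective ℂ hD h2, smul_right_inj (twistCoeff_zero_ne_zero _ _ _),
    add_eq_left, smul_eq_zero] at h1
  exact h1.elim (shear_ne_zero_of_modEq hlt hℓ hc) hD

theorem braidRep_fullTwist_pow_ne (hr : 2 ≤ r) (hlt : ℓ' < ℓ) (hℓ : ℓ < r)
    (hc : (ℓ : ℤ) + ℓ' ≡ 1 - (n + 2 : ℕ) [ZMOD r]) {k : ℕ} (hk : 0 < k) :
    (dominantRep hr (n + 1) ℓ).toRepresentation (fullTwist (n + 2)) ^ k ≠ 1 := by
  intro h
  obtain ⟨x, hx, hD⟩ := exists_mem_dominantSpace hr hlt hℓ hc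
  rw [← map_pow] at h
  have h1 := congrArg Subtype.val (LinearMap.congr_fun h (⟨x, hx⟩ : (dominantRep hr (n + 1) ℓ).toSubmodule))
  rw [toRepresentation_coe, Module.End.one_apply, map_pow, braidRep_fullTwist_pow hr hℓ hx] at h1
  have h2 := congrArg (tensorF r (n + 2) * tensorE r (n + 2)) h1
  rw [map_smul, map_add, map_smul, (mem_dominantSpace.1 hx).1, smul_zero, add_zero] at h2
  nth_rewrite 2 [← one_smul ℂ ((tensorF r (n + 2) * tensorE r (n + 2)) x)] at h2
  rw [smul_left_injective ℂ hD h2, one_smul, add_eq_left, smul_eq_zero, mul_eq_zero] at h1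
  rcases h1 with (h1 | h1) | h1
  · exact hk.ne' (by exact_mod_cast h1)
  · exact shear_ne_zero_of_modEq hlt hℓ hc h1
  · exact hD h1

theorem dominantRep_fullTwist_not_isOfFinOrder (hr : 2 ≤ r) (hlt : ℓ' < ℓ) (hℓ : ℓ < r)
    (hc : (ℓ : ℤ) + ℓ' ≡ 1 - (n + 2 : ℕ) [ZMOD r]) :
    ¬ IsOfFinOrder ((dominantRep hr (n + 1) ℓ).toRepresentation (fullTwist (n + 2))) := by
  rw [isOfFinOrder_iff_pow_eq_one]
  rintro ⟨k, hk, h⟩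
  exact braidRep_fullTwist_pow_ne hr hlt hℓ hc hk h

/-- If a central `z` acts trivially, so does the power of the full twist given by its exponent sum.
Infinite order makes this exponent zero, and then `z = 1`. -/
theorem dominantRep_center_injective (hr : 2 ≤ r) (hlt : ℓ' < ℓ) (hℓ : ℓ < r)
    (hc : (ℓ : ℤ) + ℓ' ≡ 1 - (n + 2 : ℕ) [ZMOD r]) :
    Function.Injective fun z : Subgroup.center (BraidGroup (n + 2)) =>
      (dominantRep hr (n + 1) ℓ).toRepresentation (z : BraidGroup (n + 2)) := by
  have key : ∀ z ∈ Subgroup.center (BraidGroup (n + 2)),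
      (dominantRep hr (n + 1) ℓ).toRepresentation z = 1 → z = 1 := by
    intro z hz h
    have hp := pow_eq_fullTwist_zpow hz
    refine eq_one_of_mem_center_of_expSum hz ?_
    by_contra hne
    obtain ⟨e, he⟩ : ∃ e : ℤ, expSum (n + 2) z = Multiplicative.ofAdd e := ⟨_, rfl⟩
    have he0 : e ≠ 0 := by rintro rfl; exact hne he
    rw [he, toAdd_ofAdd] at hp
    have h1 : (dominantRep hr (n + 1) ℓ).toRepresentation (fullTwist (n + 2) ^ e) = 1 := by
      rw [← hp, map_pow, h, one_pow]
    apply braidRep_fullTwist_pow_ne hr hlt hℓ hc (Int.natAbs_pos.2 he0)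
    rw [← map_pow]
    rcases Int.natAbs_eq e with h2 | h2
    · rw [h2, zpow_natCast] at h1
      exact h1
    · rw [h2, zpow_neg, zpow_natCast] at h1
      have h3 : (dominantRep hr (n + 1) ℓ).toRepresentation (fullTwist (n + 2) ^ e.natAbs) *
          (dominantRep hr (n + 1) ℓ).toRepresentation (fullTwist (n + 2) ^ e.natAbs)⁻¹ = 1 := by
        rw [← map_mul, mul_inv_cancel, map_one]
      rwa [h1, mul_one] at h3
  intro y z h
  have h1 := key (y * (z : BraidGroup (n + 2))⁻¹) (mul_mem y.2 (inv_mem z.2)) (by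
    simp only at h
    rw [map_mul, h, ← map_mul, mul_inv_cancel, map_one])
  exact Subtype.ext (mul_inv_eq_one.1 h1)

end

end QuantumBraid

end

open QuantumBraid in
theorem mainTheorem1 (n ℓ : ℕ) (hn : 2 ≤ n) (hℓ : 1 ≤ ℓ) :
    (∃ r ℓ' : ℕ, ℓ' < ℓ ∧ ℓ < r ∧ (ℓ : ℤ) + ℓ' ≡ 1 - n [ZMOD r]) ∧
    ∀ r ℓ' : ℕ, ℓ' < ℓ → ℓ < r → (ℓ : ℤ) + ℓ' ≡ 1 - n [ZMOD r] →
      ∃ ρ : Representation ℂ (BraidGroup n) (TPow r n),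
        (∀ i : Fin (n - 1), ρ (sigma i) = braidOp r n i) ∧
        ∃ W W' N : Subrepresentation ρ,
          W.toSubmodule = highestSpace r n ℓ ∧
          W'.toSubmodule = highestSpace r n ℓ' ∧
          N.toSubmodule = dominantSpace r n ℓ ∧
          (∃ (ι : Representation.IntertwiningMap W.toRepresentation N.toRepresentation)
             (π : Representation.IntertwiningMap N.toRepresentation W'.toRepresentation),
            (∀ w, (ι w : TPow r n) = w) ∧
            Function.Injective ι ∧ Function.Exact ι π ∧ Function.Surjective π ∧
            ¬ ∃ s : Representation.IntertwiningMap W'.toRepresentation N.toRepresentation,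
                ∀ w, π (s w) = w) ∧
          (Function.Injective
            fun z : Subgroup.center (BraidGroup n) => N.toRepresentation (z : BraidGroup n)) ∧
          ¬ IsOfFinOrder (N.toRepresentation (fullTwist n)) := by
  -- With `ℓ' = 0` the congruence asks that `r` divide `ℓ + n - 1`; taking equality gives `r > ℓ`
  -- because `n ≥ 2`.
  refine ⟨⟨ℓ + n - 1, 0, by omega, by omega, ?_⟩, fun r ℓ' hlt hℓr hc => ?_⟩
  · rw [Int.modEq_iff_dvd]
    exact ⟨-1, by push_cast [Nat.cast_sub (show 1 ≤ ℓ + n by omega)]; ring⟩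
  · obtain ⟨n, rfl⟩ : ∃ k, n = k + 2 := ⟨n - 2, by omega⟩
    have hr : 2 ≤ r := by omega
    exact ⟨braidRep hr (n + 1), fun i => braidRep_sigma hr (n + 1) i,
      highestRep hr (n + 1) ℓ, highestRep hr (n + 1) ℓ', dominantRep hr (n + 1) ℓ, rfl, rfl, rfl,
      ⟨highestIncl hr (n + 1) ℓ, dominantProj (n := n + 1) hr hlt hℓr hc, highestIncl_coe hr (n + 1) ℓ,
        highestIncl_injective hr (n + 1) ℓ, exact_highestIncl_dominantProj (n := n + 1) hr hlt hℓr hc,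
        dominantProj_surjective (n := n + 1) hr hlt hℓr hc,
        dominantProj_not_split hr hlt hℓr hc⟩,
      dominantRep_center_injective hr hlt hℓr hc,
      dominantRep_fullTwist_not_isOfFinOrder hr hlt hℓr hc⟩
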